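/- Let $d>2$, let $\zeta\in\mathbb{C}$ be a primitive $d$-th root of unity, and let $W=\langle s\rangle$ be the cyclic group of order $d$ acting on $V=\mathbb{C}$, where $s$ acts by multiplication by $\zeta$. Let $R=\mathcal{O}(V)=\mathbb{C}[X]$ with $\deg X=2$. For $A\subseteq W$ let $\mathcal{O}(A)$ be the graded $R$-bimodule of regular functions on $\bigcup_{x\in A}\{(xu,u)\mid u\in V\}\subseteq V\times V$, where $R$ acts on the left (right) through the first (second) projection. For a graded bimodule $M$ let $M[n]$ be the shift with $M[n]_i=M_{n+i}$. Let $\mathcal{B}_W$ be the full subcategory of graded $R$-bimodules generated by $\mathcal{O}(\{e,s\})$ under $\otimes_R$ (with unit $R$), finite direct sums, grading shifts, direct summands and isomorphisms. Let $A_W$ be its split Grothendieck ring, a $\mathbb{Z}[v^{\pm1}]$-algebra via $v\langle M\rangle=\langle M[1]\rangle$, with $\langle M\oplus N\rangle=\langle M\rangle+\langle N\rangle$ and $\langle M\rangle\langle N\rangle=\langle M\otimes_R N\rangle$. Then $\mathcal{O}(\{s\})$ is an object of $\mathcal{B}_W$. Write $s$ also for its class in $A_W$, let $C=\langle\mathcal{O}(\{e,s\})[1]\rangle$,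 and define $T_s$ by $C=T_s+v$. Let $\overline{A}_W=A_W/(s=1)$ be the quotient of $A_W$ by the two-sided ideal generated by $s-1$. There are $a_0,\dots,a_{d-1}\in\mathbb{Z}[v^{\pm1}]$ such that the $\mathbb{Z}[v^{\pm1}]$-algebra $\overline{A}_W$ is presented by the single generator $T_s$ and the single relation $$T_s^d+a_{d-1}T_s^{d-1}+\dots+a_1T_s+a_0=0;$$ that is, $T\mapsto T_s$ induces an isomorphism $\mathbb{Z}[v^{\pm1}][T]/(T^d+a_{d-1}T^{d-1}+\dots+a_0)\cong\overline{A}_W$. Moreover $a_0\neq0$. Let $K=\mathbb{Z}[v^{\pm1}][a_0^{-1}]$, and let $$H=\mathbb{Z}[u_0^{\pm1},u_1,\dots,u_{d-1}][\sigma^{\pm1}]\big/\big(\sigma^d+u_{d-1}\sigma^{d-1}+\dots+u_1\sigma+u_0\big)$$ be the generic Hecke algebra of $W$, that is, the quotient of the group algebra of the braid group $\langle\sigma\rangle\cong\mathbb{Z}$ of $W$ over $\mathbb{Z}[u_0^{\pm1},u_1,\dots,u_{d-1}]$ by this relation. Then the localization $K\otimes_{\mathbb{Z}[v^{\pm1}]}\overline{A}_W$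 is isomorphic as a $K$-algebra, via $1\otimes T_s\mapsto1\otimes\sigma$, to the one-parameter specialization $K\otimes H$ of $H$ along the ring homomorphism $\mathbb{Z}[u_0^{\pm1},u_1,\dots,u_{d-1}]\to K$, $u_i\mapsto a_i$. -/

import Mathlib

open scoped TensorProduct

namespace SoergelRankOne

/-- A grading on a vector space is internal as soon as the homogeneous parts span and there is a
linear map into finitely supported families that sends each homogeneous element `m` of degree `i`
to the family with `m` in position `i`. -/
theorem isInternal_of_lift {M : Type} [AddCommGroup M] [Module ℂ M] (gr : ℤ → Submodule ℂ M)
    (c : M →ₗ[ℂ] (ℤ →₀ M)) (hc : ∀ i, ∀ m ∈ gr i, c m = Finsupp.single i m)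
    (top : ⨆ i, gr i = ⊤) : DirectSum.IsInternal gr := by
  refine ⟨?_, ?_⟩
  · have key : c.comp (DirectSum.coeLinearMap gr) = DirectSum.toModule ℂ ℤ (ℤ →₀ M)
        (fun j => (Finsupp.lsingle j).comp (gr j).subtype) := by
      ext1 j
      ext1 x
      simp [DirectSum.toModule_lof, hc j x x.2]
    have comp : ∀ (w : DirectSum ℤ fun j => gr j) (i : ℤ), DirectSum.toModule ℂ ℤ (ℤ →₀ M)
        (fun j => (Finsupp.lsingle j).comp (gr j).subtype) w i = (w i : M) := by
      intro w i
      induction w using DirectSum.induction_on with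
      | zero => simp
      | of j x =>
        rw [← DirectSum.lof_eq_of ℂ, DirectSum.toModule_lof]
        by_cases h : j = i
        · subst h; simp [DirectSum.lof_eq_of]
        · simp [DirectSum.lof_eq_of, DirectSum.of_eq_of_ne _ _ _ (Ne.symm h), h]
      | add x y hx hy => simp [hx, hy]
    intro w w' h
    have h' : DirectSum.coeLinearMap gr w = DirectSum.coeLinearMap gr w' := h
    refine DFinsupp.ext (fun i => Subtype.ext ?_)
    rw [← comp w i, ← comp w' i, ← key, LinearMap.comp_apply, h', LinearMap.comp_apply]
  · have := (Submodule.iSup_eq_range_dfinsupp_lsum gr)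
    rw [top] at this
    exact LinearMap.range_eq_top.1 this.symm

/-- The decomposition into homogeneous components for an internal grading. -/
theorem exists_lift {M : Type} [AddCommGroup M] [Module ℂ M] (gr : ℤ → Submodule ℂ M)
    (h : DirectSum.IsInternal gr) :
    ∃ c : M →ₗ[ℂ] (ℤ →₀ M), ∀ i, ∀ m ∈ gr i, c m = Finsupp.single i m := by
  let e := LinearEquiv.ofBijective (DirectSum.coeLinearMap gr) h
  refine ⟨(DirectSum.toModule ℂ ℤ (ℤ →₀ M)
    (fun j => (Finsupp.lsingle j).comp (gr j).subtype)).comp e.symm.toLinearMap, ?_⟩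
  intro i m hm
  have : e.symm m = DirectSum.lof ℂ ℤ (fun j => gr j) i ⟨m, hm⟩ := by
    rw [LinearEquiv.symm_apply_eq]
    exact (DirectSum.coeLinearMap_lof gr i ⟨m, hm⟩).symm
  simp [this]

/-- A graded `R`-bimodule for `R = ℂ[X]`, `deg X = 2`, on which `ℂ` acts in the same way from both
sides: a `ℤ`-graded complex vector space with two commuting endomorphisms of degree `2`, the left
multiplication `lX` and the right multiplication `rX` by `X`. -/
structure GrBimod : Type 1 where
  carrier : Type
  [addCommGroup : AddCommGroup carrier]
  [module : Module ℂ carrier]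
  lX : carrier →ₗ[ℂ] carrier
  rX : carrier →ₗ[ℂ] carrier
  lX_rX : ∀ m, lX (rX m) = rX (lX m)
  gr : ℤ → Submodule ℂ carrier
  isInternal : DirectSum.IsInternal gr
  lX_mem : ∀ i, ∀ m ∈ gr i, lX m ∈ gr (i + 2)
  rX_mem : ∀ i, ∀ m ∈ gr i, rX m ∈ gr (i + 2)

namespace GrBimod

instance : CoeSort GrBimod (Type) := ⟨GrBimod.carrier⟩

attribute [instance] GrBimod.addCommGroup GrBimod.module

/-- An isomorphism of graded bimodules: a linear bijection of degree zero that commutes with the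
left and right actions. -/
structure Iso (M N : GrBimod) where
  e : M ≃ₗ[ℂ] N
  map_lX : ∀ m, e (M.lX m) = N.lX (e m)
  map_rX : ∀ m, e (M.rX m) = N.rX (e m)
  mem_gr : ∀ i m, e m ∈ N.gr i ↔ m ∈ M.gr i

/-- The shift `M[n]`, with `M[n]_i = M_{n+i}`. -/
def shift (M : GrBimod) (n : ℤ) : GrBimod where
  carrier := M
  lX := M.lX
  rX := M.rX
  lX_rX := M.lX_rX
  gr i := M.gr (n + i)
  isInternal := by
    obtain ⟨c, hc⟩ := exists_lift _ M.isInternal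
    refine isInternal_of_lift _ ((Finsupp.lmapDomain M ℂ (fun j => j - n)).comp c) ?_ ?_
    · intro i m hm
      simp [hc _ _ hm]
    · rw [eq_top_iff, ← M.isInternal.submodule_iSup_eq_top, iSup_le_iff]
      intro i
      refine le_trans (le_of_eq ?_) (le_iSup _ (i - n))
      simp
  lX_mem i m hm := by simpa [add_assoc] using M.lX_mem _ m hm
  rX_mem i m hm := by simpa [add_assoc] using M.rX_mem _ m hm

/-- The direct sum `M ⊕ N`. -/
def sum (M N : GrBimod) : GrBimod where
  carrier := M × N
  lX := M.lX.prodMap N.lX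
  rX := M.rX.prodMap N.rX
  lX_rX m := by simp [M.lX_rX, N.lX_rX]
  gr i := (M.gr i).prod (N.gr i)
  isInternal := by
    obtain ⟨c, hc⟩ := exists_lift _ M.isInternal
    obtain ⟨c', hc'⟩ := exists_lift _ N.isInternal
    refine isInternal_of_lift _
      (LinearMap.coprod ((Finsupp.mapRange.linearMap (LinearMap.inl ℂ M N)).comp c)
        ((Finsupp.mapRange.linearMap (LinearMap.inr ℂ M N)).comp c')) ?_ ?_
    · rintro i ⟨m, n⟩ ⟨hm, hn⟩
      simp [hc _ _ hm, hc' _ _ hn, ← Finsupp.single_add]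
    · rw [eq_top_iff, ← Submodule.prod_top, ← M.isInternal.submodule_iSup_eq_top,
        ← N.isInternal.submodule_iSup_eq_top]
      rintro ⟨m, n⟩ ⟨hm, hn⟩
      have h1 : ((m, 0) : M × N) ∈ ⨆ i, (M.gr i).prod (N.gr i) := by
        have := Submodule.mem_map_of_mem (f := LinearMap.inl ℂ M N) hm
        rw [Submodule.map_iSup] at this
        refine SetLike.le_def.1 (iSup_mono fun i => ?_) this
        rintro _ ⟨x, hx, rfl⟩
        exact ⟨hx, (N.gr i).zero_mem⟩
      have h2 : ((0, n) : M × N) ∈ ⨆ i, (M.gr i).prod (N.gr i) := by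
        have := Submodule.mem_map_of_mem (f := LinearMap.inr ℂ M N) hn
        rw [Submodule.map_iSup] at this
        refine SetLike.le_def.1 (iSup_mono fun i => ?_) this
        rintro _ ⟨x, hx, rfl⟩
        exact ⟨(M.gr i).zero_mem, hx⟩
      simpa using add_mem h1 h2
  lX_mem i m hm := ⟨M.lX_mem i _ hm.1, N.lX_mem i _ hm.2⟩
  rX_mem i m hm := ⟨M.rX_mem i _ hm.1, N.rX_mem i _ hm.2⟩

/-- The regular bimodule `R = ℂ[X]`; the monomial `X ^ k` has degree `2 * k`. -/
noncomputable def unit : GrBimod where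
  carrier := Polynomial ℂ
  lX := LinearMap.mulLeft ℂ Polynomial.X
  rX := LinearMap.mulLeft ℂ Polynomial.X
  lX_rX _ := rfl
  gr i := Submodule.span ℂ {p | ∃ k : ℕ, 2 * (k : ℤ) = i ∧ p = Polynomial.X ^ k}
  isInternal := by
    refine isInternal_of_lift _ ((Polynomial.basisMonomials ℂ).constr ℂ
      (fun k => Finsupp.single (2 * (k : ℤ)) (Polynomial.X ^ k))) ?_ ?_
    · intro i m hm
      induction hm using Submodule.span_induction with
      | mem x h =>
        obtain ⟨k, rfl, rfl⟩ := h
        have h := (Polynomial.basisMonomials ℂ).constr_basis ℂ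
          (fun k => Finsupp.single (2 * (k : ℤ)) (Polynomial.X ^ k : Polynomial ℂ)) k
        refine Eq.trans (congrArg _ ?_) h
        exact (Polynomial.monomial_one_right_eq_X_pow k).symm
      | zero => simp
      | add x y _ _ hx hy => rw [map_add, hx, hy, Finsupp.single_add]
      | smul a x _ hx => rw [map_smul, hx, Finsupp.smul_single]
    · rw [eq_top_iff, ← (Polynomial.basisMonomials ℂ).span_eq, Submodule.span_le]
      rintro _ ⟨k, rfl⟩
      refine Submodule.mem_iSup_of_mem (2 * (k : ℤ)) (Submodule.subset_span ⟨k, rfl, ?_⟩)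
      rw [Polynomial.coe_basisMonomials, ← Polynomial.monomial_one_right_eq_X_pow]
  lX_mem i m hm := by
    induction hm using Submodule.span_induction with
    | mem x h =>
      obtain ⟨k, rfl, rfl⟩ := h
      exact Submodule.subset_span ⟨k + 1, by push_cast; ring, by
        simp [pow_succ']⟩
    | zero => simp
    | add x y _ _ hx hy => rw [map_add]; exact add_mem hx hy
    | smul a x _ hx => rw [map_smul]; exact Submodule.smul_mem _ _ hx
  rX_mem i m hm := by
    induction hm using Submodule.span_induction with
    | mem x h =>
      obtain ⟨k, rfl, rfl⟩ := h
      exact Submodule.subset_span ⟨k + 1, by push_cast; ring, by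
        simp [pow_succ']⟩
    | zero => simp
    | add x y _ _ hx hy => rw [map_add]; exact add_mem hx hy
    | smul a x _ hx => rw [map_smul]; exact Submodule.smul_mem _ _ hx

/-- The union over `x ∈ A` of the reversed graphs `{(x v, v)}` in `ℂ × ℂ`, where a scalar `x` acts
on the line `ℂ` by multiplication. -/
def graphs (A : Set ℂ) : Set (Fin 2 → ℂ) := {p | ∃ x ∈ A, ∃ v : ℂ, p = ![x * v, v]}

/-- The ideal of the polynomials in two variables that vanish on the reversed graphs. -/
noncomputable def graphIdeal (A : Set ℂ) : Ideal (MvPolynomial (Fin 2) ℂ) :=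
  MvPolynomial.vanishingIdeal ℂ (graphs A)

theorem aeval_smul_of_isHomogeneous {k : ℕ} {p : MvPolynomial (Fin 2) ℂ} (hp : p.IsHomogeneous k)
    (t x y : ℂ) :
    MvPolynomial.aeval ![t * x, t * y] p = t ^ k * MvPolynomial.aeval ![x, y] p := by
  rw [MvPolynomial.aeval_def, MvPolynomial.aeval_def, MvPolynomial.eval₂_eq',
    MvPolynomial.eval₂_eq', Finset.mul_sum]
  refine Finset.sum_congr rfl (fun s hs => ?_)
  have h := hp.degree_eq_sum_deg_support hs
  rw [Finset.sum_subset (Finset.subset_univ _) (fun i _ hi => by simpa using hi),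
    Fin.sum_univ_two] at h
  simp only [Fin.prod_univ_two, Matrix.cons_val_zero, Matrix.cons_val_one, mul_pow]
  rw [h, pow_add]
  ring

theorem homogeneousComponent_mem_graphIdeal (A : Set ℂ) (n : ℕ) (p : MvPolynomial (Fin 2) ℂ)
    (hp : p ∈ graphIdeal A) : MvPolynomial.homogeneousComponent n p ∈ graphIdeal A := by
  rintro _ ⟨x, hx, v, rfl⟩
  let q : Polynomial ℂ := ∑ k ∈ Finset.range (p.totalDegree + 1), Polynomial.monomial k
    (MvPolynomial.aeval ![x * v, v] (MvPolynomial.homogeneousComponent k p))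
  have key : q = 0 := by
    refine Polynomial.funext (fun t => ?_)
    have h1 := hp ![x * (t * v), t * v] ⟨x, hx, t * v, rfl⟩
    rw [← MvPolynomial.sum_homogeneousComponent p, map_sum] at h1
    rw [Polynomial.eval_zero, ← h1, Polynomial.eval_finsetSum]
    refine Finset.sum_congr rfl (fun k _ => ?_)
    rw [Polynomial.eval_monomial, mul_left_comm x t v, aeval_smul_of_isHomogeneous
      (MvPolynomial.homogeneousComponent_isHomogeneous k p), mul_comm]
  by_cases hn : n ∈ Finset.range (p.totalDegree + 1)
  · have h2 := congrArg (fun r => Polynomial.coeff r n) key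
    simpa [q, Polynomial.finsetSum_coeff, Polynomial.coeff_monomial, hn] using h2
  · rw [MvPolynomial.homogeneousComponent_eq_zero, map_zero]
    simpa using hn

/-- The ring `𝒪(A)` of regular functions on the union of the reversed graphs of the elements
of `A`, with the bimodule structure given by the two projections to `ℂ`: the left (right)
multiplication by `X` is the multiplication by the first (second) coordinate function. Both
coordinate functions have degree `2`. -/
noncomputable def coordRing (A : Set ℂ) : GrBimod where
  carrier := MvPolynomial (Fin 2) ℂ ⧸ graphIdeal A
  lX := LinearMap.mulLeft ℂ (Ideal.Quotient.mk _ (MvPolynomial.X 0))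
  rX := LinearMap.mulLeft ℂ (Ideal.Quotient.mk _ (MvPolynomial.X 1))
  lX_rX m := mul_left_comm _ _ _
  gr i := Submodule.span ℂ {f | ∃ (k : ℕ) (p : MvPolynomial (Fin 2) ℂ), 2 * (k : ℤ) = i ∧
    p.IsHomogeneous k ∧ f = Ideal.Quotient.mk (graphIdeal A) p}
  isInternal := by
    let π : MvPolynomial (Fin 2) ℂ →ₗ[ℂ] (MvPolynomial (Fin 2) ℂ ⧸ graphIdeal A) :=
      (Ideal.Quotient.mkₐ ℂ (graphIdeal A)).toLinearMap
    let c₀ : MvPolynomial (Fin 2) ℂ →ₗ[ℂ] (ℤ →₀ (MvPolynomial (Fin 2) ℂ ⧸ graphIdeal A)) :=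
      (MvPolynomial.basisMonomials (Fin 2) ℂ).constr ℂ
        (fun s => Finsupp.single (2 * (s.degree : ℤ)) (π (MvPolynomial.monomial s 1)))
    have hmon : ∀ s a, c₀ (MvPolynomial.monomial s a) =
        Finsupp.single (2 * (s.degree : ℤ)) (π (MvPolynomial.monomial s a)) := by
      intro s a
      have h := (MvPolynomial.basisMonomials (Fin 2) ℂ).constr_basis ℂ
        (fun s => Finsupp.single (2 * (s.degree : ℤ)) (π (MvPolynomial.monomial s 1))) s
      rw [MvPolynomial.coe_basisMonomials] at h
      have h' : (MvPolynomial.monomial s a : MvPolynomial (Fin 2) ℂ) =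
          a • MvPolynomial.monomial s 1 := by
        rw [MvPolynomial.smul_monomial, smul_eq_mul, mul_one]
      rw [h', map_smul, map_smul, ← Finsupp.smul_single]
      exact congrArg (fun z => a • z) h
    have hhom : ∀ (k : ℕ) (p : MvPolynomial (Fin 2) ℂ), p.IsHomogeneous k →
        c₀ p = Finsupp.single (2 * (k : ℤ)) (π p) := by
      intro k p hp
      conv_lhs => rw [p.as_sum]
      conv_rhs => rw [p.as_sum]
      rw [map_sum, map_sum, ← Finsupp.lsingle_apply (R := ℂ), map_sum]
      refine Finset.sum_congr rfl (fun s hs => ?_)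
      rw [hmon, Finsupp.lsingle_apply, hp.degree_eq_sum_deg_support hs]
      rfl
    have hker : LinearMap.ker π ≤ LinearMap.ker c₀ := by
      intro p hp
      have hp' : p ∈ graphIdeal A := Ideal.Quotient.eq_zero_iff_mem.1 hp
      rw [LinearMap.mem_ker, ← MvPolynomial.sum_homogeneousComponent p, map_sum]
      refine Finset.sum_eq_zero (fun k _ => ?_)
      rw [hhom k _ (MvPolynomial.homogeneousComponent_isHomogeneous k p)]
      have : π (MvPolynomial.homogeneousComponent k p) = 0 :=
        Ideal.Quotient.eq_zero_iff_mem.2 (homogeneousComponent_mem_graphIdeal A k p hp')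
      rw [this, Finsupp.single_zero]
    have hπ : Function.Surjective π := Ideal.Quotient.mk_surjective
    let c : (MvPolynomial (Fin 2) ℂ ⧸ graphIdeal A) →ₗ[ℂ] _ :=
      (LinearMap.ker π).liftQ c₀ hker ∘ₗ (π.quotKerEquivOfSurjective hπ).symm.toLinearMap
    have hc : ∀ p, c (π p) = c₀ p := by
      intro p
      have : (π.quotKerEquivOfSurjective hπ).symm (π p) = Submodule.Quotient.mk p := by
        rw [LinearEquiv.symm_apply_eq]; rfl
      simp [c, this]
    refine isInternal_of_lift _ c ?_ ?_
    · intro i m hm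
      induction hm using Submodule.span_induction with
      | mem x h =>
        obtain ⟨k, p, rfl, hp, rfl⟩ := h
        exact (hc p).trans (hhom k p hp)
      | zero => simp
      | add x y _ _ hx hy => rw [map_add, hx, hy, Finsupp.single_add]
      | smul a x _ hx => rw [map_smul, hx, Finsupp.smul_single]
    · rw [eq_top_iff]
      rintro f -
      obtain ⟨p, rfl⟩ := Ideal.Quotient.mk_surjective f
      rw [← MvPolynomial.sum_homogeneousComponent p, map_sum]
      refine Submodule.sum_mem _ (fun k _ => ?_)
      exact Submodule.mem_iSup_of_mem (2 * (k : ℤ)) (Submodule.subset_span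
        ⟨k, _, rfl, MvPolynomial.homogeneousComponent_isHomogeneous k p, rfl⟩)
  lX_mem i m hm := by
    induction hm using Submodule.span_induction with
    | mem x h =>
      obtain ⟨k, p, rfl, hp, rfl⟩ := h
      exact Submodule.subset_span ⟨k + 1, MvPolynomial.X 0 * p, by push_cast; ring, by
        rw [add_comm k 1]; exact (MvPolynomial.isHomogeneous_X ℂ 0).mul hp, by simp⟩
    | zero => simp
    | add x y _ _ hx hy => rw [map_add]; exact add_mem hx hy
    | smul a x _ hx => rw [map_smul]; exact Submodule.smul_mem _ _ hx
  rX_mem i m hm := by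
    induction hm using Submodule.span_induction with
    | mem x h =>
      obtain ⟨k, p, rfl, hp, rfl⟩ := h
      exact Submodule.subset_span ⟨k + 1, MvPolynomial.X 1 * p, by push_cast; ring, by
        rw [add_comm k 1]; exact (MvPolynomial.isHomogeneous_X ℂ 1).mul hp, by simp⟩
    | zero => simp
    | add x y _ _ hx hy => rw [map_add]; exact add_mem hx hy
    | smul a x _ hx => rw [map_smul]; exact Submodule.smul_mem _ _ hx

/-- The subspace of `M ⊗[ℂ] N` spanned by the `m X ⊗ n - m ⊗ X n`. -/
def tensorRel (M N : GrBimod) : Submodule ℂ (M ⊗[ℂ] N) :=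
  LinearMap.range (TensorProduct.map M.rX LinearMap.id - TensorProduct.map LinearMap.id N.lX)

/-- The class of `m ⊗ n` in the tensor product over `R`. -/
def tmk (M N : GrBimod) : M →ₗ[ℂ] N →ₗ[ℂ] ((M ⊗[ℂ] N) ⧸ tensorRel M N) :=
  (TensorProduct.mk ℂ M N).compr₂ (tensorRel M N).mkQ

theorem tmk_rel (M N : GrBimod) (m : M) (n : N) : tmk M N (M.rX m) n = tmk M N m (N.lX n) := by
  refine (Submodule.Quotient.eq _).2 ⟨m ⊗ₜ n, ?_⟩
  simp

theorem tensor_induction {M N : GrBimod} {motive : ((M ⊗[ℂ] N) ⧸ tensorRel M N) → Prop}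
    (tmul : ∀ m n, motive (tmk M N m n)) (add : ∀ x y, motive x → motive y → motive (x + y))
    (x : (M ⊗[ℂ] N) ⧸ tensorRel M N) : motive x := by
  induction x using Submodule.Quotient.induction_on with
  | H z =>
    induction z using TensorProduct.induction_on with
    | zero => simpa using tmul 0 0
    | tmul m n => exact tmul m n
    | add x y hx hy => exact add _ _ hx hy

/-- The linear map out of the tensor product over `R` given by a balanced bilinear map. -/
def tlift {M N : GrBimod} {V : Type} [AddCommGroup V] [Module ℂ V] (f : M →ₗ[ℂ] N →ₗ[ℂ] V)
    (hf : ∀ m n, f (M.rX m) n = f m (N.lX n)) : ((M ⊗[ℂ] N) ⧸ tensorRel M N) →ₗ[ℂ] V :=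
  (tensorRel M N).liftQ (TensorProduct.lift f) (by
    rintro _ ⟨z, rfl⟩
    induction z using TensorProduct.induction_on with
    | zero => simp
    | tmul m n => simp [hf]
    | add x y hx hy => rw [map_add]; exact add_mem hx hy)

@[simp]
theorem tlift_tmk {M N : GrBimod} {V : Type} [AddCommGroup V] [Module ℂ V]
    (f : M →ₗ[ℂ] N →ₗ[ℂ] V) (hf : ∀ m n, f (M.rX m) n = f m (N.lX n)) (m : M) (n : N) :
    tlift f hf (tmk M N m n) = f m n := by
  simp [tlift, tmk]

theorem mem_iSup_gr (M : GrBimod) (m : M) : m ∈ ⨆ i, M.gr i := by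
  rw [M.isInternal.submodule_iSup_eq_top]; trivial

theorem homogeneous_induction (M : GrBimod) {motive : M → Prop}
    (hom : ∀ i, ∀ m ∈ M.gr i, motive m) (add : ∀ x y, motive x → motive y → motive (x + y))
    (m : M) : motive m := by
  induction M.mem_iSup_gr m using Submodule.iSup_induction' with
  | mem i x hx => exact hom i x hx
  | zero => exact hom 0 0 (Submodule.zero_mem _)
  | add x y _ _ hx hy => exact add x y hx hy

/-- The left multiplication by `X` on the tensor product over `R`. -/
def tensorL (M N : GrBimod) :
    ((M ⊗[ℂ] N) ⧸ tensorRel M N) →ₗ[ℂ] ((M ⊗[ℂ] N) ⧸ tensorRel M N) :=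
  tlift ((tmk M N).comp M.lX) (fun m n => by
    rw [LinearMap.comp_apply, LinearMap.comp_apply, M.lX_rX, tmk_rel])

/-- The right multiplication by `X` on the tensor product over `R`. -/
def tensorR (M N : GrBimod) :
    ((M ⊗[ℂ] N) ⧸ tensorRel M N) →ₗ[ℂ] ((M ⊗[ℂ] N) ⧸ tensorRel M N) :=
  tlift ((tmk M N).compl₂ N.rX) (fun m n => by
    rw [LinearMap.compl₂_apply, LinearMap.compl₂_apply, ← N.lX_rX, tmk_rel])

theorem tensorL_tmk (M N : GrBimod) (m : M) (n : N) :
    tensorL M N (tmk M N m n) = tmk M N (M.lX m) n := tlift_tmk _ _ m n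

theorem tensorR_tmk (M N : GrBimod) (m : M) (n : N) :
    tensorR M N (tmk M N m n) = tmk M N m (N.rX n) := tlift_tmk _ _ m n

/-- The tensor product `M ⊗_R N`: the quotient of `M ⊗[ℂ] N` by the relations
`m X ⊗ n = m ⊗ X n`. If `m` and `n` are homogeneous of degrees `i` and `j`, then `m ⊗ n` is
homogeneous of degree `i + j`. -/
noncomputable def tensor (M N : GrBimod) : GrBimod where
  carrier := (M ⊗[ℂ] N) ⧸ tensorRel M N
  lX := tensorL M N
  rX := tensorR M N
  lX_rX x := by
    induction x using tensor_induction with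
    | tmul m n => rw [tensorR_tmk, tensorL_tmk, tensorL_tmk, tensorR_tmk]
    | add x y hx hy => simp only [map_add, hx, hy]
  gr k := Submodule.span ℂ {t | ∃ (i j : ℤ) (m : M) (n : N), i + j = k ∧ m ∈ M.gr i ∧
    n ∈ N.gr j ∧ t = tmk M N m n}
  isInternal := by
    obtain ⟨c, hc⟩ := exists_lift _ M.isInternal
    obtain ⟨c', hc'⟩ := exists_lift _ N.isInternal
    let F : (ℤ →₀ M) →ₗ[ℂ] (ℤ →₀ N) →ₗ[ℂ] (ℤ →₀ ((M ⊗[ℂ] N) ⧸ tensorRel M N)) :=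
      Finsupp.lsum ℂ (fun i => LinearMap.flip (Finsupp.lsum ℂ (fun j =>
        LinearMap.flip ((tmk M N).compr₂ (Finsupp.lsingle (i + j))))))
    have hF : ∀ i j m n, F (Finsupp.single i m) (Finsupp.single j n) =
        Finsupp.single (i + j) (tmk M N m n) := by
      intro i j m n
      simp [F]
    have hG : ∀ i j, ∀ m ∈ M.gr i, ∀ n ∈ N.gr j, F.compl₁₂ c c' m n =
        Finsupp.single (i + j) (tmk M N m n) := by
      intro i j m hm n hn
      rw [LinearMap.compl₁₂_apply, hc i m hm, hc' j n hn, hF]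
    have bal : ∀ m n, F.compl₁₂ c c' (M.rX m) n = F.compl₁₂ c c' m (N.lX n) := by
      intro m n
      induction m using homogeneous_induction with
      | hom i m hm =>
        induction n using homogeneous_induction with
        | hom j n hn =>
          rw [hG _ _ _ (M.rX_mem i m hm) n hn, hG _ _ m hm _ (N.lX_mem j n hn), tmk_rel]
          congr 1
          ring
        | add x y hx hy => simp only [map_add, hx, hy]
      | add x y hx hy => simp only [map_add, LinearMap.add_apply, hx, hy]
    refine isInternal_of_lift _ (tlift _ bal) ?_ ?_
    · intro k x hx
      induction hx using Submodule.span_induction with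
      | mem x h =>
        obtain ⟨i, j, m, n, rfl, hm, hn, rfl⟩ := h
        rw [tlift_tmk, hG i j m hm n hn]
      | zero => simp
      | add x y _ _ hx hy => rw [map_add, hx, hy, Finsupp.single_add]
      | smul a x _ hx => rw [map_smul, hx, Finsupp.smul_single]
    · rw [eq_top_iff]
      rintro x -
      induction x using tensor_induction with
      | tmul m n =>
        induction m using homogeneous_induction with
        | hom i m hm =>
          induction n using homogeneous_induction with
          | hom j n hn =>
            exact Submodule.mem_iSup_of_mem (i + j) (Submodule.subset_span
              ⟨i, j, m, n, rfl, hm, hn, rfl⟩)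
          | add x y hx hy => rw [map_add]; exact add_mem hx hy
        | add x y hx hy => rw [map_add, LinearMap.add_apply]; exact add_mem hx hy
      | add x y hx hy => exact add_mem hx hy
  lX_mem k x hx := by
    induction hx using Submodule.span_induction with
    | mem x h =>
      obtain ⟨i, j, m, n, rfl, hm, hn, rfl⟩ := h
      exact Submodule.subset_span ⟨i + 2, j, M.lX m, n, by ring, M.lX_mem i m hm, hn, tensorL_tmk M N m n⟩
    | zero => simp
    | add x y _ _ hx hy => rw [map_add]; exact add_mem hx hy
    | smul a x _ hx => rw [map_smul]; exact Submodule.smul_mem _ _ hx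
  rX_mem k x hx := by
    induction hx using Submodule.span_induction with
    | mem x h =>
      obtain ⟨i, j, m, n, rfl, hm, hn, rfl⟩ := h
      exact Submodule.subset_span ⟨i, j + 2, m, N.rX n, by ring, hm, N.rX_mem j n hn, tensorR_tmk M N m n⟩
    | zero => simp
    | add x y _ _ hx hy => rw [map_add]; exact add_mem hx hy
    | smul a x _ hx => rw [map_smul]; exact Submodule.smul_mem _ _ hx

/-- The pure tensor `m ⊗ n` in `M ⊗_R N`. -/
noncomputable def tprod (M N : GrBimod) : M →ₗ[ℂ] N →ₗ[ℂ] tensor M N := tmk M N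

theorem tprod_balanced {M N : GrBimod} (m : M) (n : N) :
    tprod M N (M.rX m) n = tprod M N m (N.lX n) := tmk_rel M N m n

theorem lX_tprod {M N : GrBimod} (m : M) (n : N) :
    (tensor M N).lX (tprod M N m n) = tprod M N (M.lX m) n := tensorL_tmk M N m n

theorem rX_tprod {M N : GrBimod} (m : M) (n : N) :
    (tensor M N).rX (tprod M N m n) = tprod M N m (N.rX n) := tensorR_tmk M N m n

theorem tprod_mem {M N : GrBimod} {i j : ℤ} {m : M} {n : N} (hm : m ∈ M.gr i) (hn : n ∈ N.gr j) :
    tprod M N m n ∈ (tensor M N).gr (i + j) :=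
  Submodule.subset_span (R := ℂ) (M := (M ⊗[ℂ] N) ⧸ tensorRel M N)
    (s := {t | ∃ (a b : ℤ) (m' : M) (n' : N), a + b = i + j ∧ m' ∈ M.gr a ∧ n' ∈ N.gr b ∧
      t = tmk M N m' n'}) ⟨i, j, m, n, rfl, hm, hn, rfl⟩

theorem tprod_induction {M N : GrBimod} {motive : tensor M N → Prop}
    (tmul : ∀ m n, motive (tprod M N m n)) (add : ∀ x y, motive x → motive y → motive (x + y))
    (x : tensor M N) : motive x := tensor_induction tmul add x

/-- The universal property of the tensor product over `R`. -/
noncomputable def lift {M N : GrBimod} {V : Type} [AddCommGroup V] [Module ℂ V]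
    (f : M →ₗ[ℂ] N →ₗ[ℂ] V) (hf : ∀ m n, f (M.rX m) n = f m (N.lX n)) : tensor M N →ₗ[ℂ] V :=
  tlift f hf

theorem lift_tprod {M N : GrBimod} {V : Type} [AddCommGroup V] [Module ℂ V]
    (f : M →ₗ[ℂ] N →ₗ[ℂ] V) (hf : ∀ m n, f (M.rX m) n = f m (N.lX n)) (m : M) (n : N) :
    lift f hf (tprod M N m n) = f m n := tlift_tmk f hf m n

theorem map_gr_tensor {M N : GrBimod} {V : Type} [AddCommGroup V] [Module ℂ V]
    (f : tensor M N →ₗ[ℂ] V) (S : Submodule ℂ V) (k : ℤ)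
    (h : ∀ i j, i + j = k → ∀ m ∈ M.gr i, ∀ n ∈ N.gr j, f (tprod M N m n) ∈ S)
    (x : tensor M N) (hx : x ∈ (tensor M N).gr k) : f x ∈ S := by
  have : (tensor M N).gr k ≤ S.comap f := by
    refine Submodule.span_le.2 ?_
    rintro _ ⟨i, j, m, n, hij, hm, hn, rfl⟩
    exact h i j hij m hm n hn
  exact this hx

theorem mem_gr_of_equiv {M N : GrBimod} (e : M ≃ₗ[ℂ] N) (h : ∀ i, ∀ m ∈ M.gr i, e m ∈ N.gr i)
    (i : ℤ) (m : M) (hm : e m ∈ N.gr i) : m ∈ M.gr i := by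
  obtain ⟨c, hc⟩ := exists_lift _ M.isInternal
  obtain ⟨c', hc'⟩ := exists_lift _ N.isInternal
  have h1 : ∀ x, c x i ∈ M.gr i := by
    intro x
    induction x using homogeneous_induction with
    | hom j x hx =>
      rw [hc j x hx, Finsupp.single_apply]
      split_ifs with hji
      · exact hji ▸ hx
      · exact Submodule.zero_mem _
    | add x y hx hy => rw [map_add, Finsupp.add_apply]; exact add_mem hx hy
  have h2 : ∀ x, c' (e x) i = e (c x i) := by
    intro x
    induction x using homogeneous_induction with
    | hom j x hx =>
      rw [hc j x hx, hc' j _ (h j x hx), Finsupp.single_apply, Finsupp.single_apply]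
      split_ifs <;> simp
    | add x y hx hy => simp only [map_add, Finsupp.add_apply, hx, hy]
  have h3 := h2 m
  rw [hc' i _ hm, Finsupp.single_eq_same] at h3
  rw [e.injective h3]
  exact h1 m

namespace Iso

/-- A linear bijection that commutes with both actions and maps each homogeneous part into the
homogeneous part of the same degree is an isomorphism. -/
def of {M N : GrBimod} (e : M ≃ₗ[ℂ] N) (h1 : ∀ m, e (M.lX m) = N.lX (e m))
    (h2 : ∀ m, e (M.rX m) = N.rX (e m)) (h : ∀ i, ∀ m ∈ M.gr i, e m ∈ N.gr i) : Iso M N where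
  e := e
  map_lX := h1
  map_rX := h2
  mem_gr i m := ⟨mem_gr_of_equiv e h i m, h i m⟩

def refl (M : GrBimod) : Iso M M :=
  of (LinearEquiv.refl ℂ M) (fun _ => rfl) (fun _ => rfl) (fun _ _ hm => hm)

def symm {M N : GrBimod} (f : Iso M N) : Iso N M where
  e := f.e.symm
  map_lX m := by rw [LinearEquiv.symm_apply_eq, f.map_lX, LinearEquiv.apply_symm_apply]
  map_rX m := by rw [LinearEquiv.symm_apply_eq, f.map_rX, LinearEquiv.apply_symm_apply]
  mem_gr i m := by rw [← f.mem_gr, LinearEquiv.apply_symm_apply]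

def trans {M N P : GrBimod} (f : Iso M N) (g : Iso N P) : Iso M P where
  e := f.e.trans g.e
  map_lX m := by rw [LinearEquiv.trans_apply, LinearEquiv.trans_apply, f.map_lX, g.map_lX]
  map_rX m := by rw [LinearEquiv.trans_apply, LinearEquiv.trans_apply, f.map_rX, g.map_rX]
  mem_gr i m := by rw [LinearEquiv.trans_apply, g.mem_gr, f.mem_gr]

/-- The linear map `f ⊗_R g`. -/
noncomputable def tensorMap {M N M' N' : GrBimod} (f : Iso M M') (g : Iso N N') :
    tensor M N →ₗ[ℂ] tensor M' N' :=
  lift ((tprod M' N').compl₁₂ f.e.toLinearMap g.e.toLinearMap) (fun m n => by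
    simp only [LinearMap.compl₁₂_apply, LinearEquiv.coe_coe, f.map_rX, g.map_lX, tprod_balanced])

theorem tensorMap_tprod {M N M' N' : GrBimod} (f : Iso M M') (g : Iso N N') (m : M) (n : N) :
    tensorMap f g (tprod M N m n) = tprod M' N' (f.e m) (g.e n) := lift_tprod _ _ m n

/-- The tensor product of two isomorphisms. -/
noncomputable def tensorCongr {M N M' N' : GrBimod} (f : Iso M M') (g : Iso N N') :
    Iso (tensor M N) (tensor M' N') :=
  of (LinearEquiv.ofLinearMap (tensorMap f g) (tensorMap f.symm g.symm)
      (LinearMap.ext fun x => by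
        induction x using tprod_induction with
        | tmul m n => simp [tensorMap_tprod, symm]
        | add x y hx hy => rw [map_add, map_add, hx, hy])
      (LinearMap.ext fun x => by
        induction x using tprod_induction with
        | tmul m n => simp [tensorMap_tprod, symm]
        | add x y hx hy => rw [map_add, map_add, hx, hy]))
    (fun x => by
      change tensorMap f g ((tensor M N).lX x) = (tensor M' N').lX (tensorMap f g x)
      induction x using tprod_induction with
      | tmul m n => rw [lX_tprod, tensorMap_tprod, tensorMap_tprod, lX_tprod, f.map_lX]
      | add x y hx hy => simp only [map_add, hx, hy])
    (fun x => by
      change tensorMap f g ((tensor M N).rX x) = (tensor M' N').rX (tensorMap f g x)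
      induction x using tprod_induction with
      | tmul m n => rw [rX_tprod, tensorMap_tprod, tensorMap_tprod, rX_tprod, g.map_rX]
      | add x y hx hy => simp only [map_add, hx, hy])
    (fun k => map_gr_tensor (tensorMap f g) _ k (fun i j hij m hm n hn => by
      rw [tensorMap_tprod, ← hij]
      exact tprod_mem ((f.mem_gr i m).2 hm) ((g.mem_gr j n).2 hn)))

/-- The map `(m ⊗ n) ⊗ p ↦ m ⊗ (n ⊗ p)`. -/
noncomputable def assocMap (M N P : GrBimod) :
    tensor (tensor M N) P →ₗ[ℂ] tensor M (tensor N P) :=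
  lift (lift (LinearMap.mk₂ ℂ (fun m n => (tprod M (tensor N P) m).comp (tprod N P n))
      (fun m m' n => by ext p; simp) (fun a m n => by ext p; simp)
      (fun m n n' => by ext p; simp) (fun a m n => by ext p; simp))
    (fun m n => by
      ext p
      simp [tprod_balanced, lX_tprod]))
    (fun x p => by
      induction x using tprod_induction with
      | tmul m n => simp [rX_tprod, lift_tprod, tprod_balanced]
      | add x y hx hy => simp only [map_add, LinearMap.add_apply, hx, hy])

theorem assocMap_tprod (M N P : GrBimod) (m : M) (n : N) (p : P) :
    assocMap M N P (tprod (tensor M N) P (tprod M N m n) p) =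
      tprod M (tensor N P) m (tprod N P n p) := by
  simp [assocMap, lift_tprod]

/-- The map `m ⊗ (n ⊗ p) ↦ (m ⊗ n) ⊗ p`. -/
noncomputable def assocInv (M N P : GrBimod) :
    tensor M (tensor N P) →ₗ[ℂ] tensor (tensor M N) P :=
  lift (LinearMap.flip (lift (LinearMap.mk₂ ℂ (fun n p =>
        ((tprod (tensor M N) P).flip p).comp ((tprod M N).flip n))
      (fun m m' n => by ext p; simp) (fun a m n => by ext p; simp)
      (fun m n n' => by ext p; simp) (fun a m n => by ext p; simp))
    (fun n p => by
      ext m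
      simp [← tprod_balanced, rX_tprod])))
    (fun m x => by
      induction x using tprod_induction with
      | tmul n p => simp [lX_tprod, lift_tprod, tprod_balanced]
      | add x y hx hy => simp only [map_add, hx, hy])

theorem assocInv_tprod (M N P : GrBimod) (m : M) (n : N) (p : P) :
    assocInv M N P (tprod M (tensor N P) m (tprod N P n p)) =
      tprod (tensor M N) P (tprod M N m n) p := by
  simp [assocInv, lift_tprod]

theorem induction_left {M N P : GrBimod} {motive : tensor (tensor M N) P → Prop}
    (tmul : ∀ m n p, motive (tprod (tensor M N) P (tprod M N m n) p))
    (add : ∀ x y, motive x → motive y → motive (x + y)) (x : tensor (tensor M N) P) :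
    motive x := by
  induction x using tprod_induction with
  | tmul y p =>
    induction y using tprod_induction with
    | tmul m n => exact tmul m n p
    | add a b ha hb => rw [map_add, LinearMap.add_apply]; exact add _ _ ha hb
  | add x y hx hy => exact add x y hx hy

theorem induction_right {M N P : GrBimod} {motive : tensor M (tensor N P) → Prop}
    (tmul : ∀ m n p, motive (tprod M (tensor N P) m (tprod N P n p)))
    (add : ∀ x y, motive x → motive y → motive (x + y)) (x : tensor M (tensor N P)) :
    motive x := by
  induction x using tprod_induction with
  | tmul m y =>
    induction y using tprod_induction with
    | tmul n p => exact tmul m n p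
    | add a b ha hb => rw [map_add]; exact add _ _ ha hb
  | add x y hx hy => exact add x y hx hy

/-- The associativity isomorphism. -/
noncomputable def assoc (M N P : GrBimod) :
    Iso (tensor (tensor M N) P) (tensor M (tensor N P)) :=
  of (LinearEquiv.ofLinearMap (assocMap M N P) (assocInv M N P)
      (LinearMap.ext fun x => by
        induction x using induction_right with
        | tmul m n p => rw [LinearMap.comp_apply, assocInv_tprod, assocMap_tprod]; rfl
        | add x y hx hy => rw [map_add, map_add, hx, hy])
      (LinearMap.ext fun x => by
        induction x using induction_left with
        | tmul m n p => rw [LinearMap.comp_apply, assocMap_tprod, assocInv_tprod]; rfl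
        | add x y hx hy => rw [map_add, map_add, hx, hy]))
    (fun x => by
      change assocMap M N P ((tensor (tensor M N) P).lX x) =
        (tensor M (tensor N P)).lX (assocMap M N P x)
      induction x using induction_left with
      | tmul m n p => rw [lX_tprod, lX_tprod, assocMap_tprod, assocMap_tprod, lX_tprod]
      | add x y hx hy => rw [map_add, map_add, map_add, map_add, hx, hy])
    (fun x => by
      change assocMap M N P ((tensor (tensor M N) P).rX x) =
        (tensor M (tensor N P)).rX (assocMap M N P x)
      induction x using induction_left with
      | tmul m n p => rw [rX_tprod, assocMap_tprod, assocMap_tprod, rX_tprod, rX_tprod]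
      | add x y hx hy => rw [map_add, map_add, map_add, map_add, hx, hy])
    (fun k => map_gr_tensor (assocMap M N P) _ k (fun i j hij y hy p hp =>
      map_gr_tensor ((assocMap M N P).comp ((tprod (tensor M N) P).flip p)) _ i
        (fun a b hab m hm n hn => by
          rw [LinearMap.comp_apply, LinearMap.flip_apply, assocMap_tprod, ← hij, ← hab, add_assoc]
          exact tprod_mem hm (tprod_mem hn hp)) y hy))

/-- The unit of the ring `R`, as an element of the regular bimodule. -/
noncomputable def uone : unit := (1 : Polynomial ℂ)

theorem unit_rX (p : unit) : unit.rX p = unit.lX p := rfl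

theorem unit_induction {motive : unit → Prop} (one : motive uone)
    (smul : ∀ (a : ℂ) p, motive p → motive (a • p)) (add : ∀ p q, motive p → motive q →
      motive (p + q)) (lX : ∀ p, motive p → motive (unit.lX p)) (p : unit) : motive p := by
  have pow : ∀ n : ℕ, motive (Polynomial.X ^ n : Polynomial ℂ) := by
    intro n
    induction n with
    | zero => rw [pow_zero]; exact one
    | succ n ih => rw [pow_succ']; exact lX _ ih
  refine Polynomial.induction_on' (motive := motive) p add (fun n a => ?_)
  rw [← Polynomial.C_mul_X_pow_eq_monomial, ← Polynomial.smul_eq_C_mul]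
  exact smul a _ (pow n)

/-- The action of `R` on `M` given by an endomorphism of `M`. -/
noncomputable def act {M : GrBimod} (f : M →ₗ[ℂ] M) : unit →ₗ[ℂ] M →ₗ[ℂ] M :=
  (Polynomial.aeval (R := ℂ) (A := Module.End ℂ M) f).toLinearMap

theorem act_uone {M : GrBimod} (f : M →ₗ[ℂ] M) (m : M) : act f uone m = m :=
  congrArg (fun z : Module.End ℂ M => z m) (map_one (Polynomial.aeval f))

theorem act_lX {M : GrBimod} (f : M →ₗ[ℂ] M) (p : unit) (m : M) :
    act f (unit.lX p) m = f (act f p m) := by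
  have h : ∀ q : Polynomial ℂ, Polynomial.aeval (R := ℂ) (A := Module.End ℂ M) f
      (Polynomial.X * q) m = f (Polynomial.aeval (R := ℂ) (A := Module.End ℂ M) f q m) := by
    intro q
    rw [map_mul, Polynomial.aeval_X]
    rfl
  exact h p

theorem act_comm {M : GrBimod} (f g : M →ₗ[ℂ] M) (h : ∀ m, f (g m) = g (f m)) (p : unit) (m : M) :
    act f p (g m) = g (act f p m) := by
  induction p using unit_induction with
  | one => rw [act_uone, act_uone]
  | smul a p hp => simp only [map_smul, LinearMap.smul_apply, hp]
  | add p q hp hq => simp only [map_add, LinearMap.add_apply, hp, hq]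
  | lX p hp => rw [act_lX, act_lX, hp, h]

theorem act_mem {M : GrBimod} (f : M →ₗ[ℂ] M) (hf : ∀ i, ∀ m ∈ M.gr i, f m ∈ M.gr (i + 2))
    (i j : ℤ) (p : unit) (hp : p ∈ unit.gr i) (m : M) (hm : m ∈ M.gr j) :
    act f p m ∈ M.gr (i + j) := by
  have pow : ∀ k : ℕ, act f (Polynomial.X ^ k : Polynomial ℂ) m ∈ M.gr (2 * (k : ℤ) + j) := by
    intro k
    induction k with
    | zero =>
      rw [pow_zero, show 2 * ((0 : ℕ) : ℤ) + j = j by simp]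
      exact (act_uone f m).symm ▸ hm
    | succ k ih =>
      rw [pow_succ', show 2 * ((k + 1 : ℕ) : ℤ) + j = 2 * (k : ℤ) + j + 2 by push_cast; ring]
      exact (act_lX f _ m).symm ▸ hf _ _ ih
  have h : unit.gr i ≤ (M.gr (i + j)).comap ((act f).flip m) := by
    refine Submodule.span_le.2 ?_
    rintro _ ⟨k, rfl, rfl⟩
    exact pow k
  exact h hp

/-- The map `p ⊗ m ↦ p m` from `R ⊗_R M` to `M`. -/
noncomputable def leftUnitMap (M : GrBimod) : tensor unit M →ₗ[ℂ] M :=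
  lift (act M.lX) (fun p m => by rw [unit_rX, act_lX, act_comm _ _ (fun _ => rfl)])

theorem leftUnitMap_tprod (M : GrBimod) (p : unit) (m : M) :
    leftUnitMap M (tprod unit M p m) = act M.lX p m := lift_tprod _ _ p m

/-- The map `m ⊗ p ↦ m p` from `M ⊗_R R` to `M`. -/
noncomputable def rightUnitMap (M : GrBimod) : tensor M unit →ₗ[ℂ] M :=
  lift (act M.rX).flip (fun m p => by
    rw [LinearMap.flip_apply, LinearMap.flip_apply, act_lX, act_comm _ _ (fun _ => rfl)])

theorem rightUnitMap_tprod (M : GrBimod) (m : M) (p : unit) :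
    rightUnitMap M (tprod M unit m p) = act M.rX p m := lift_tprod _ _ m p

theorem tprod_act_left (M : GrBimod) (p : unit) (m : M) :
    tprod unit M uone (act M.lX p m) = tprod unit M p m := by
  induction p using unit_induction with
  | one => rw [act_uone]
  | smul a p hp => simp only [map_smul, LinearMap.smul_apply, hp]
  | add p q hp hq => simp only [map_add, LinearMap.add_apply, hp, hq]
  | lX p hp => rw [act_lX, ← tprod_balanced, unit_rX, ← lX_tprod, hp, lX_tprod]

theorem tprod_act_right (M : GrBimod) (m : M) (p : unit) :
    tprod M unit (act M.rX p m) uone = tprod M unit m p := by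
  induction p using unit_induction with
  | one => rw [act_uone]
  | smul a p hp => simp only [map_smul, LinearMap.smul_apply, hp]
  | add p q hp hq => simp only [map_add, LinearMap.add_apply, hp, hq]
  | lX p hp => rw [act_lX, tprod_balanced, ← unit_rX, ← rX_tprod, hp, rX_tprod, unit_rX]

/-- The left unit isomorphism. -/
noncomputable def leftUnit (M : GrBimod) : Iso (tensor unit M) M :=
  of (LinearEquiv.ofLinearMap (leftUnitMap M) (tprod unit M uone)
      (LinearMap.ext fun m => by
        rw [LinearMap.comp_apply, leftUnitMap_tprod, act_uone]; rfl)
      (LinearMap.ext fun x => by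
        induction x using tprod_induction with
        | tmul p m => rw [LinearMap.comp_apply, leftUnitMap_tprod, tprod_act_left]; rfl
        | add x y hx hy => rw [map_add, map_add, hx, hy]))
    (fun x => by
      change leftUnitMap M ((tensor unit M).lX x) = M.lX (leftUnitMap M x)
      induction x using tprod_induction with
      | tmul p m => rw [lX_tprod, leftUnitMap_tprod, leftUnitMap_tprod, act_lX]
      | add x y hx hy => rw [map_add, map_add, map_add, map_add, hx, hy])
    (fun x => by
      change leftUnitMap M ((tensor unit M).rX x) = M.rX (leftUnitMap M x)
      induction x using tprod_induction with
      | tmul p m =>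
        rw [rX_tprod, leftUnitMap_tprod, leftUnitMap_tprod, act_comm _ _ M.lX_rX]
      | add x y hx hy => rw [map_add, map_add, map_add, map_add, hx, hy])
    (fun k => map_gr_tensor (leftUnitMap M) _ k (fun i j hij p hp m hm => by
      rw [leftUnitMap_tprod, ← hij]
      exact act_mem M.lX M.lX_mem i j p hp m hm))

/-- The right unit isomorphism. -/
noncomputable def rightUnit (M : GrBimod) : Iso (tensor M unit) M :=
  of (LinearEquiv.ofLinearMap (rightUnitMap M) ((tprod M unit).flip uone)
      (LinearMap.ext fun m => by
        rw [LinearMap.comp_apply, LinearMap.flip_apply, rightUnitMap_tprod, act_uone]; rfl)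
      (LinearMap.ext fun x => by
        induction x using tprod_induction with
        | tmul m p =>
          rw [LinearMap.comp_apply, rightUnitMap_tprod, LinearMap.flip_apply, tprod_act_right]
          rfl
        | add x y hx hy => rw [map_add, map_add, hx, hy]))
    (fun x => by
      change rightUnitMap M ((tensor M unit).lX x) = M.lX (rightUnitMap M x)
      induction x using tprod_induction with
      | tmul m p =>
        rw [lX_tprod, rightUnitMap_tprod, rightUnitMap_tprod,
          act_comm _ _ (fun m => (M.lX_rX m).symm)]
      | add x y hx hy => rw [map_add, map_add, map_add, map_add, hx, hy])
    (fun x => by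
      change rightUnitMap M ((tensor M unit).rX x) = M.rX (rightUnitMap M x)
      induction x using tprod_induction with
      | tmul m p => rw [rX_tprod, rightUnitMap_tprod, rightUnitMap_tprod, unit_rX, act_lX]
      | add x y hx hy => rw [map_add, map_add, map_add, map_add, hx, hy])
    (fun k => map_gr_tensor (rightUnitMap M) _ k (fun i j hij m hm p hp => by
      rw [rightUnitMap_tprod, ← hij, add_comm i j]
      exact act_mem M.rX M.rX_mem j i p hp m hm))

end Iso

end GrBimod

open GrBimod

/-- The objects of the full subcategory `ℬ_W` of the category of graded `R`-bimodules, for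
`W` the cyclic group generated by the scalar `ζ`: the smallest class of graded bimodules that
contains `R` and `𝒪(e, s)` and is closed under direct sums, tensor products over `R`, grading
shifts, and direct summands (in particular under isomorphisms and, as `M ≅ 0 ⊕ M`, it contains
the zero bimodule). -/
inductive MemB (ζ : ℂ) : GrBimod → Prop
  | unit : MemB ζ unit
  | gen : MemB ζ (coordRing {1, ζ})
  | sum (M N : GrBimod) : MemB ζ M → MemB ζ N → MemB ζ (sum M N)
  | tensor (M N : GrBimod) : MemB ζ M → MemB ζ N → MemB ζ (tensor M N)
  | shift (M : GrBimod) (n : ℤ) : MemB ζ M → MemB ζ (shift M n)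
  | summand (M N N' : GrBimod) : MemB ζ M → Nonempty (Iso M (sum N N')) → MemB ζ N

/-- The objects of `ℬ_W`. -/
def ObjB (ζ : ℂ) : Type 1 := {M : GrBimod // MemB ζ M}

instance isoSetoid (ζ : ℂ) : Setoid (ObjB ζ) where
  r M N := Nonempty (Iso M.1 N.1)
  iseqv := ⟨fun M => ⟨Iso.refl M.1⟩, fun ⟨f⟩ => ⟨f.symm⟩, fun ⟨f⟩ ⟨g⟩ => ⟨f.trans g⟩⟩

/-- The isomorphism classes of objects of `ℬ_W`. -/
def IsoClass (ζ : ℂ) : Type 1 := Quotient (isoSetoid ζ)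

/-- The isomorphism class of an object of `ℬ_W`. -/
def isoClass {ζ : ℂ} (M : GrBimod) (hM : MemB ζ M) : IsoClass ζ := Quotient.mk _ ⟨M, hM⟩

/-- The isomorphism classes form a monoid under the tensor product over `R`. -/
noncomputable instance (ζ : ℂ) : Monoid (IsoClass ζ) where
  mul := Quotient.map₂ (fun M N => ⟨tensor M.1 N.1, MemB.tensor _ _ M.2 N.2⟩)
    (fun _ _ ⟨f⟩ _ _ ⟨g⟩ => ⟨Iso.tensorCongr f g⟩)
  one := isoClass unit MemB.unit
  mul_assoc a b c := by
    induction a using Quotient.inductionOn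
    induction b using Quotient.inductionOn
    induction c using Quotient.inductionOn
    exact Quotient.sound ⟨Iso.assoc _ _ _⟩
  one_mul a := by
    induction a using Quotient.inductionOn
    exact Quotient.sound ⟨Iso.leftUnit _⟩
  mul_one a := by
    induction a using Quotient.inductionOn
    exact Quotient.sound ⟨Iso.rightUnit _⟩

/-- The relations of the split Grothendieck ring, in the free `ℤ[v, v⁻¹]`-module on the
isomorphism classes with the product induced by the tensor product:
`[M ⊕ N] = [M] + [N]` and `[M[1]] = v [M]`. -/
inductive GrothendieckRel (ζ : ℂ) :
    MonoidAlgebra (LaurentPolynomial ℤ) (IsoClass ζ) →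
    MonoidAlgebra (LaurentPolynomial ℤ) (IsoClass ζ) → Prop
  | sum (M N : GrBimod) (hM : MemB ζ M) (hN : MemB ζ N) : GrothendieckRel ζ
      (MonoidAlgebra.of _ _ (isoClass (sum M N) (MemB.sum M N hM hN)))
      (MonoidAlgebra.of _ _ (isoClass M hM) + MonoidAlgebra.of _ _ (isoClass N hN))
  | shift (M : GrBimod) (hM : MemB ζ M) : GrothendieckRel ζ
      (MonoidAlgebra.of _ _ (isoClass (shift M 1) (MemB.shift M 1 hM)))
      ((LaurentPolynomial.T 1 : LaurentPolynomial ℤ) • MonoidAlgebra.of _ _ (isoClass M hM))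

/-- The split Grothendieck ring `A_W` of `ℬ_W`, an algebra over `ℤ[v, v⁻¹]`. -/
abbrev AW (ζ : ℂ) : Type 1 := RingQuot (GrothendieckRel ζ)

/-- The class `⟨M⟩` in `A_W` of an object `M` of `ℬ_W`. -/
noncomputable def cls {ζ : ℂ} (M : GrBimod) (hM : MemB ζ M) : AW ζ :=
  RingQuot.mkAlgHom (LaurentPolynomial ℤ) (GrothendieckRel ζ)
    (MonoidAlgebra.of _ _ (isoClass M hM))

/-- The class `C` of `𝒪(e, s)[1]`. -/
noncomputable def clsC (ζ : ℂ) : AW ζ :=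
  cls (shift (coordRing {1, ζ}) 1) (MemB.shift _ 1 MemB.gen)

/-- The relation `s = 1`, where `s` is the class of `𝒪(s)`. -/
def relS {ζ : ℂ} (hs : MemB ζ (coordRing {ζ})) (a b : AW ζ) : Prop :=
  a = cls (coordRing {ζ}) hs ∧ b = 1

/-- The quotient algebra `A_W / (s = 1)`. -/
abbrev AWbar {ζ : ℂ} (hs : MemB ζ (coordRing {ζ})) : Type 1 := RingQuot (relS hs)

/-- The image of `T_s = C - v` in `A_W / (s = 1)`. -/
noncomputable def Ts {ζ : ℂ} (hs : MemB ζ (coordRing {ζ})) : AWbar hs :=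
  RingQuot.mkAlgHom (LaurentPolynomial ℤ) (relS hs)
    (clsC ζ - algebraMap (LaurentPolynomial ℤ) (AW ζ) (LaurentPolynomial.T 1))

/-- The parameter ring `ℤ[u₀, u₀⁻¹, u₁, …, u_{d-1}]` of the generic Hecke algebra of the cyclic
reflection group of order `d`. -/
abbrev HeckeParam (d : ℕ) [NeZero d] : Type :=
  Localization.Away (MvPolynomial.X 0 : MvPolynomial (Fin d) ℤ)

/-- The parameter `u_i`. -/
noncomputable def heckeU (d : ℕ) [NeZero d] (i : Fin d) : HeckeParam d :=
  algebraMap (MvPolynomial (Fin d) ℤ) (HeckeParam d) (MvPolynomial.X i)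

/-- The ideal generated by `σ^d + u_{d-1} σ^{d-1} + ⋯ + u₁ σ + u₀`, where `σ = T 1`. -/
noncomputable def heckeIdeal (d : ℕ) [NeZero d] : Ideal (LaurentPolynomial (HeckeParam d)) :=
  Ideal.span {LaurentPolynomial.T (d : ℤ) + ∑ i : Fin d, LaurentPolynomial.C (heckeU d i) *
    LaurentPolynomial.T ((i : ℕ) : ℤ)}

/-- The generic Hecke algebra of the cyclic reflection group of order `d` of rank one: the
quotient of the group algebra of the braid group, which is infinite cyclic with the braided
reflection `σ = T 1` as a generator, by `σ^d + u_{d-1} σ^{d-1} + ⋯ + u₁ σ + u₀ = 0`. -/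
def GenericHecke (d : ℕ) [NeZero d] : Type :=
  LaurentPolynomial (HeckeParam d) ⧸ heckeIdeal d

noncomputable instance (d : ℕ) [NeZero d] : CommRing (GenericHecke d) :=
  inferInstanceAs (CommRing (LaurentPolynomial (HeckeParam d) ⧸ heckeIdeal d))

noncomputable instance (d : ℕ) [NeZero d] : Algebra (HeckeParam d) (GenericHecke d) :=
  inferInstanceAs (Algebra (HeckeParam d) (LaurentPolynomial (HeckeParam d) ⧸ heckeIdeal d))

/-- The generator `σ` of the generic Hecke algebra. -/
noncomputable def heckeSigma (d : ℕ) [NeZero d] : GenericHecke d :=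
  Ideal.Quotient.mk (heckeIdeal d) (LaurentPolynomial.T 1)

/-- The specialization `K ⊗ H` of the generic Hecke algebra `H` along a ring homomorphism from the
parameter ring to `K`. -/
def SpecializedHecke {d : ℕ} [NeZero d] {K : Type} [CommRing K] (φ : HeckeParam d →+* K) : Type :=
  @TensorProduct (HeckeParam d) _ K (GenericHecke d) _ _ φ.toAlgebra.toModule _

noncomputable instance {d : ℕ} [NeZero d] {K : Type} [CommRing K] (φ : HeckeParam d →+* K) :
    CommRing (SpecializedHecke φ) :=
  @Algebra.TensorProduct.instCommRing (HeckeParam d) K (GenericHecke d) _ _ φ.toAlgebra _ _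

noncomputable instance {d : ℕ} [NeZero d] {K : Type} [CommRing K] (φ : HeckeParam d →+* K) :
    Algebra K (SpecializedHecke φ) :=
  @Algebra.TensorProduct.leftAlgebra (HeckeParam d) K K (GenericHecke d) _ _ φ.toAlgebra _ _ _ _
    (@Algebra.to_smulCommClass (HeckeParam d) K _ _ φ.toAlgebra)

/-- The image `1 ⊗ σ` of the generator in a specialized Hecke algebra. -/
noncomputable def specializedSigma {d : ℕ} [NeZero d] {K : Type} [CommRing K]
    (φ : HeckeParam d →+* K) : SpecializedHecke φ :=
  @TensorProduct.tmul (HeckeParam d) _ K (GenericHecke d) _ _ φ.toAlgebra.toModule _ 1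
    (heckeSigma d)

end SoergelRankOne

/-! Call the set of k consecutive powers of ζ starting at ζ^a an arc. Everything rests on how `𝒪(e,
s)` and `𝒪(s)` multiply the function rings of arcs. Tensoring with `𝒪(s)` rotates an arc by one step
(`iso_singleton_arc`). Tensoring `𝒪(e, s)` with a proper arc of length j + 1 gives the arc of length
j + 2 plus an arc of length j shifted by -2 (`iso_pair_arc`); with the full circle it gives two
copies of the full circle, one shifted by -2 (`iso_pair_full`). The geometric source is a line
arrangement: the tensor product embeds into the functions on the lines {(abv, bv, v)} with a ∈ {1,
ζ} and b ∈ B, and the two outer coordinates see the line of slope ab once or twice. A linear form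
that vanishes on the lines seen once generates the second summand (`iso_tensor_pair`).

Once s = 1, the class of an arc depends on its length only. The class U_k of the arc of length k
shifted by k - 1 satisfies U_0 = 0, U_1 = 1 and C U_k = U_{k+1} + U_{k-1} for k < d, so it is a
Chebyshev polynomial in C (`clsBar_arc`). The full circle adds C U_d = (v + v⁻¹) U_d. As C = T_s +
v, this reads (T_s - v⁻¹) U_d(T_s + v) = 0, a monic relation of degree d (`heckePoly`), and the
classes of all objects are expressed through T_s.

There are no further relations because of a character with values in ℤ[v, v⁻¹][T] modulo this
polynomial. Shifted function rings of nonempty arcs are bricks: they have only scalar endomorphisms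
of degree zero. Bricks have the exchange property (`Brick.exchange`), so finite sums of arcs are
closed under direct summands and their decompositions are unique (`Dec.of_sum`, `sum_eq_of_iso`).
Hence prescribing v^{n+1-k} U_k on an arc of length k shifted by n gives a well-defined additive
invariant. It is multiplicative: for the factors `𝒪(e, s)` and `𝒪(s)` this is the tensor product
rule above, and the property passes to tensor products, shifts and complements of summands, hence to
all sums of arcs (`Good.of_dec`). The same argument shows that every object of `ℬ_W` is a sum of
arcs (`MemB.dec`). The character and the evaluation T ↦ T_s are mutually inverse (`presentation`).

The constant term of the polynomial is -v⁻¹ U_d(v), which is nonzero because U_d is monic. After it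
is inverted, the root becomes a unit, so it can receive the invertible generator σ. Comparing
universal properties identifies the presented algebra with the specialized Hecke algebra
(`exists_specialized_equiv`). -/

namespace SoergelRankOne

/-! ### Homomorphisms and direct sums of graded bimodules. -/

namespace GrBimod

/-- A homomorphism of graded bimodules of degree zero. -/
structure Hom (M N : GrBimod) where
  toLin : M →ₗ[ℂ] N
  map_lX : ∀ m, toLin (M.lX m) = N.lX (toLin m)
  map_rX : ∀ m, toLin (M.rX m) = N.rX (toLin m)
  map_gr : ∀ i, ∀ m ∈ M.gr i, toLin m ∈ N.gr i

instance (M N : GrBimod) : CoeFun (Hom M N) (fun _ => M → N) := ⟨fun f => f.toLin⟩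

namespace Hom

def comp {M N P : GrBimod} (g : Hom N P) (f : Hom M N) : Hom M P where
  toLin := g.toLin.comp f.toLin
  map_lX m := by rw [LinearMap.comp_apply, LinearMap.comp_apply, f.map_lX, g.map_lX]
  map_rX m := by rw [LinearMap.comp_apply, LinearMap.comp_apply, f.map_rX, g.map_rX]
  map_gr i m hm := g.map_gr i _ (f.map_gr i m hm)

@[simp]
theorem comp_apply {M N P : GrBimod} (g : Hom N P) (f : Hom M N) (m : M) :
    g.comp f m = g (f m) := rfl

def smul {M N : GrBimod} (c : ℂ) (f : Hom M N) : Hom M N where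
  toLin := c • f.toLin
  map_lX m := by rw [LinearMap.smul_apply, LinearMap.smul_apply, f.map_lX, map_smul]
  map_rX m := by rw [LinearMap.smul_apply, LinearMap.smul_apply, f.map_rX, map_smul]
  map_gr i m hm := Submodule.smul_mem _ _ (f.map_gr i m hm)

@[simp]
theorem smul_apply {M N : GrBimod} (c : ℂ) (f : Hom M N) (m : M) : f.smul c m = c • f m := rfl

def sub {M N : GrBimod} (f g : Hom M N) : Hom M N where
  toLin := f.toLin - g.toLin
  map_lX m := by rw [LinearMap.sub_apply, LinearMap.sub_apply, f.map_lX, g.map_lX, map_sub]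
  map_rX m := by rw [LinearMap.sub_apply, LinearMap.sub_apply, f.map_rX, g.map_rX, map_sub]
  map_gr i m hm := Submodule.sub_mem _ (f.map_gr i m hm) (g.map_gr i m hm)

def id (M : GrBimod) : Hom M M where
  toLin := LinearMap.id
  map_lX _ := rfl
  map_rX _ := rfl
  map_gr _ _ hm := hm

@[simp]
theorem id_apply {M : GrBimod} (m : M) : Hom.id M m = m := rfl

def inl (M N : GrBimod) : Hom M (sum M N) where
  toLin := LinearMap.inl ℂ M N
  map_lX _ := Prod.ext rfl (map_zero N.lX).symm
  map_rX _ := Prod.ext rfl (map_zero N.rX).symm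
  map_gr _ _ hm := ⟨hm, Submodule.zero_mem _⟩

def inr (M N : GrBimod) : Hom N (sum M N) where
  toLin := LinearMap.inr ℂ M N
  map_lX _ := Prod.ext (map_zero M.lX).symm rfl
  map_rX _ := Prod.ext (map_zero M.rX).symm rfl
  map_gr _ _ hm := ⟨Submodule.zero_mem _, hm⟩

def fst (M N : GrBimod) : Hom (sum M N) M where
  toLin := LinearMap.fst ℂ M N
  map_lX _ := rfl
  map_rX _ := rfl
  map_gr _ _ hm := hm.1

def snd (M N : GrBimod) : Hom (sum M N) N where
  toLin := LinearMap.snd ℂ M N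
  map_lX _ := rfl
  map_rX _ := rfl
  map_gr _ _ hm := hm.2

variable {M N : GrBimod}

@[simp] theorem fst_inl (m : M) : fst M N (inl M N m) = m := rfl
@[simp] theorem snd_inl (m : M) : snd M N (inl M N m) = 0 := rfl
@[simp] theorem fst_inr (n : N) : fst M N (inr M N n) = 0 := rfl
@[simp] theorem snd_inr (n : N) : snd M N (inr M N n) = n := rfl

theorem inl_add_inr (x : sum M N) : inl M N (fst M N x) + inr M N (snd M N x) = x :=
  Prod.ext (add_zero (x : M × N).1) (zero_add (x : M × N).2)

theorem sum_ext {x y : sum M N} (h1 : fst M N x = fst M N y) (h2 : snd M N x = snd M N y) :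
    x = y := Prod.ext h1 h2

/-- Two mutually inverse homomorphisms form an isomorphism. -/
def toIso (f : Hom M N) (g : Hom N M) (h1 : ∀ n, f (g n) = n) (h2 : ∀ m, g (f m) = m) :
    Iso M N :=
  Iso.of (LinearEquiv.ofLinearMap f.toLin g.toLin (LinearMap.ext h1) (LinearMap.ext h2))
    f.map_lX f.map_rX f.map_gr

end Hom

namespace Iso

variable {M N P Q : GrBimod}

def hom (e : Iso M N) : Hom M N where
  toLin := e.e.toLinearMap
  map_lX := e.map_lX
  map_rX := e.map_rX
  map_gr i m hm := (e.mem_gr i m).2 hm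

@[simp] theorem symm_hom_hom (e : Iso M N) (m : M) : e.symm.hom (e.hom m) = m :=
  e.e.symm_apply_apply m

@[simp] theorem hom_symm_hom (e : Iso M N) (n : N) : e.hom (e.symm.hom n) = n :=
  e.e.apply_symm_apply n

end Iso

/-- The homomorphism out of a direct sum. -/
def Hom.coprod {M N P : GrBimod} (f : Hom M P) (g : Hom N P) : Hom (sum M N) P where
  toLin := LinearMap.coprod f.toLin g.toLin
  map_lX m := by
    change f.toLin (M.lX m.1) + g.toLin (N.lX m.2) = P.lX (f.toLin m.1 + g.toLin m.2)
    rw [f.map_lX, g.map_lX, map_add]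
  map_rX m := by
    change f.toLin (M.rX m.1) + g.toLin (N.rX m.2) = P.rX (f.toLin m.1 + g.toLin m.2)
    rw [f.map_rX, g.map_rX, map_add]
  map_gr i m hm := Submodule.add_mem _ (f.map_gr i _ hm.1) (g.map_gr i _ hm.2)

theorem Hom.coprod_apply {M N P : GrBimod} (f : Hom M P) (g : Hom N P) (x : sum M N) :
    f.coprod g x = f (fst M N x) + g (snd M N x) := rfl

/-- The homomorphism into a direct sum. -/
def Hom.prod {M N P : GrBimod} (f : Hom P M) (g : Hom P N) : Hom P (sum M N) where
  toLin := LinearMap.prod f.toLin g.toLin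
  map_lX m := Prod.ext (f.map_lX m) (g.map_lX m)
  map_rX m := Prod.ext (f.map_rX m) (g.map_rX m)
  map_gr i m hm := ⟨f.map_gr i m hm, g.map_gr i m hm⟩

@[simp] theorem Hom.fst_prod {M N P : GrBimod} (f : Hom P M) (g : Hom P N) (x : P) :
    fst M N (f.prod g x) = f x := rfl

@[simp] theorem Hom.snd_prod {M N P : GrBimod} (f : Hom P M) (g : Hom P N) (x : P) :
    snd M N (f.prod g x) = g x := rfl

/-- A homomorphism that is bijective is an isomorphism. -/
noncomputable def Hom.isoOfBijective {M N : GrBimod} (f : Hom M N) (h : Function.Bijective f) :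
    Iso M N :=
  Iso.of (LinearEquiv.ofBijective f.toLin h) f.map_lX f.map_rX f.map_gr

namespace Iso

open Hom

variable {M N P Q : GrBimod}

def sumComm (M N : GrBimod) : Iso (sum M N) (sum N M) :=
  toIso ((snd M N).prod (fst M N)) ((snd N M).prod (fst N M)) (fun _ => rfl) (fun _ => rfl)

def sumAssoc (M N P : GrBimod) : Iso (sum (sum M N) P) (sum M (sum N P)) :=
  toIso (((fst M N).comp (fst _ P)).prod (((snd M N).comp (fst _ P)).prod (snd _ P)))
    (((fst M _).prod ((fst N P).comp (snd M _))).prod ((snd N P).comp (snd M _)))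
    (fun _ => rfl) (fun _ => rfl)

def sumCongr (e : Iso M N) (f : Iso P Q) : Iso (sum M P) (sum N Q) :=
  toIso ((e.hom.comp (fst M P)).prod (f.hom.comp (snd M P)))
    ((e.symm.hom.comp (fst N Q)).prod (f.symm.hom.comp (snd N Q)))
    (fun n => sum_ext (by simp) (by simp)) (fun n => sum_ext (by simp) (by simp))

/-- A direct summand whose complement vanishes is everything. -/
def sumZero (M Z : GrBimod) [Subsingleton Z] : Iso (sum M Z) M :=
  toIso (fst M Z) (inl M Z) (fun _ => rfl) (fun _ => sum_ext rfl (Subsingleton.elim _ _))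

def zeroSum (Z M : GrBimod) [Subsingleton Z] : Iso (sum Z M) M :=
  (sumComm Z M).trans (sumZero M Z)

def shiftCongr (n : ℤ) (e : Iso M N) : Iso (shift M n) (shift N n) where
  e := e.e
  map_lX := e.map_lX
  map_rX := e.map_rX
  mem_gr i m := e.mem_gr (n + i) m

def shiftShift (M : GrBimod) (a b : ℤ) : Iso (shift (shift M a) b) (shift M (a + b)) where
  e := LinearEquiv.refl ℂ M
  map_lX _ := rfl
  map_rX _ := rfl
  mem_gr i m := by
    change m ∈ M.gr (a + b + i) ↔ m ∈ M.gr (a + (b + i))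
    rw [add_assoc]

def shiftZero (M : GrBimod) : Iso (shift M 0) M where
  e := LinearEquiv.refl ℂ M
  map_lX _ := rfl
  map_rX _ := rfl
  mem_gr i m := by
    change m ∈ M.gr i ↔ m ∈ M.gr (0 + i)
    rw [zero_add]

def shiftSum (M N : GrBimod) (n : ℤ) :
    Iso (shift (sum M N) n) (sum (shift M n) (shift N n)) where
  e := LinearEquiv.refl ℂ (M × N)
  map_lX _ := rfl
  map_rX _ := rfl
  mem_gr _ _ := Iff.rfl

def ofEq {M N : GrBimod} (h : M = N) : Iso M N := h ▸ refl M

end Iso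

/-! ### Compatibility of the tensor product with sums and shifts. -/

/-- The tensor product of two homomorphisms. -/
noncomputable def Hom.tensorMap {M N M' N' : GrBimod} (f : Hom M M') (g : Hom N N') :
    Hom (tensor M N) (tensor M' N') where
  toLin := lift ((tprod M' N').compl₁₂ f.toLin g.toLin) (fun m n => by
    simp only [LinearMap.compl₁₂_apply, f.map_rX, g.map_lX, tprod_balanced])
  map_lX x := by
    induction x using tprod_induction with
    | tmul m n => simp only [lX_tprod, lift_tprod, LinearMap.compl₁₂_apply, f.map_lX]
    | add x y hx hy => simp only [map_add, hx, hy]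
  map_rX x := by
    induction x using tprod_induction with
    | tmul m n => simp only [rX_tprod, lift_tprod, LinearMap.compl₁₂_apply, g.map_rX]
    | add x y hx hy => simp only [map_add, hx, hy]
  map_gr k := map_gr_tensor _ _ k (fun i j hij m hm n hn => by
    rw [lift_tprod, ← hij]
    exact tprod_mem (f.map_gr i m hm) (g.map_gr j n hn))

theorem Hom.tensorMap_tprod {M N M' N' : GrBimod} (f : Hom M M') (g : Hom N N') (m : M) (n : N) :
    Hom.tensorMap f g (tprod M N m n) = tprod M' N' (f m) (g n) := lift_tprod _ (by
      intro m n
      simp only [LinearMap.compl₁₂_apply, f.map_rX, g.map_lX, tprod_balanced]) m n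

theorem Hom.tensor_ext {M N P : GrBimod} (f g : Hom (tensor M N) P)
    (h : ∀ m n, f (tprod M N m n) = g (tprod M N m n)) (x : tensor M N) : f x = g x := by
  induction x using tprod_induction with
  | tmul m n => exact h m n
  | add x y hx hy => rw [map_add, map_add, hx, hy]

theorem Hom.sum_hom_ext {M N P : GrBimod} (f g : Hom (sum M N) P)
    (h1 : ∀ m, f (inl M N m) = g (inl M N m)) (h2 : ∀ n, f (inr M N n) = g (inr M N n))
    (x : sum M N) : f x = g x := by
  rw [← inl_add_inr x, map_add, map_add, h1, h2]

theorem Hom.coprod_inl {M N P : GrBimod} (f : Hom M P) (g : Hom N P) (m : M) :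
    f.coprod g (inl M N m) = f m := by
  rw [coprod_apply, fst_inl, snd_inl, map_zero, add_zero]

theorem Hom.coprod_inr {M N P : GrBimod} (f : Hom M P) (g : Hom N P) (n : N) :
    f.coprod g (inr M N n) = g n := by
  rw [coprod_apply, fst_inr, snd_inr, map_zero, zero_add]

namespace Iso

open Hom

/-- The tensor product distributes over direct sums on the right. -/
noncomputable def tensorSum (M N P : GrBimod) :
    Iso (tensor M (sum N P)) (sum (tensor M N) (tensor M P)) :=
  let f := (Hom.tensorMap (Hom.id M) (fst N P)).prod (Hom.tensorMap (Hom.id M) (snd N P))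
  let g := (Hom.tensorMap (Hom.id M) (inl N P)).coprod (Hom.tensorMap (Hom.id M) (inr N P))
  toIso f g
    (sum_hom_ext (f.comp g) (Hom.id _)
      (tensor_ext ((f.comp g).comp (inl _ _)) (inl _ _) fun m n => by
        simp only [f, g, comp_apply, coprod_inl, Hom.tensorMap_tprod, id_apply]
        refine sum_ext ?_ ?_ <;> simp [Hom.tensorMap_tprod])
      (tensor_ext ((f.comp g).comp (inr _ _)) (inr _ _) fun m n => by
        simp only [f, g, comp_apply, coprod_inr, Hom.tensorMap_tprod, id_apply]
        refine sum_ext ?_ ?_ <;> simp [Hom.tensorMap_tprod]))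
    (tensor_ext (g.comp f) (Hom.id _) fun m n => by
      simp only [f, g, comp_apply, coprod_apply, fst_prod, snd_prod, Hom.tensorMap_tprod, id_apply]
      rw [← map_add, inl_add_inr])

/-- The tensor product distributes over direct sums on the left. -/
noncomputable def sumTensor (M N P : GrBimod) :
    Iso (tensor (sum M N) P) (sum (tensor M P) (tensor N P)) :=
  let f := (Hom.tensorMap (fst M N) (Hom.id P)).prod (Hom.tensorMap (snd M N) (Hom.id P))
  let g := (Hom.tensorMap (inl M N) (Hom.id P)).coprod (Hom.tensorMap (inr M N) (Hom.id P))
  toIso f g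
    (sum_hom_ext (f.comp g) (Hom.id _)
      (tensor_ext ((f.comp g).comp (inl _ _)) (inl _ _) fun m n => by
        simp only [f, g, comp_apply, coprod_inl, Hom.tensorMap_tprod, id_apply]
        refine sum_ext ?_ ?_ <;> simp [Hom.tensorMap_tprod])
      (tensor_ext ((f.comp g).comp (inr _ _)) (inr _ _) fun m n => by
        simp only [f, g, comp_apply, coprod_inr, Hom.tensorMap_tprod, id_apply]
        refine sum_ext ?_ ?_ <;> simp [Hom.tensorMap_tprod]))
    (tensor_ext (g.comp f) (Hom.id _) fun m n => by
      simp only [f, g, comp_apply, coprod_apply, fst_prod, snd_prod, Hom.tensorMap_tprod, id_apply]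
      rw [← LinearMap.add_apply, ← map_add, inl_add_inr])

/-- Shifting the left factor shifts the tensor product. -/
noncomputable def shiftTensor (M N : GrBimod) (n : ℤ) :
    Iso (tensor (shift M n) N) (shift (tensor M N) n) :=
  of (LinearEquiv.refl ℂ (tensor M N)) (fun _ => rfl) (fun _ => rfl) (fun k =>
    map_gr_tensor (M := shift M n) (LinearMap.id (M := tensor M N)) _ k
      (fun i j hij m hm p hp => by
        subst hij
        change tprod M N m p ∈ (tensor M N).gr (n + (i + j))
        rw [← add_assoc]
        exact tprod_mem hm hp))

/-- Shifting the right factor shifts the tensor product. -/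
noncomputable def tensorShift (M N : GrBimod) (n : ℤ) :
    Iso (tensor M (shift N n)) (shift (tensor M N) n) :=
  of (LinearEquiv.refl ℂ (tensor M N)) (fun _ => rfl) (fun _ => rfl) (fun k =>
    map_gr_tensor (N := shift N n) (LinearMap.id (M := tensor M N)) _ k
      (fun i j hij m hm p hp => by
        subst hij
        change tprod M N m p ∈ (tensor M N).gr (n + (i + j))
        rw [add_left_comm]
        exact tprod_mem hm hp))

end Iso

/-! ### Retracts, cancellation and the exchange property of bricks. -/

/-- The kernel of a retraction `g` of a homomorphism `f`. -/
def retractKer {X N : GrBimod} (f : Hom X N) (g : Hom N X) (h : ∀ x, g (f x) = x) : GrBimod where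
  carrier := LinearMap.ker g.toLin
  lX := N.lX.restrict fun n hn => by
    rw [LinearMap.mem_ker, g.map_lX, LinearMap.mem_ker.1 hn, map_zero]
  rX := N.rX.restrict fun n hn => by
    rw [LinearMap.mem_ker, g.map_rX, LinearMap.mem_ker.1 hn, map_zero]
  lX_rX n := Subtype.ext (N.lX_rX n)
  gr i := (N.gr i).comap (LinearMap.ker g.toLin).subtype
  isInternal := by
    obtain ⟨c, hc⟩ := exists_lift _ N.isInternal
    -- The projection 1 - fg onto the kernel preserves degrees, so applying it to the homogeneous
    -- components in N grades the kernel.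
    let p : N →ₗ[ℂ] LinearMap.ker g.toLin :=
      (LinearMap.id - f.toLin.comp g.toLin).codRestrict _ fun n => by
        simp [LinearMap.mem_ker, h]
    have hp : ∀ n, (p n : N) = n - f (g n) := fun n => rfl
    have hker : ∀ n : LinearMap.ker g.toLin, p n = n := fun n => Subtype.ext (by
      rw [hp, LinearMap.mem_ker.1 n.2, map_zero, sub_zero])
    refine isInternal_of_lift _ ((Finsupp.mapRange.linearMap p).comp
      (c.comp (LinearMap.ker g.toLin).subtype)) ?_ ?_
    · intro i m hm
      rw [LinearMap.comp_apply, LinearMap.comp_apply, hc i _ hm]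
      simp [hker]
    · have key : ∀ n : N, p n ∈ ⨆ i, (N.gr i).comap (LinearMap.ker g.toLin).subtype := by
        intro n
        induction n using homogeneous_induction with
        | hom i n hn =>
          refine Submodule.mem_iSup_of_mem i ?_
          exact Submodule.sub_mem _ hn (f.map_gr i _ (g.map_gr i _ hn))
        | add x y hx hy => rw [map_add]; exact add_mem hx hy
      rw [eq_top_iff]
      rintro n -
      rw [← hker n]
      exact key n
  lX_mem i m hm := N.lX_mem i _ hm
  rX_mem i m hm := N.rX_mem i _ hm

/-- A retract is a direct summand, embedded by the given homomorphism. -/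
theorem exists_iso_sum_of_retract {X N : GrBimod} (f : Hom X N) (g : Hom N X)
    (h : ∀ x, g (f x) = x) :
    ∃ K, ∃ e : Iso N (sum X K), ∀ x, e.hom (f x) = Hom.inl X K x := by
  let ι : Hom (retractKer f g h) N :=
    { toLin := (LinearMap.ker g.toLin).subtype
      map_lX := fun _ => rfl
      map_rX := fun _ => rfl
      map_gr := fun _ _ hm => hm }
  let p : Hom N (retractKer f g h) :=
    { toLin := (LinearMap.id - f.toLin.comp g.toLin).codRestrict _ fun n => by
        simp [LinearMap.mem_ker, h]
      map_lX := fun m => Subtype.ext (((Hom.id N).sub (f.comp g)).map_lX m)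
      map_rX := fun m => Subtype.ext (((Hom.id N).sub (f.comp g)).map_rX m)
      map_gr := fun i m hm => ((Hom.id N).sub (f.comp g)).map_gr i m hm }
  have hιp : ∀ n, ι (p n) = n - f (g n) := fun n => rfl
  have hgι : ∀ k, g (ι k) = 0 := fun k => LinearMap.mem_ker.1 k.2
  have hpι : ∀ k, p (ι k) = k := fun k => Subtype.ext (by
    change ι k - f (g (ι k)) = ι k
    rw [hgι, map_zero, sub_zero])
  have hpf : ∀ x, p (f x) = 0 := fun x => Subtype.ext (by
    change f x - f (g (f x)) = 0
    rw [h, sub_self])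
  refine ⟨retractKer f g h, Hom.toIso (g.prod p) (f.coprod ι) (fun x => ?_) (fun n => ?_),
    fun x => Hom.sum_ext (h x) (hpf x)⟩
  · rw [Hom.coprod_apply]
    refine Hom.sum_ext ?_ ?_
    · rw [Hom.fst_prod, map_add, h, hgι, add_zero]
    · rw [Hom.snd_prod, map_add, hpf, hpι, zero_add]
  · rw [Hom.coprod_apply, Hom.fst_prod, Hom.snd_prod, hιp, add_sub_cancel]

/-- Cancellation of a direct summand on which an isomorphism is the identity. -/
theorem iso_of_fst_hom_inl {X R K : GrBimod} (θ : Iso (sum X R) (sum X K))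
    (h : ∀ x, Hom.fst X K (θ.hom (Hom.inl X R x)) = x) : Nonempty (Iso R K) := by
  -- In block form θ has rows (1, b) and (c, d). Then s = d - cb is the Schur complement of the
  -- entry 1, and its inverse t is the lower right block of θ⁻¹.
  let b : Hom R X := (Hom.fst X K).comp (θ.hom.comp (Hom.inr X R))
  let s : Hom R K := ((Hom.snd X K).comp (θ.hom.comp (Hom.inr X R))).sub
    ((Hom.snd X K).comp (θ.hom.comp ((Hom.inl X R).comp b)))
  let t : Hom K R := (Hom.snd X R).comp (θ.symm.hom.comp (Hom.inr X K))
  have key : ∀ r, θ.hom (Hom.inr X R r - Hom.inl X R (b r)) = Hom.inr X K (s r) := by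
    intro r
    refine Hom.sum_ext ?_ ?_
    · rw [map_sub, map_sub, h, Hom.fst_inr]
      exact sub_self _
    · rw [map_sub, map_sub, Hom.snd_inr]
      rfl
  refine ⟨Hom.toIso s t (fun k => ?_) (fun r => ?_)⟩
  -- The first component of θ y vanishes, which forces the X-component of y to be -b of its
  -- R-component. So y has the form treated in `key`.
  · obtain ⟨y, hy⟩ : ∃ y, y = θ.symm.hom (Hom.inr X K k) := ⟨_, rfl⟩
    have hθ : θ.hom y = Hom.inr X K k := by rw [hy, Iso.hom_symm_hom]
    have htk : t k = Hom.snd X R y := by rw [hy]; rfl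
    have hx : Hom.fst X R y = - b (Hom.snd X R y) := by
      have h1 := congrArg (Hom.fst X K) hθ
      rw [Hom.fst_inr, ← Hom.inl_add_inr y, map_add, map_add, h] at h1
      exact eq_neg_of_add_eq_zero_left h1
    have h2 := key (Hom.snd X R y)
    have h3 : Hom.inr X R (Hom.snd X R y) - Hom.inl X R (b (Hom.snd X R y)) = y := by
      conv_rhs => rw [← Hom.inl_add_inr y, hx, map_neg]
      abel
    rw [h3, hθ] at h2
    rw [htk]
    exact (congrArg (Hom.snd X K) h2).symm
  · change Hom.snd X R (θ.symm.hom (Hom.inr X K (s r))) = r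
    rw [← key, Iso.symm_hom_hom, map_sub, Hom.snd_inr, Hom.snd_inl, sub_zero]

/-- A nonzero graded bimodule with only the scalars as endomorphisms. -/
structure Brick (X : GrBimod) : Prop where
  nontrivial : Nontrivial X
  scalar : ∀ f : Hom X X, ∃ c : ℂ, ∀ x, f x = c • x

/-- The hypothesis says that the composite X → N → X is an invertible scalar, so X is a retract of N
and N ≅ X ⊕ K. Then X ⊕ R ≅ X ⊕ (K ⊕ N') is the identity on the entry X → X, and
`iso_of_fst_hom_inl` cancels X. -/
theorem exchange_left {X R N N' : GrBimod} (φ : Iso (sum X R) (sum N N')) {c : ℂ} (hc : c ≠ 0)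
    (h : ∀ x, Hom.fst X R (φ.symm.hom (Hom.inl N N' (Hom.fst N N' (φ.hom (Hom.inl X R x))))) =
      c • x) :
    ∃ K, Nonempty (Iso N (sum X K)) ∧ Nonempty (Iso R (sum K N')) := by
  let f : Hom X N := (Hom.fst N N').comp (φ.hom.comp (Hom.inl X R))
  let g : Hom N X := ((Hom.fst X R).comp (φ.symm.hom.comp (Hom.inl N N'))).smul c⁻¹
  have hgf : ∀ x, g (f x) = x := by
    intro x
    rw [Hom.smul_apply]
    refine (congrArg (c⁻¹ • ·) (h x)).trans ?_
    simp [smul_smul, hc]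
  obtain ⟨K, e, he⟩ := exists_iso_sum_of_retract f g hgf
  refine ⟨K, ⟨e⟩, iso_of_fst_hom_inl
    ((φ.trans (Iso.sumCongr e (Iso.refl N'))).trans (Iso.sumAssoc X K N')) fun x => ?_⟩
  change Hom.fst X K (e.hom (f x)) = x
  rw [he, Hom.fst_inl]

/-- The exchange property of bricks. -/
theorem Brick.exchange {X R N N' : GrBimod} (hX : Brick X) (φ : Iso (sum X R) (sum N N')) :
    (∃ K, Nonempty (Iso N (sum X K)) ∧ Nonempty (Iso R (sum K N'))) ∨
    ∃ K, Nonempty (Iso N' (sum X K)) ∧ Nonempty (Iso R (sum K N)) := by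
  obtain ⟨a, ha⟩ := hX.scalar ((Hom.fst X R).comp (φ.symm.hom.comp ((Hom.inl N N').comp
    ((Hom.fst N N').comp (φ.hom.comp (Hom.inl X R))))))
  obtain ⟨b, hb⟩ := hX.scalar ((Hom.fst X R).comp (φ.symm.hom.comp ((Hom.inr N N').comp
    ((Hom.snd N N').comp (φ.hom.comp (Hom.inl X R))))))
  -- The composites X → X through N and through N' add up to the identity, so the scalars a and b
  -- have sum 1 and cannot both vanish. This plays the role of a local endomorphism ring.
  by_cases h : a = 0
  · right
    have hb0 : b ≠ 0 := by
      rintro rfl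
      have := hX.nontrivial
      obtain ⟨x, hx⟩ := exists_ne (0 : X)
      refine hx ?_
      have h1 := ha x
      have h2 := hb x
      have h3 := congrArg (fun y => Hom.fst X R (φ.symm.hom y))
        (Hom.inl_add_inr (φ.hom (Hom.inl X R x)))
      simp only [map_add, Iso.symm_hom_hom, Hom.fst_inl] at h3
      rw [← h3]
      refine (congrArg₂ (· + ·) h1 h2).trans ?_
      simp [h]
    exact exchange_left (φ.trans (Iso.sumComm N N')) hb0 hb
  · left
    exact exchange_left φ h ha

/-- A brick has no proper direct summands. -/
theorem Brick.subsingleton_or {X N N' : GrBimod} (hX : Brick X) (e : Iso X (sum N N')) :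
    Subsingleton N ∨ Subsingleton N' := by
  -- The projection of X to the summand N is a scalar. If it is 0, then N vanishes; otherwise N'
  -- vanishes, because the projection kills it.
  obtain ⟨c, hc⟩ := hX.scalar (e.symm.hom.comp ((Hom.inl N N').comp
    ((Hom.fst N N').comp e.hom)))
  by_cases h : c = 0
  · left
    refine subsingleton_of_forall_eq 0 fun n => ?_
    have h1 := congrArg (fun y => Hom.fst N N' (e.hom y)) (hc (e.symm.hom (Hom.inl N N' n)))
    simpa [h] using h1
  · right
    refine subsingleton_of_forall_eq 0 fun n => ?_
    have h1 := hc (e.symm.hom (Hom.inr N N' n))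
    simp only [Hom.comp_apply, Iso.hom_symm_hom, Hom.fst_inr, map_zero] at h1
    have h2 := (smul_eq_zero.1 h1.symm).resolve_left h
    have h3 := congrArg (fun y => Hom.snd N N' (e.hom y)) h2
    simpa using h3

end GrBimod

end SoergelRankOne

/-! ### Polynomials acting on bimodules, and functions on unions of lines. -/

namespace SoergelRankOne

namespace GrBimod

/-- The restriction of a polynomial in two variables to the line `{(a v, v)}`. -/
noncomputable def restrictLine (a : ℂ) : MvPolynomial (Fin 2) ℂ →ₐ[ℂ] Polynomial ℂ :=
  MvPolynomial.aeval ![Polynomial.C a * Polynomial.X, Polynomial.X]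

@[simp]
theorem restrictLine_X_zero (a : ℂ) :
    restrictLine a (MvPolynomial.X 0) = Polynomial.C a * Polynomial.X := by
  simp [restrictLine]

@[simp]
theorem restrictLine_X_one (a : ℂ) : restrictLine a (MvPolynomial.X 1) = Polynomial.X := by
  simp [restrictLine]

theorem eval_restrictLine (a v : ℂ) (p : MvPolynomial (Fin 2) ℂ) :
    (restrictLine a p).eval v = MvPolynomial.aeval ![a * v, v] p := by
  have h : ((Polynomial.aeval v).comp (restrictLine a) : MvPolynomial (Fin 2) ℂ →ₐ[ℂ] ℂ) =
      MvPolynomial.aeval ![a * v, v] := by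
    refine MvPolynomial.algHom_ext fun i => ?_
    fin_cases i <;> simp
  rw [← h]
  simp

/-- A polynomial over the infinite field ℂ is determined by its values. Membership in the ideal thus
becomes a family of equations in the domain ℂ[X], one for each line, and all later computations take
place there. -/
theorem mem_graphIdeal {A : Set ℂ} {p : MvPolynomial (Fin 2) ℂ} :
    p ∈ graphIdeal A ↔ ∀ a ∈ A, restrictLine a p = 0 := by
  constructor
  · intro hp a ha
    refine Polynomial.funext fun v => ?_
    rw [eval_restrictLine, Polynomial.eval_zero]
    exact hp _ ⟨a, ha, v, rfl⟩
  · rintro hp _ ⟨a, ha, v, rfl⟩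
    rw [← eval_restrictLine, hp a ha, Polynomial.eval_zero]

/-- The action of the polynomials in two variables on a bimodule. -/
noncomputable def polyAct (M : GrBimod) : MvPolynomial (Fin 2) ℂ →ₗ[ℂ] M →ₗ[ℂ] M :=
  (MvPolynomial.basisMonomials (Fin 2) ℂ).constr ℂ
    (fun s => ((M.lX ^ s 0) * (M.rX ^ s 1) : Module.End ℂ M))

theorem polyAct_monomial (M : GrBimod) (s : Fin 2 →₀ ℕ) (m : M) :
    polyAct M (MvPolynomial.monomial s 1) m =
      ((M.lX ^ s 0) * (M.rX ^ s 1) : Module.End ℂ M) m := by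
  have h := (MvPolynomial.basisMonomials (Fin 2) ℂ).constr_basis ℂ
    (fun s => ((M.lX ^ s 0) * (M.rX ^ s 1) : Module.End ℂ M)) s
  rw [MvPolynomial.coe_basisMonomials] at h
  exact congrArg (fun f : Module.End ℂ M => f m) h

/-- The last two cases match `lX` and `rX`, so identities for `polyAct` reduce to the two generators
of the bimodule action. -/
theorem mvPolynomial_induction {motive : MvPolynomial (Fin 2) ℂ → Prop} (one : motive 1)
    (smul : ∀ (a : ℂ) p, motive p → motive (a • p))
    (add : ∀ p q, motive p → motive q → motive (p + q))
    (X0 : ∀ p, motive p → motive (MvPolynomial.X 0 * p))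
    (X1 : ∀ p, motive p → motive (MvPolynomial.X 1 * p)) (p : MvPolynomial (Fin 2) ℂ) :
    motive p := by
  induction p using MvPolynomial.induction_on with
  | C a =>
    rw [← mul_one (MvPolynomial.C a), ← MvPolynomial.smul_eq_C_mul]
    exact smul a 1 one
  | add p q hp hq => exact add p q hp hq
  | mul_X p i hp =>
    rw [mul_comm]
    fin_cases i
    · exact X0 p hp
    · exact X1 p hp

theorem polyAct_one (M : GrBimod) (m : M) : polyAct M 1 m = m := by
  have h := polyAct_monomial M 0 m
  simpa using h

theorem polyAct_monomial_smul (M : GrBimod) (s : Fin 2 →₀ ℕ) (a : ℂ) (m : M) :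
    polyAct M (MvPolynomial.monomial s a) m =
      a • ((M.lX ^ s 0) * (M.rX ^ s 1) : Module.End ℂ M) m := by
  rw [← polyAct_monomial, ← LinearMap.smul_apply, ← map_smul, MvPolynomial.smul_monomial,
    smul_eq_mul, mul_one]

theorem polyAct_X_zero_mul (M : GrBimod) (p : MvPolynomial (Fin 2) ℂ) (m : M) :
    polyAct M (MvPolynomial.X 0 * p) m = M.lX (polyAct M p m) := by
  induction p using MvPolynomial.induction_on' with
  | monomial s a =>
    rw [MvPolynomial.X, MvPolynomial.monomial_mul, polyAct_monomial_smul, polyAct_monomial_smul,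
      map_smul, one_mul]
    simp [pow_add, pow_one]
  | add p q hp hq => rw [mul_add, map_add, LinearMap.add_apply, hp, hq, map_add,
      LinearMap.add_apply, map_add]

theorem polyAct_X_one_mul (M : GrBimod) (p : MvPolynomial (Fin 2) ℂ) (m : M) :
    polyAct M (MvPolynomial.X 1 * p) m = M.rX (polyAct M p m) := by
  have hc : Commute (M.rX : Module.End ℂ M) M.lX := LinearMap.ext fun m => (M.lX_rX m).symm
  induction p using MvPolynomial.induction_on' with
  | monomial s a =>
    rw [MvPolynomial.X, MvPolynomial.monomial_mul, polyAct_monomial_smul, polyAct_monomial_smul,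
      map_smul, one_mul]
    have h := (hc.pow_right (s 0)).eq
    congr 1
    rw [← Module.End.mul_apply, ← mul_assoc, h]
    simp [pow_add, pow_one]
  | add p q hp hq => rw [mul_add, map_add, LinearMap.add_apply, hp, hq, map_add,
      LinearMap.add_apply, map_add]

theorem Hom.map_polyAct {M N : GrBimod} (f : Hom M N) (p : MvPolynomial (Fin 2) ℂ) (m : M) :
    f (polyAct M p m) = polyAct N p (f m) := by
  induction p using mvPolynomial_induction with
  | one => rw [polyAct_one, polyAct_one]
  | smul a p hp => simp only [map_smul, LinearMap.smul_apply, hp]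
  | add p q hp hq => simp only [map_add, LinearMap.add_apply, hp, hq]
  | X0 p hp => rw [polyAct_X_zero_mul, polyAct_X_zero_mul, f.map_lX, hp]
  | X1 p hp => rw [polyAct_X_one_mul, polyAct_X_one_mul, f.map_rX, hp]

theorem polyAct_mem (M : GrBimod) {k : ℕ} {p : MvPolynomial (Fin 2) ℂ} (hp : p.IsHomogeneous k)
    {i : ℤ} {m : M} (hm : m ∈ M.gr i) : polyAct M p m ∈ M.gr (2 * (k : ℤ) + i) := by
  have hl : ∀ (n : ℕ) (j : ℤ) (x : M), x ∈ M.gr j →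
      (M.lX ^ n : Module.End ℂ M) x ∈ M.gr (2 * (n : ℤ) + j) := by
    intro n
    induction n with
    | zero => intro j x hx; simpa using hx
    | succ n ih =>
      intro j x hx
      rw [pow_succ, show 2 * ((n + 1 : ℕ) : ℤ) + j = 2 * (n : ℤ) + (j + 2) by push_cast; ring]
      exact ih _ _ (M.lX_mem j x hx)
  have hr : ∀ (n : ℕ) (j : ℤ) (x : M), x ∈ M.gr j →
      (M.rX ^ n : Module.End ℂ M) x ∈ M.gr (2 * (n : ℤ) + j) := by
    intro n
    induction n with
    | zero => intro j x hx; simpa using hx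
    | succ n ih =>
      intro j x hx
      rw [pow_succ, show 2 * ((n + 1 : ℕ) : ℤ) + j = 2 * (n : ℤ) + (j + 2) by push_cast; ring]
      exact ih _ _ (M.rX_mem j x hx)
  rw [p.as_sum, map_sum, LinearMap.sum_apply]
  refine Submodule.sum_mem _ fun s hs => ?_
  rw [polyAct_monomial_smul]
  refine Submodule.smul_mem _ _ ?_
  have h := hp.degree_eq_sum_deg_support hs
  rw [Finset.sum_subset (Finset.subset_univ _) (fun i _ hi => by simpa using hi),
    Fin.sum_univ_two] at h
  rw [h, show 2 * ((s 0 + s 1 : ℕ) : ℤ) + i = 2 * (s 0 : ℤ) + (2 * (s 1 : ℤ) + i) by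
    push_cast; ring]
  exact hl _ _ _ (hr _ _ _ hm)

/-- The class of a polynomial in `𝒪(A)`. -/
noncomputable def coordMk (A : Set ℂ) : MvPolynomial (Fin 2) ℂ →ₗ[ℂ] coordRing A :=
  (Ideal.Quotient.mkₐ ℂ (graphIdeal A)).toLinearMap

theorem coordMk_surjective (A : Set ℂ) : Function.Surjective (coordMk A) :=
  Ideal.Quotient.mk_surjective

theorem coordMk_eq_zero {A : Set ℂ} {p : MvPolynomial (Fin 2) ℂ} :
    coordMk A p = 0 ↔ p ∈ graphIdeal A := Ideal.Quotient.eq_zero_iff_mem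

theorem coordRing_lX (A : Set ℂ) (p : MvPolynomial (Fin 2) ℂ) :
    (coordRing A).lX (coordMk A p) = coordMk A (MvPolynomial.X 0 * p) := rfl

theorem coordRing_rX (A : Set ℂ) (p : MvPolynomial (Fin 2) ℂ) :
    (coordRing A).rX (coordMk A p) = coordMk A (MvPolynomial.X 1 * p) := rfl

theorem polyAct_coordMk (A : Set ℂ) (p q : MvPolynomial (Fin 2) ℂ) :
    polyAct (coordRing A) p (coordMk A q) = coordMk A (p * q) := by
  induction p using mvPolynomial_induction with
  | one => rw [polyAct_one, one_mul]
  | smul a p hp => rw [map_smul, LinearMap.smul_apply, hp, smul_mul_assoc, map_smul]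
  | add p q hp hq => rw [map_add, LinearMap.add_apply, hp, hq, add_mul, map_add]
  | X0 p hp => rw [polyAct_X_zero_mul, hp, coordRing_lX, mul_assoc]
  | X1 p hp => rw [polyAct_X_one_mul, hp, coordRing_rX, mul_assoc]

theorem coordMk_eq_polyAct (A : Set ℂ) (p : MvPolynomial (Fin 2) ℂ) :
    coordMk A p = polyAct (coordRing A) p (coordMk A 1) := by
  rw [polyAct_coordMk, mul_one]

theorem coordMk_mem {A : Set ℂ} {k : ℕ} {p : MvPolynomial (Fin 2) ℂ} (hp : p.IsHomogeneous k) :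
    coordMk A p ∈ (coordRing A).gr (2 * (k : ℤ)) := by
  have h : Ideal.Quotient.mk (graphIdeal A) p ∈ Submodule.span ℂ {f | ∃ (k' : ℕ)
      (p : MvPolynomial (Fin 2) ℂ), 2 * (k' : ℤ) = 2 * (k : ℤ) ∧ p.IsHomogeneous k' ∧
      f = Ideal.Quotient.mk (graphIdeal A) p} :=
    Submodule.subset_span ⟨k, p, rfl, hp, rfl⟩
  exact h

theorem coordMk_one_mem (A : Set ℂ) : coordMk A 1 ∈ (coordRing A).gr 0 := by
  have h := coordMk_mem (A := A) (MvPolynomial.isHomogeneous_one (Fin 2) ℂ)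
  rwa [Nat.cast_zero, mul_zero] at h

theorem map_gr_coordRing {A : Set ℂ} {V : Type} [AddCommGroup V] [Module ℂ V]
    (f : coordRing A →ₗ[ℂ] V) (S : Submodule ℂ V) (i : ℤ)
    (h : ∀ (k : ℕ) (p : MvPolynomial (Fin 2) ℂ), 2 * (k : ℤ) = i → p.IsHomogeneous k →
      f (coordMk A p) ∈ S) (x : coordRing A) (hx : x ∈ (coordRing A).gr i) : f x ∈ S := by
  have : (coordRing A).gr i ≤ S.comap f := by
    refine Submodule.span_le.2 ?_
    rintro _ ⟨k, p, hk, hp, rfl⟩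
    exact h k p hk hp
  exact this hx

/-- The homomorphism `𝒪(A)[-i] → M` that maps `1` to an element of degree `i` killed by the
ideal of `A`. -/
noncomputable def coordHom {A : Set ℂ} {M : GrBimod} {i : ℤ} (u : M) (hu : u ∈ M.gr i)
    (h : ∀ p ∈ graphIdeal A, polyAct M p u = 0) : Hom (shift (coordRing A) (-i)) M where
  toLin := Submodule.liftQ ((graphIdeal A).restrictScalars ℂ) ((polyAct M).flip u) h
  map_lX x := by
    obtain ⟨p, rfl⟩ := coordMk_surjective A x
    exact polyAct_X_zero_mul M p u
  map_rX x := by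
    obtain ⟨p, rfl⟩ := coordMk_surjective A x
    exact polyAct_X_one_mul M p u
  map_gr j x hx := by
    refine map_gr_coordRing (A := A)
      (Submodule.liftQ ((graphIdeal A).restrictScalars ℂ) ((polyAct M).flip u) h) _ (-i + j)
      (fun k p hk hp => ?_) x hx
    rw [show j = 2 * (k : ℤ) + i by rw [hk]; ring]
    exact polyAct_mem M hp hu

theorem coordHom_coordMk {A : Set ℂ} {M : GrBimod} {i : ℤ} (u : M) (hu : u ∈ M.gr i)
    (h : ∀ p ∈ graphIdeal A, polyAct M p u = 0) (p : MvPolynomial (Fin 2) ℂ) :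
    coordHom u hu h (coordMk A p) = polyAct M p u := rfl

/-- A cyclic bimodule generated in degree zero whose annihilator is the ideal of `A`. -/
theorem iso_coordRing {A : Set ℂ} {M : GrBimod} (u : M) (hu : u ∈ M.gr 0)
    (gen : ∀ m, ∃ p, m = polyAct M p u)
    (ann : ∀ p, polyAct M p u = 0 ↔ p ∈ graphIdeal A) : Nonempty (Iso M (coordRing A)) := by
  let f := coordHom u hu (A := A) (fun p hp => (ann p).2 hp)
  have hf : Function.Bijective f := by
    constructor
    · refine (injective_iff_map_eq_zero f.toLin).2 fun x hx => ?_
      obtain ⟨p, rfl⟩ := coordMk_surjective A x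
      exact coordMk_eq_zero.2 ((ann p).1 hx)
    · intro m
      obtain ⟨p, rfl⟩ := gen m
      exact ⟨coordMk A p, rfl⟩
  exact ⟨(f.isoOfBijective hf).symm.trans (Iso.shiftZero (coordRing A))⟩

/-- A bimodule with two generators, of degrees `0` and `2`, that are independent modulo the ideals
of `D` and `E`. -/
theorem iso_sum_coordRing {D E : Set ℂ} {M : GrBimod} (u w : M) (hu : u ∈ M.gr 0)
    (hw : w ∈ M.gr 2) (gen : ∀ m, ∃ p q, m = polyAct M p u + polyAct M q w)
    (annD : ∀ p ∈ graphIdeal D, polyAct M p u = 0) (annE : ∀ p ∈ graphIdeal E, polyAct M p w = 0)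
    (indep : ∀ p q, polyAct M p u + polyAct M q w = 0 → p ∈ graphIdeal D ∧ q ∈ graphIdeal E) :
    Nonempty (Iso M (sum (coordRing D) (shift (coordRing E) (-2)))) := by
  let f := (coordHom u hu annD).coprod (coordHom w hw annE)
  have hf : Function.Bijective f := by
    constructor
    · refine (injective_iff_map_eq_zero f.toLin).2 fun x hx => ?_
      obtain ⟨p, hp⟩ := coordMk_surjective D x.1
      obtain ⟨q, hq⟩ := coordMk_surjective E x.2
      have h : polyAct M p u + polyAct M q w = 0 := by
        rw [← coordHom_coordMk u hu annD, ← coordHom_coordMk w hw annE, hp, hq]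
        exact hx
      obtain ⟨h1, h2⟩ := indep p q h
      exact Prod.ext (hp.symm.trans (coordMk_eq_zero.2 h1)) (hq.symm.trans (coordMk_eq_zero.2 h2))
    · intro m
      obtain ⟨p, q, rfl⟩ := gen m
      exact ⟨(coordMk D p, coordMk E q), rfl⟩
  exact ⟨(f.isoOfBijective hf).symm.trans
    (Iso.sumCongr (Iso.shiftZero (coordRing D)) (Iso.refl _))⟩

/-- A homomorphism to the functions on the line `{(a v, v)}`. -/
structure LineHom (M : GrBimod) (a : ℂ) where
  toLin : M →ₗ[ℂ] Polynomial ℂ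
  map_lX : ∀ m, toLin (M.lX m) = Polynomial.C a * Polynomial.X * toLin m
  map_rX : ∀ m, toLin (M.rX m) = Polynomial.X * toLin m

noncomputable instance (M : GrBimod) (a : ℂ) : CoeFun (LineHom M a) (fun _ => M → Polynomial ℂ) :=
  ⟨fun f => f.toLin⟩

/-- This is how relations between generators of a bimodule are tested: on each line they become
equations between polynomials in one variable. -/
theorem LineHom.map_polyAct {M : GrBimod} {a : ℂ} (f : LineHom M a)
    (p : MvPolynomial (Fin 2) ℂ) (m : M) : f (polyAct M p m) = restrictLine a p * f m := by
  induction p using mvPolynomial_induction with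
  | one => rw [polyAct_one, map_one, one_mul]
  | smul c p hp => rw [map_smul, LinearMap.smul_apply, map_smul, hp, map_smul, smul_mul_assoc]
  | add p q hp hq => rw [map_add, LinearMap.add_apply, map_add, hp, hq, map_add, add_mul]
  | X0 p hp => rw [polyAct_X_zero_mul, f.map_lX, hp, map_mul, restrictLine_X_zero, mul_assoc _ _ (f m)]
  | X1 p hp => rw [polyAct_X_one_mul, f.map_rX, hp, map_mul, restrictLine_X_one, mul_assoc _ _ (f m)]

/-- The restriction of functions on the lines of `A` to one of them. -/
noncomputable def coordLine {A : Set ℂ} {a : ℂ} (ha : a ∈ A) : LineHom (coordRing A) a where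
  toLin := Submodule.liftQ ((graphIdeal A).restrictScalars ℂ) (restrictLine a).toLinearMap
    (fun _ hp => mem_graphIdeal.1 hp a ha)
  map_lX x := by
    obtain ⟨p, rfl⟩ := coordMk_surjective A x
    exact (map_mul (restrictLine a) (MvPolynomial.X 0) p).trans (by
      rw [restrictLine_X_zero]; rfl)
  map_rX x := by
    obtain ⟨p, rfl⟩ := coordMk_surjective A x
    exact (map_mul (restrictLine a) (MvPolynomial.X 1) p).trans (by
      rw [restrictLine_X_one]; rfl)

theorem coordLine_coordMk {A : Set ℂ} {a : ℂ} (ha : a ∈ A) (p : MvPolynomial (Fin 2) ℂ) :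
    coordLine ha (coordMk A p) = restrictLine a p := rfl

theorem coordRing_eq_zero {A : Set ℂ} (x : coordRing A)
    (h : ∀ a (ha : a ∈ A), coordLine ha x = 0) : x = 0 := by
  obtain ⟨p, rfl⟩ := coordMk_surjective A x
  exact coordMk_eq_zero.2 (mem_graphIdeal.2 h)

/-- The pairing from which the product of two line homomorphisms is constructed. -/
noncomputable def LineHom.pairing {M N : GrBimod} {a b : ℂ} (f : LineHom M a) (g : LineHom N b) :
    M →ₗ[ℂ] N →ₗ[ℂ] Polynomial ℂ :=
  -- The composite line is {(abv, bv, v)}. The value of f is a polynomial in the middle coordinate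
  -- bv, hence the substitution X ↦ bX in the first factor.
  (LinearMap.mul ℂ (Polynomial ℂ)).compl₁₂
    ((Polynomial.aeval (Polynomial.C b * Polynomial.X : Polynomial ℂ)).toLinearMap.comp f.toLin)
    g.toLin

theorem LineHom.pairing_apply {M N : GrBimod} {a b : ℂ} (f : LineHom M a) (g : LineHom N b)
    (m : M) (n : N) : f.pairing g m n =
      Polynomial.aeval (Polynomial.C b * Polynomial.X : Polynomial ℂ) (f m) * g n := rfl

theorem LineHom.pairing_balanced {M N : GrBimod} {a b : ℂ} (f : LineHom M a) (g : LineHom N b)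
    (m : M) (n : N) : f.pairing g (M.rX m) n = f.pairing g m (N.lX n) := by
  rw [pairing_apply, pairing_apply, f.map_rX, g.map_lX, map_mul, Polynomial.aeval_X]
  ring

/-- The product of two line homomorphisms. -/
noncomputable def LineHom.tensor {M N : GrBimod} {a b : ℂ} (f : LineHom M a) (g : LineHom N b) :
    LineHom (tensor M N) (a * b) where
  toLin := lift (f.pairing g) (f.pairing_balanced g)
  map_lX x := by
    induction x using tprod_induction with
    | tmul m n =>
      rw [lX_tprod, lift_tprod, lift_tprod, pairing_apply, pairing_apply, f.map_lX, map_mul,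
        map_mul, Polynomial.aeval_X, Polynomial.aeval_C, Polynomial.algebraMap_eq, map_mul]
      ring
    | add x y hx hy => simp only [map_add, hx, hy, mul_add]
  map_rX x := by
    induction x using tprod_induction with
    | tmul m n =>
      rw [rX_tprod, lift_tprod, lift_tprod, pairing_apply, pairing_apply, g.map_rX]
      ring
    | add x y hx hy => simp only [map_add, hx, hy, mul_add]

theorem LineHom.tensor_tprod {M N : GrBimod} {a b : ℂ} (f : LineHom M a) (g : LineHom N b)
    (m : M) (n : N) : f.tensor g (tprod M N m n) =
      Polynomial.aeval (Polynomial.C b * Polynomial.X : Polynomial ℂ) (f m) * g n :=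
  lift_tprod _ (f.pairing_balanced g) m n

end GrBimod

end SoergelRankOne

/-! ### Tensor products of the function rings. -/

namespace SoergelRankOne

namespace GrBimod

theorem coordRing_ext {A : Set ℂ} {x y : coordRing A}
    (h : ∀ a (ha : a ∈ A), coordLine ha x = coordLine ha y) : x = y := by
  refine sub_eq_zero.1 (coordRing_eq_zero _ fun a ha => ?_)
  rw [map_sub, h, sub_self]

theorem coordLine_one {A : Set ℂ} {a : ℂ} (ha : a ∈ A) : coordLine ha (coordMk A 1) = 1 := by
  rw [coordLine_coordMk, map_one]

theorem coordRing_induction {A : Set ℂ} {motive : coordRing A → Prop}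
    (one : motive (coordMk A 1)) (smul : ∀ (c : ℂ) x, motive x → motive (c • x))
    (add : ∀ x y, motive x → motive y → motive (x + y))
    (lX : ∀ x, motive x → motive ((coordRing A).lX x))
    (rX : ∀ x, motive x → motive ((coordRing A).rX x)) (x : coordRing A) : motive x := by
  obtain ⟨p, rfl⟩ := coordMk_surjective A x
  induction p using mvPolynomial_induction with
  | one => exact one
  | smul c p hp => rw [map_smul]; exact smul c _ hp
  | add p q hp hq => rw [map_add]; exact add _ _ hp hq
  | X0 p hp => exact lX _ hp
  | X1 p hp => exact rX _ hp

theorem coordRing_singleton_lX_one (α : ℂ) :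
    (coordRing {α}).lX (coordMk {α} 1) = α • (coordRing {α}).rX (coordMk {α} 1) := by
  refine coordRing_ext fun a ha => ?_
  rw [map_smul, (coordLine ha).map_lX, (coordLine ha).map_rX, coordLine_one,
    Set.mem_singleton_iff.1 ha, Polynomial.smul_eq_C_mul, mul_assoc]

/-- With x, y the outer coordinates, this is (x - y)(x - ζy) = 0 on the two lines. It makes 1 and x
generators of `𝒪(e, s)` as a right module. -/
theorem coordRing_pair_lX_lX_one (ζ : ℂ) :
    (coordRing {1, ζ}).lX ((coordRing {1, ζ}).lX (coordMk {1, ζ} 1)) =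
      (1 + ζ) • (coordRing {1, ζ}).rX ((coordRing {1, ζ}).lX (coordMk {1, ζ} 1)) -
        ζ • (coordRing {1, ζ}).rX ((coordRing {1, ζ}).rX (coordMk {1, ζ} 1)) := by
  refine coordRing_ext fun a ha => ?_
  rw [map_sub, map_smul, map_smul]
  simp only [(coordLine ha).map_lX, (coordLine ha).map_rX, coordLine_one,
    Polynomial.smul_eq_C_mul, Polynomial.C_add, Polynomial.C_1]
  rcases ha with rfl | ha
  · rw [Polynomial.C_1]; ring
  · rw [Set.mem_singleton_iff.1 ha]; ring

theorem uone_mem : Iso.uone ∈ unit.gr 0 := by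
  have h : (1 : Polynomial ℂ) ∈ Submodule.span ℂ
      {p : Polynomial ℂ | ∃ k : ℕ, 2 * (k : ℤ) = 0 ∧ p = Polynomial.X ^ k} :=
    Submodule.subset_span ⟨0, by simp, by simp⟩
  exact h

/-- The regular bimodule consists of the functions on the diagonal. -/
theorem iso_unit : Nonempty (Iso unit (coordRing {1})) := by
  let f : LineHom unit 1 :=
    { toLin := LinearMap.id (M := Polynomial ℂ)
      map_lX := fun m => by rw [Polynomial.C_1, one_mul]; rfl
      map_rX := fun m => rfl }
  have hf : ∀ p, polyAct unit p Iso.uone = restrictLine 1 p := fun p =>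
    (f.map_polyAct p Iso.uone).trans (mul_one _)
  refine iso_coordRing Iso.uone uone_mem (fun m => ?_) fun p => ?_
  · induction m using Iso.unit_induction with
    | one => exact ⟨1, (polyAct_one _ _).symm⟩
    | smul a p hp =>
      obtain ⟨q, rfl⟩ := hp
      exact ⟨a • q, by rw [map_smul, LinearMap.smul_apply]⟩
    | add p q hp hq =>
      obtain ⟨p, rfl⟩ := hp
      obtain ⟨q, rfl⟩ := hq
      exact ⟨p + q, by rw [map_add, LinearMap.add_apply]⟩
    | lX p hp =>
      obtain ⟨q, rfl⟩ := hp
      exact ⟨MvPolynomial.X 0 * q, (polyAct_X_zero_mul _ _ _).symm⟩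
  · rw [mem_graphIdeal, hf]
    simp only [Set.mem_singleton_iff, forall_eq]
    rfl

theorem coordMk_one_tprod_mem (A B : Set ℂ) :
    tprod (coordRing A) (coordRing B) (coordMk A 1) (coordMk B 1) ∈
      (tensor (coordRing A) (coordRing B)).gr 0 := by
  have h := tprod_mem (coordMk_one_mem A) (coordMk_one_mem B)
  rwa [add_zero] at h

/-- As 1 generates `𝒪(α)` as a right module, the first factor can be moved across the tensor sign.
-/
theorem tensor_singleton_normal {α : ℂ} {N : GrBimod} (x : tensor (coordRing {α}) N) :
    ∃ n, x = tprod (coordRing {α}) N (coordMk {α} 1) n := by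
  induction x using tprod_induction with
  | tmul m n =>
    induction m using coordRing_induction generalizing n with
    | one => exact ⟨n, rfl⟩
    | smul c x hx =>
      obtain ⟨n', h⟩ := hx n
      exact ⟨c • n', by rw [map_smul, LinearMap.smul_apply, h, map_smul]⟩
    | add x y hx hy =>
      obtain ⟨n₁, h₁⟩ := hx n
      obtain ⟨n₂, h₂⟩ := hy n
      exact ⟨n₁ + n₂, by rw [map_add, LinearMap.add_apply, h₁, h₂, map_add]⟩
    | lX x hx =>
      obtain ⟨n', h⟩ := hx n
      exact ⟨α • N.lX n', by rw [← lX_tprod, h, lX_tprod, coordRing_singleton_lX_one, map_smul,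
        LinearMap.smul_apply, tprod_balanced, map_smul]⟩
    | rX x hx =>
      rw [tprod_balanced]
      exact hx _
  | add x y hx hy =>
    obtain ⟨n₁, h₁⟩ := hx
    obtain ⟨n₂, h₂⟩ := hy
    exact ⟨n₁ + n₂, by rw [h₁, h₂, map_add]⟩

/-- On a normal form 1 ⊗ n the line homomorphisms of the tensor product are those of n, and these
separate the elements of `𝒪(B)`. -/
theorem tensor_singleton_ext {α : ℂ} {B : Set ℂ}
    (x : tensor (coordRing {α}) (coordRing B))
    (h : ∀ b (hb : b ∈ B), (coordLine (Set.mem_singleton α)).tensor (coordLine hb) x = 0) :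
    x = 0 := by
  obtain ⟨n, rfl⟩ := tensor_singleton_normal x
  rw [coordRing_eq_zero n fun b hb => ?_, map_zero]
  have := h b hb
  rwa [LineHom.tensor_tprod, coordLine_one, map_one, one_mul] at this

/-- `𝒪(α) ⊗ 𝒪(B) ≅ 𝒪(α B)`. -/
theorem iso_tensor_singleton {α : ℂ} (hα : α ≠ 0) (B : Set ℂ) :
    Nonempty (Iso (tensor (coordRing {α}) (coordRing B)) (coordRing ((α * ·) '' B))) := by
  have hu : ∀ b (hb : b ∈ B), (coordLine (Set.mem_singleton α)).tensor (coordLine hb)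
      (tprod (coordRing {α}) (coordRing B) (coordMk {α} 1) (coordMk B 1)) = 1 := by
    intro b hb
    rw [LineHom.tensor_tprod, coordLine_one, coordLine_one, map_one, one_mul]
  refine iso_coordRing (tprod (coordRing {α}) (coordRing B) (coordMk {α} 1) (coordMk B 1))
    (coordMk_one_tprod_mem _ _) (fun m => ?_) fun p => ?_
  · obtain ⟨n, rfl⟩ := tensor_singleton_normal m
    induction n using coordRing_induction with
    | one => exact ⟨1, (polyAct_one _ _).symm⟩
    | smul c x hx =>
      obtain ⟨p, h⟩ := hx
      exact ⟨c • p, by rw [map_smul, h, map_smul, LinearMap.smul_apply]⟩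
    | add x y hx hy =>
      obtain ⟨p, hp⟩ := hx
      obtain ⟨q, hq⟩ := hy
      exact ⟨p + q, by rw [map_add, hp, hq, map_add, LinearMap.add_apply]⟩
    | lX x hx =>
      obtain ⟨p, h⟩ := hx
      -- On elements 1 ⊗ n the left multiplication by X is α times the one in the middle, so the
      -- latter is recovered by dividing by α.
      refine ⟨α⁻¹ • (MvPolynomial.X 0 * p), ?_⟩
      rw [map_smul, LinearMap.smul_apply, polyAct_X_zero_mul, ← h, lX_tprod,
        coordRing_singleton_lX_one, map_smul, LinearMap.smul_apply, smul_smul,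
        inv_mul_cancel₀ hα, one_smul, tprod_balanced]
    | rX x hx =>
      obtain ⟨p, h⟩ := hx
      exact ⟨MvPolynomial.X 1 * p, by rw [polyAct_X_one_mul, ← h, rX_tprod]⟩
  · rw [mem_graphIdeal]
    constructor
    · rintro hp _ ⟨b, hb, rfl⟩
      have h := congrArg ((coordLine (Set.mem_singleton α)).tensor (coordLine hb)) hp
      rwa [LineHom.map_polyAct, hu, mul_one, map_zero] at h
    · intro hp
      refine tensor_singleton_ext _ fun b hb => ?_
      rw [LineHom.map_polyAct, hp _ ⟨b, hb, rfl⟩, zero_mul]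

/-- Since 1 and x generate `𝒪(e, s)` as a right module, all further coefficients can be moved into
N. -/
theorem tensor_pair_normal {ζ : ℂ} {N : GrBimod} (x : tensor (coordRing {1, ζ}) N) :
    ∃ n n', x = tprod (coordRing {1, ζ}) N (coordMk {1, ζ} 1) n +
      (tensor (coordRing {1, ζ}) N).lX (tprod (coordRing {1, ζ}) N (coordMk {1, ζ} 1) n') := by
  induction x using tprod_induction with
  | tmul m n =>
    induction m using coordRing_induction generalizing n with
    | one => exact ⟨n, 0, by rw [map_zero, map_zero, add_zero]⟩
    | smul c x hx =>
      obtain ⟨n₁, n₂, h⟩ := hx n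
      exact ⟨c • n₁, c • n₂, by
        rw [map_smul, LinearMap.smul_apply, h, smul_add, map_smul, map_smul, map_smul]⟩
    | add x y hx hy =>
      obtain ⟨n₁, n₁', h₁⟩ := hx n
      obtain ⟨n₂, n₂', h₂⟩ := hy n
      exact ⟨n₁ + n₂, n₁' + n₂', by
        rw [map_add, LinearMap.add_apply, h₁, h₂]; simp only [map_add]; abel⟩
    | lX x hx =>
      obtain ⟨n₁, n₂, h⟩ := hx n
      -- The witnesses come from x² = (1 + ζ) x z - ζ z², where z is the right coordinate of the
      -- first factor; in the tensor product it acts as the left coordinate of N.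
      refine ⟨- ζ • N.lX (N.lX n₂), n₁ + (1 + ζ) • N.lX n₂, ?_⟩
      rw [← lX_tprod, h, map_add, lX_tprod, lX_tprod, lX_tprod, coordRing_pair_lX_lX_one, map_sub,
        map_smul, map_smul, LinearMap.sub_apply, LinearMap.smul_apply, LinearMap.smul_apply,
        tprod_balanced, tprod_balanced, tprod_balanced, map_smul, lX_tprod, map_add, map_smul,
        neg_smul]
      abel
    | rX x hx =>
      rw [tprod_balanced]
      exact hx _
  | add x y hx hy =>
    obtain ⟨n₁, n₁', h₁⟩ := hx
    obtain ⟨n₂, n₂', h₂⟩ := hy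
    exact ⟨n₁ + n₂, n₁' + n₂', by rw [h₁, h₂]; simp only [map_add]; abel⟩

/-- On the lines with a = 1 and a = ζ over a fixed b, the normal form takes the values n_b + abX
n'_b. This is a linear system over ℂ[X] with determinant (ζ - 1) b X ≠ 0, so n and n' vanish on
every line of B. -/
theorem tensor_pair_ext {ζ : ℂ} (hζ : ζ ≠ 1) {B : Set ℂ} (hB : ∀ b ∈ B, b ≠ 0)
    (x : tensor (coordRing {1, ζ}) (coordRing B))
    (h : ∀ a (ha : a ∈ ({1, ζ} : Set ℂ)) b (hb : b ∈ B),
      (coordLine ha).tensor (coordLine hb) x = 0) : x = 0 := by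
  obtain ⟨n, n', rfl⟩ := tensor_pair_normal x
  have key : ∀ b (hb : b ∈ B), coordLine hb n = 0 ∧ coordLine hb n' = 0 := by
    intro b hb
    have h1 := h 1 (by simp) b hb
    have h2 := h ζ (by simp) b hb
    rw [map_add, LineHom.map_lX, LineHom.tensor_tprod, LineHom.tensor_tprod, coordLine_one,
      map_one, one_mul] at h1 h2
    have h3 : Polynomial.C ((ζ - 1) * b) * (Polynomial.X * coordLine hb n') = 0 := by
      simp only [Polynomial.C_mul, Polynomial.C_sub, Polynomial.C_1, one_mul] at h1 h2 ⊢
      linear_combination h2 - h1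
    have h4 : coordLine hb n' = 0 := by
      refine (mul_eq_zero.1 ((mul_eq_zero.1 h3).resolve_left ?_)).resolve_left Polynomial.X_ne_zero
      rw [Polynomial.C_eq_zero]
      exact mul_ne_zero (sub_ne_zero.2 hζ) (hB b hb)
    rw [h4, mul_zero, mul_zero, add_zero] at h1
    exact ⟨h1, h4⟩
  rw [coordRing_eq_zero n fun b hb => (key b hb).1, coordRing_eq_zero n' fun b hb => (key b hb).2]
  simp only [map_zero, add_zero]

/-- The multiplication by `X` in the middle of a tensor product. -/
noncomputable def midX (M N : GrBimod) : tensor M N →ₗ[ℂ] tensor M N :=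
  lift ((tprod M N).compl₂ N.lX) (fun m n => by
    rw [LinearMap.compl₂_apply, LinearMap.compl₂_apply, tprod_balanced])

theorem midX_tprod {M N : GrBimod} (m : M) (n : N) :
    midX M N (tprod M N m n) = tprod M N m (N.lX n) := lift_tprod _ (fun m n => by
    rw [LinearMap.compl₂_apply, LinearMap.compl₂_apply, tprod_balanced]) m n

theorem midX_lX {M N : GrBimod} (x : tensor M N) :
    midX M N ((tensor M N).lX x) = (tensor M N).lX (midX M N x) := by
  induction x using tprod_induction with
  | tmul m n => rw [lX_tprod, midX_tprod, midX_tprod, lX_tprod]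
  | add x y hx hy => simp only [map_add, hx, hy]

theorem midX_rX {M N : GrBimod} (x : tensor M N) :
    midX M N ((tensor M N).rX x) = (tensor M N).rX (midX M N x) := by
  induction x using tprod_induction with
  | tmul m n => rw [rX_tprod, midX_tprod, midX_tprod, rX_tprod, N.lX_rX]
  | add x y hx hy => simp only [map_add, hx, hy]

theorem midX_polyAct {M N : GrBimod} (p : MvPolynomial (Fin 2) ℂ) (x : tensor M N) :
    midX M N (polyAct _ p x) = polyAct _ p (midX M N x) := by
  induction p using mvPolynomial_induction with
  | one => rw [polyAct_one, polyAct_one]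
  | smul a p hp => simp only [map_smul, LinearMap.smul_apply, hp]
  | add p q hp hq => simp only [map_add, LinearMap.add_apply, hp, hq]
  | X0 p hp => rw [polyAct_X_zero_mul, polyAct_X_zero_mul, midX_lX, hp]
  | X1 p hp => rw [polyAct_X_one_mul, polyAct_X_one_mul, midX_rX, hp]

/-- The subbimodule generated by two elements. -/
noncomputable def polySpan (M : GrBimod) (u t : M) : Submodule ℂ M :=
  LinearMap.range ((polyAct M).flip u) ⊔ LinearMap.range ((polyAct M).flip t)

theorem mem_polySpan {M : GrBimod} {u t x : M} :
    x ∈ polySpan M u t ↔ ∃ p q, x = polyAct M p u + polyAct M q t := by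
  rw [polySpan, Submodule.mem_sup]
  constructor
  · rintro ⟨_, ⟨p, rfl⟩, _, ⟨q, rfl⟩, rfl⟩
    exact ⟨p, q, rfl⟩
  · rintro ⟨p, q, rfl⟩
    exact ⟨_, ⟨p, rfl⟩, _, ⟨q, rfl⟩, rfl⟩

theorem left_mem_polySpan {M : GrBimod} (u t : M) : u ∈ polySpan M u t :=
  mem_polySpan.2 ⟨1, 0, by rw [polyAct_one, map_zero, LinearMap.zero_apply, add_zero]⟩

theorem right_mem_polySpan {M : GrBimod} (u t : M) : t ∈ polySpan M u t :=
  mem_polySpan.2 ⟨0, 1, by rw [polyAct_one, map_zero, LinearMap.zero_apply, zero_add]⟩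

theorem lX_mem_polySpan {M : GrBimod} {u t x : M} (hx : x ∈ polySpan M u t) :
    M.lX x ∈ polySpan M u t := by
  obtain ⟨p, q, rfl⟩ := mem_polySpan.1 hx
  exact mem_polySpan.2 ⟨MvPolynomial.X 0 * p, MvPolynomial.X 0 * q, by
    rw [polyAct_X_zero_mul, polyAct_X_zero_mul, map_add]⟩

theorem rX_mem_polySpan {M : GrBimod} {u t x : M} (hx : x ∈ polySpan M u t) :
    M.rX x ∈ polySpan M u t := by
  obtain ⟨p, q, rfl⟩ := mem_polySpan.1 hx
  exact mem_polySpan.2 ⟨MvPolynomial.X 1 * p, MvPolynomial.X 1 * q, by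
    rw [polyAct_X_one_mul, polyAct_X_one_mul, map_add]⟩

theorem polyAct_mem_polySpan {M : GrBimod} {u t x : M} (p : MvPolynomial (Fin 2) ℂ)
    (hx : x ∈ polySpan M u t) : polyAct M p x ∈ polySpan M u t := by
  induction p using mvPolynomial_induction with
  | one => rwa [polyAct_one]
  | smul a p hp => rw [map_smul]; exact Submodule.smul_mem _ _ hp
  | add p q hp hq => rw [map_add]; exact add_mem hp hq
  | X0 p hp => rw [polyAct_X_zero_mul]; exact lX_mem_polySpan hp
  | X1 p hp => rw [polyAct_X_one_mul]; exact rX_mem_polySpan hp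

theorem polySpan_le {M : GrBimod} {u t u' t' : M} (hu : u ∈ polySpan M u' t')
    (ht : t ∈ polySpan M u' t') {x : M} (hx : x ∈ polySpan M u t) : x ∈ polySpan M u' t' := by
  obtain ⟨p, q, rfl⟩ := mem_polySpan.1 hx
  exact add_mem (polyAct_mem_polySpan p hu) (polyAct_mem_polySpan q ht)

/-- Let Z be the multiplication by X in the middle. The quadratic relation of `𝒪(e, s)`, solved for
Z² with ζ invertible, reads ζ Z² u = (1 + ζ) X Z u - X² u. So the subbimodule generated by u = 1 ⊗ 1
and t = Z u is stable under Z, and normal forms lie in it. -/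
theorem tensor_pair_mem_polySpan {ζ : ℂ} (hζ : ζ ≠ 0) {B : Set ℂ}
    (x : tensor (coordRing {1, ζ}) (coordRing B)) :
    x ∈ polySpan _ (tprod (coordRing {1, ζ}) (coordRing B) (coordMk _ 1) (coordMk B 1))
      (tprod (coordRing {1, ζ}) (coordRing B) (coordMk _ 1)
        ((coordRing B).lX (coordMk B 1))) := by
  set u := tprod (coordRing {1, ζ}) (coordRing B) (coordMk _ 1) (coordMk B 1) with hu
  set t := tprod (coordRing {1, ζ}) (coordRing B) (coordMk _ 1) ((coordRing B).lX (coordMk B 1))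
    with ht
  have hZu : midX _ _ u = t := midX_tprod _ _
  have hZt : midX _ _ t ∈ polySpan _ u t := by
    have h : ζ • midX _ _ t = (1 + ζ) • (tensor (coordRing {1, ζ}) (coordRing B)).lX t -
        (tensor (coordRing {1, ζ}) (coordRing B)).lX
          ((tensor (coordRing {1, ζ}) (coordRing B)).lX u) := by
      rw [ht, hu, midX_tprod, lX_tprod, lX_tprod, lX_tprod, coordRing_pair_lX_lX_one, map_sub,
        map_smul, map_smul, LinearMap.sub_apply, LinearMap.smul_apply, LinearMap.smul_apply,
        tprod_balanced, tprod_balanced, tprod_balanced]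
      abel
    have h' : midX _ _ t = ζ⁻¹ • (ζ • midX _ _ t) := by
      rw [smul_smul, inv_mul_cancel₀ hζ, one_smul]
    rw [h', h]
    exact Submodule.smul_mem _ _ (Submodule.sub_mem _
      (Submodule.smul_mem _ _ (lX_mem_polySpan (right_mem_polySpan _ _)))
      (lX_mem_polySpan (lX_mem_polySpan (left_mem_polySpan _ _))))
  have hZ : ∀ y, y ∈ polySpan _ u t → midX _ _ y ∈ polySpan _ u t := by
    intro y hy
    obtain ⟨p, q, rfl⟩ := mem_polySpan.1 hy
    rw [map_add, midX_polyAct, midX_polyAct, hZu]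
    exact add_mem (polyAct_mem_polySpan p (right_mem_polySpan _ _)) (polyAct_mem_polySpan q hZt)
  have key : ∀ n, tprod (coordRing {1, ζ}) (coordRing B) (coordMk _ 1) n ∈ polySpan _ u t := by
    intro n
    induction n using coordRing_induction with
    | one => exact left_mem_polySpan _ _
    | smul c x hx => rw [map_smul]; exact Submodule.smul_mem _ _ hx
    | add x y hx hy => rw [map_add]; exact add_mem hx hy
    | lX x hx => rw [← midX_tprod]; exact hZ _ hx
    | rX x hx => rw [← rX_tprod]; exact rX_mem_polySpan hx
  obtain ⟨n, n', rfl⟩ := tensor_pair_normal x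
  exact add_mem (key n) (lX_mem_polySpan (key n'))

/-- `𝒪(e, s) ⊗ 𝒪(B) ≅ 𝒪(B ∪ s B) ⊕ 𝒪(B ∩ s B)[-2]`, if a linear function vanishes on the lines
that occur only once. -/
theorem iso_tensor_pair {ζ : ℂ} (hζ0 : ζ ≠ 0) (hζ1 : ζ ≠ 1) {B : Set ℂ} (hB : ∀ b ∈ B, b ≠ 0)
    (l m : ℂ) (h₁ : ∀ b ∈ B, b ∉ (ζ * ·) '' B → b - l * b - m = 0)
    (h₂ : ∀ b ∈ B, ζ * b ∉ B → b - l * (ζ * b) - m = 0) :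
    Nonempty (Iso (tensor (coordRing {1, ζ}) (coordRing B))
      (sum (coordRing (B ∪ (ζ * ·) '' B)) (shift (coordRing (B ∩ (ζ * ·) '' B)) (-2)))) := by
  set M := tensor (coordRing {1, ζ}) (coordRing B) with hM
  let u : M := tprod (coordRing {1, ζ}) (coordRing B) (coordMk _ 1) (coordMk B 1)
  let t : M := tprod (coordRing {1, ζ}) (coordRing B) (coordMk _ 1)
    ((coordRing B).lX (coordMk B 1))
  -- This is the linear form Z - l x - m y applied to u, with x, y the outer coordinates. On the
  -- line of (a, b) it is (b - l a b - m) X, so `h₁` and `h₂` say that it vanishes on the lines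
  -- whose outer slope ab occurs once. What remains is supported on B ∩ ζB.
  let w : M := t - l • M.lX u - m • M.rX u
  have hu : u ∈ M.gr 0 := coordMk_one_tprod_mem _ _
  have ht : t ∈ M.gr 2 := by
    have h := tprod_mem (coordMk_one_mem {1, ζ}) ((coordRing B).lX_mem 0 _ (coordMk_one_mem B))
    rwa [zero_add, zero_add] at h
  have hw : w ∈ M.gr 2 := Submodule.sub_mem _ (Submodule.sub_mem _ ht
    (Submodule.smul_mem _ _ (M.lX_mem 0 u hu))) (Submodule.smul_mem _ _ (M.rX_mem 0 u hu))
  have lu : ∀ a (ha : a ∈ ({1, ζ} : Set ℂ)) b (hb : b ∈ B),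
      (coordLine ha).tensor (coordLine hb) u = 1 := by
    intro a ha b hb
    rw [LineHom.tensor_tprod, coordLine_one, coordLine_one, map_one, one_mul]
  have lw : ∀ a (ha : a ∈ ({1, ζ} : Set ℂ)) b (hb : b ∈ B),
      (coordLine ha).tensor (coordLine hb) w = Polynomial.C (b - l * (a * b) - m) *
        Polynomial.X := by
    intro a ha b hb
    rw [map_sub, map_sub, map_smul, map_smul, LineHom.map_lX, LineHom.map_rX, lu,
      LineHom.tensor_tprod, LineHom.map_lX, coordLine_one, coordLine_one, map_one]
    simp only [Polynomial.smul_eq_C_mul, Polynomial.C_sub, Polynomial.C_mul]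
    ring
  have val : ∀ p q a (ha : a ∈ ({1, ζ} : Set ℂ)) b (hb : b ∈ B),
      (coordLine ha).tensor (coordLine hb) (polyAct M p u + polyAct M q w) =
        restrictLine (a * b) p + restrictLine (a * b) q *
          (Polynomial.C (b - l * (a * b) - m) * Polynomial.X) := by
    intro p q a ha b hb
    rw [map_add, LineHom.map_polyAct, LineHom.map_polyAct, lu, lw, mul_one]
  refine iso_sum_coordRing u w hu hw (fun x => ?_) (fun p hp => ?_) (fun q hq => ?_)
    (fun p q hpq => ?_)
  -- The generator t may be replaced by w, as they differ by a combination of `lX u` and `rX u`.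
  · refine mem_polySpan.1 (polySpan_le (left_mem_polySpan u w) ?_
      (tensor_pair_mem_polySpan hζ0 x))
    have h : t = w + l • M.lX u + m • M.rX u := by simp only [w]; abel
    change t ∈ _
    rw [h]
    exact add_mem (add_mem (right_mem_polySpan u w) (Submodule.smul_mem _ _
      (lX_mem_polySpan (left_mem_polySpan u w)))) (Submodule.smul_mem _ _
      (rX_mem_polySpan (left_mem_polySpan u w)))
  · refine tensor_pair_ext hζ1 hB _ fun a ha b hb => ?_
    rw [LineHom.map_polyAct, mem_graphIdeal.1 hp, zero_mul]
    rcases ha with rfl | ha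
    · rw [one_mul]; exact Or.inl hb
    · rw [Set.mem_singleton_iff.1 ha]; exact Or.inr ⟨b, hb, rfl⟩
  · refine tensor_pair_ext hζ1 hB _ fun a ha b hb => ?_
    rw [LineHom.map_polyAct, lw]
    rcases ha with rfl | ha
    · rw [one_mul]
      by_cases hb' : b ∈ (ζ * ·) '' B
      · rw [mem_graphIdeal.1 hq b ⟨hb, hb'⟩, zero_mul]
      · rw [h₁ b hb hb', Polynomial.C_0, zero_mul, mul_zero]
    · rw [Set.mem_singleton_iff.1 ha]
      by_cases hb' : ζ * b ∈ B
      · rw [mem_graphIdeal.1 hq (ζ * b) ⟨hb', b, hb, rfl⟩, zero_mul]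
      · rw [h₂ b hb hb', Polynomial.C_0, zero_mul, mul_zero]
  -- A slope e = ζb in the intersection comes from two lines, (1, ζb) and (ζ, b). The values of p u
  -- + q w there differ by (ζ - 1) b X q, so q vanishes on the slope e, and then p does too.
  · have hE : ∀ e ∈ B ∩ (ζ * ·) '' B, restrictLine e p = 0 ∧ restrictLine e q = 0 := by
      rintro _ ⟨he, b, hb, rfl⟩
      have e1 := val p q 1 (by simp) _ he
      have e2 := val p q ζ (by simp) b hb
      rw [hpq, map_zero] at e1 e2
      simp only [one_mul] at e1 he ⊢
      have e3 : Polynomial.C ((ζ - 1) * b) * (Polynomial.X * restrictLine (ζ * b) q) = 0 := by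
        simp only [Polynomial.C_sub, Polynomial.C_mul, Polynomial.C_1] at e1 e2 ⊢
        linear_combination e2 - e1
      have e4 : restrictLine (ζ * b) q = 0 := by
        refine (mul_eq_zero.1 ((mul_eq_zero.1 e3).resolve_left ?_)).resolve_left
          Polynomial.X_ne_zero
        rw [Polynomial.C_eq_zero]
        exact mul_ne_zero (sub_ne_zero.2 hζ1) (hB b hb)
      rw [e4, zero_mul, add_zero] at e2
      exact ⟨e2.symm, e4⟩
    refine ⟨mem_graphIdeal.2 fun e he => ?_, mem_graphIdeal.2 fun e he => (hE e he).2⟩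
    rcases he with he | ⟨b, hb, rfl⟩
    · by_cases he' : e ∈ (ζ * ·) '' B
      · exact (hE e ⟨he, he'⟩).1
      · have e1 := val p q 1 (by simp) e he
        rw [hpq, map_zero, one_mul, h₁ e he he', Polynomial.C_0, zero_mul, mul_zero,
          add_zero] at e1
        exact e1.symm
    · by_cases he' : ζ * b ∈ B
      · exact (hE _ ⟨he', b, hb, rfl⟩).1
      · have e1 := val p q ζ (by simp) b hb
        rw [hpq, map_zero, h₂ b hb he', Polynomial.C_0, zero_mul, mul_zero, add_zero] at e1
        exact e1.symm

end GrBimod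

end SoergelRankOne

/-! ### Rigidity of the function rings. -/

namespace SoergelRankOne

namespace GrBimod

theorem coordMk_one_ne_zero {A : Set ℂ} (hA : A.Nonempty) : coordMk A 1 ≠ 0 := by
  obtain ⟨a, ha⟩ := hA
  intro h
  have h1 := coordLine_one ha
  rw [h, map_zero] at h1
  exact zero_ne_one h1

theorem coordRing_gr_neg {A : Set ℂ} {i : ℤ} (hi : i < 0) {x : coordRing A}
    (hx : x ∈ (coordRing A).gr i) : x = 0 := by
  have h := map_gr_coordRing (A := A) LinearMap.id ⊥ i (fun k p hk _ => by omega) x hx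
  exact h

theorem coordRing_gr_zero {A : Set ℂ} {x : coordRing A} (hx : x ∈ (coordRing A).gr 0) :
    ∃ c : ℂ, x = c • coordMk A 1 := by
  have h := map_gr_coordRing (A := A) LinearMap.id (Submodule.span ℂ {coordMk A 1}) 0
    (fun k p hk hp => by
      obtain rfl : k = 0 := by omega
      rw [MvPolynomial.totalDegree_eq_zero_iff_eq_C.1
        (Nat.le_zero.1 hp.totalDegree_le)]
      refine Submodule.mem_span_singleton.2 ⟨MvPolynomial.coeff 0 p, ?_⟩
      rw [← map_smul, MvPolynomial.smul_eq_C_mul, mul_one]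
      rfl) x hx
  obtain ⟨c, hc⟩ := Submodule.mem_span_singleton.1 h
  exact ⟨c, hc.symm⟩

/-- The bimodule is generated by 1, and the component of degree zero of `𝒪(A)` consists of the
multiples of 1. An endomorphism of degree zero is determined by the scalar by which it multiplies 1.
-/
theorem brick_shift_coordRing {A : Set ℂ} (hA : A.Nonempty) (n : ℤ) :
    Brick (shift (coordRing A) n) where
  nontrivial := ⟨⟨coordMk A 1, 0, coordMk_one_ne_zero hA⟩⟩
  scalar f := by
    let g : Hom (coordRing A) (coordRing A) :=
      { toLin := f.toLin
        map_lX := f.map_lX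
        map_rX := f.map_rX
        map_gr := fun i x hx => by
          have hx' : x ∈ (coordRing A).gr (n + (i - n)) := by rwa [add_sub_cancel]
          have h : f.toLin x ∈ (coordRing A).gr (n + (i - n)) := f.map_gr (i - n) x hx'
          rwa [add_sub_cancel] at h }
    obtain ⟨c, hc⟩ := coordRing_gr_zero (g.map_gr 0 _ (coordMk_one_mem A))
    refine ⟨c, fun x => ?_⟩
    obtain ⟨p, rfl⟩ := coordMk_surjective A x
    change g (coordMk A p) = c • coordMk A p
    rw [coordMk_eq_polyAct, g.map_polyAct, hc, map_smul]

/-- For finite A, the product of the linear forms x - a y over a ∈ A lies in the ideal of A and is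
nonzero on every other line of the form {(bv, v)}. -/
theorem subset_of_graphIdeal_le {A A' : Set ℂ} (hA : A.Finite)
    (h : graphIdeal A ≤ graphIdeal A') : A' ⊆ A := by
  intro b hb
  let p : MvPolynomial (Fin 2) ℂ := ∏ a ∈ hA.toFinset,
    (MvPolynomial.X 0 - MvPolynomial.C a * MvPolynomial.X 1)
  have hp : ∀ c, restrictLine c p = ∏ a ∈ hA.toFinset, Polynomial.C (c - a) * Polynomial.X := by
    intro c
    rw [map_prod]
    refine Finset.prod_congr rfl fun a _ => ?_
    rw [map_sub, map_mul, restrictLine_X_zero, restrictLine_X_one,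
      show MvPolynomial.C a = algebraMap ℂ (MvPolynomial (Fin 2) ℂ) a from rfl, AlgHom.commutes,
      Polynomial.algebraMap_eq, Polynomial.C_sub]
    ring
  have hpA : p ∈ graphIdeal A := mem_graphIdeal.2 fun a ha => by
    rw [hp]
    exact Finset.prod_eq_zero (hA.mem_toFinset.2 ha) (by rw [sub_self, Polynomial.C_0, zero_mul])
  have h1 := mem_graphIdeal.1 (h hpA) b hb
  rw [hp, Finset.prod_eq_zero_iff] at h1
  obtain ⟨a, ha, h2⟩ := h1
  have h3 := Polynomial.C_eq_zero.1 ((mul_eq_zero.1 h2).resolve_right Polynomial.X_ne_zero)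
  rw [sub_eq_zero.1 h3]
  exact hA.mem_toFinset.1 ha

/-- The nonzero generator 1 sits in degree -n after the shift, and the target vanishes below degree
-n'. -/
theorem le_of_iso_shift_coordRing {A A' : Set ℂ} {n n' : ℤ} (hA : A.Nonempty)
    (e : Iso (shift (coordRing A) n) (shift (coordRing A') n')) : n ≤ n' := by
  by_contra h
  have hone : coordMk A 1 ∈ (coordRing A).gr (n + -n) := by
    rw [add_neg_cancel]; exact coordMk_one_mem A
  have h1 : e.e (coordMk A 1) ∈ (coordRing A').gr (n' + -n) := (e.mem_gr (-n) _).2 hone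
  have h2 := coordRing_gr_neg (by omega) h1
  exact coordMk_one_ne_zero hA (e.e.map_eq_zero_iff.1 h2)

/-- An isomorphism maps 1 to a nonzero multiple of 1, and the annihilator of 1 is the ideal of the
lines. -/
theorem graphIdeal_le_of_iso {A A' : Set ℂ} {n : ℤ} (hA : A.Nonempty)
    (e : Iso (shift (coordRing A) n) (shift (coordRing A') n)) : graphIdeal A ≤ graphIdeal A' := by
  have hone : coordMk A 1 ∈ (coordRing A).gr (n + -n) := by
    rw [add_neg_cancel]; exact coordMk_one_mem A
  have h1 : e.e (coordMk A 1) ∈ (coordRing A').gr (n + -n) := (e.mem_gr (-n) _).2 hone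
  rw [add_neg_cancel] at h1
  obtain ⟨c, hc⟩ := coordRing_gr_zero h1
  have hc0 : c ≠ 0 := by
    rintro rfl
    rw [zero_smul] at hc
    exact coordMk_one_ne_zero hA (e.e.map_eq_zero_iff.1 hc)
  intro p hp
  have h2 : polyAct (coordRing A) p (coordMk A 1) = 0 := by
    rw [← coordMk_eq_polyAct]
    exact coordMk_eq_zero.2 hp
  have h3 : polyAct (coordRing A') p (e.e (coordMk A 1)) = 0 := by
    refine (e.hom.map_polyAct p (coordMk A 1)).symm.trans ?_
    refine (congrArg e.e h2).trans ?_
    exact map_zero e.e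
  rw [hc, map_smul, ← coordMk_eq_polyAct] at h3
  exact coordMk_eq_zero.1 ((smul_eq_zero.1 h3).resolve_left hc0)

/-- The lowest degree recovers the shift and the annihilator of the generator recovers the set of
lines. This is what makes weights of arcs well defined. -/
theorem eq_of_iso_shift_coordRing {A A' : Set ℂ} {n n' : ℤ} (hA : A.Nonempty) (hA' : A'.Nonempty)
    (fA : A.Finite) (fA' : A'.Finite)
    (e : Iso (shift (coordRing A) n) (shift (coordRing A') n')) : n = n' ∧ A = A' := by
  obtain rfl := le_antisymm (le_of_iso_shift_coordRing hA e) (le_of_iso_shift_coordRing hA' e.symm)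
  exact ⟨rfl, (subset_of_graphIdeal_le fA' (graphIdeal_le_of_iso hA' e.symm)).antisymm
    (subset_of_graphIdeal_le fA (graphIdeal_le_of_iso hA e))⟩

/-! ### Arcs of consecutive powers of ζ and their tensor product rules. -/

/-- The arc of the `k` consecutive powers of `ζ` that starts at `ζ ^ a`. -/
def arc (ζ : ℂ) (a k : ℕ) : Set ℂ := {x | ∃ i < k, x = ζ ^ (a + i)}

section arc

variable {ζ : ℂ} {d : ℕ}

theorem arc_zero (a : ℕ) : arc ζ a 0 = ∅ := by
  ext x
  simp [arc]

theorem arc_one (a : ℕ) : arc ζ a 1 = {ζ ^ a} := by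
  ext x
  simp [arc]

theorem arc_two : arc ζ 0 2 = {1, ζ} := by
  ext x
  constructor
  · rintro ⟨i, hi, rfl⟩
    interval_cases i <;> simp
  · rintro (rfl | rfl)
    · exact ⟨0, by omega, by simp⟩
    · exact ⟨1, by omega, by simp⟩

theorem finite_arc (a k : ℕ) : (arc ζ a k).Finite := by
  have h : arc ζ a k = (fun i => ζ ^ (a + i)) '' Set.Iio k := by
    ext x
    simp [arc, eq_comm]
  rw [h]
  exact (Set.finite_Iio k).image _

theorem nonempty_arc {a k : ℕ} (hk : 1 ≤ k) : (arc ζ a k).Nonempty := ⟨ζ ^ (a + 0), 0, hk, rfl⟩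

theorem ncard_arc (hζ : IsPrimitiveRoot ζ d) (hd : d ≠ 0) {a k : ℕ} (hk : k ≤ d) :
    (arc ζ a k).ncard = k := by
  have h : arc ζ a k = (fun i => ζ ^ (a + i)) '' (Finset.range k : Set ℕ) := by
    ext x
    simp [arc, eq_comm]
  rw [h, Set.InjOn.ncard_image, Set.ncard_coe_finset, Finset.card_range]
  intro i hi j hj hij
  simp only [Finset.coe_range, Set.mem_Iio] at hi hj
  have h0 : ζ ^ a ≠ 0 := pow_ne_zero _ (hζ.ne_zero hd)
  simp only [pow_add] at hij
  exact hζ.pow_inj (by omega) (by omega) (mul_left_cancel₀ h0 hij)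

theorem mul_image_arc (a k : ℕ) : (ζ * ·) '' arc ζ a k = arc ζ (a + 1) k := by
  ext x
  constructor
  · rintro ⟨_, ⟨i, hi, rfl⟩, rfl⟩
    exact ⟨i, hi, by simp only; ring⟩
  · rintro ⟨i, hi, rfl⟩
    exact ⟨_, ⟨i, hi, rfl⟩, by simp only; ring⟩

theorem arc_union (a j : ℕ) : arc ζ a (j + 1) ∪ arc ζ (a + 1) (j + 1) = arc ζ a (j + 2) := by
  ext x
  constructor
  · rintro (⟨i, hi, rfl⟩ | ⟨i, hi, rfl⟩)
    · exact ⟨i, by omega, rfl⟩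
    · exact ⟨i + 1, by omega, by ring⟩
  · rintro ⟨i, hi, rfl⟩
    rcases i with _ | i
    · exact Or.inl ⟨0, by omega, rfl⟩
    · exact Or.inr ⟨i, by omega, by ring⟩

theorem pow_succ_ne_one (hζ : IsPrimitiveRoot ζ d) {j : ℕ} (hj : j + 1 < d) : ζ ^ (j + 1) ≠ 1 :=
  hζ.pow_ne_one_of_pos_of_lt (by omega) hj

theorem pow_start_notMem (hζ : IsPrimitiveRoot ζ d) {a j : ℕ} (hj : j + 1 < d) :
    ζ ^ a ∉ arc ζ (a + 1) (j + 1) := by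
  rintro ⟨i, hi, h⟩
  have h0 : ζ ^ a ≠ 0 := pow_ne_zero _ (hζ.ne_zero (by omega))
  have h1 : ζ ^ a * ζ ^ (i + 1) = ζ ^ a * 1 := by
    rw [mul_one, ← pow_add]
    conv_rhs => rw [h]
    congr 1
    omega
  exact pow_succ_ne_one hζ (j := i) (by omega) (mul_left_cancel₀ h0 h1)

/-- The bound on j ensures that the rotated arc does not wrap around to the start ζ^a of the first
one; for the full circle the intersection is the whole arc instead. -/
theorem arc_inter (hζ : IsPrimitiveRoot ζ d) {a j : ℕ} (hj : j + 1 < d) :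
    arc ζ a (j + 1) ∩ arc ζ (a + 1) (j + 1) = arc ζ (a + 1) j := by
  ext x
  constructor
  · rintro ⟨⟨i, hi, rfl⟩, h⟩
    rcases i with _ | i
    · exact absurd h (pow_start_notMem hζ hj)
    · exact ⟨i, by omega, by ring⟩
  · rintro ⟨i, hi, rfl⟩
    exact ⟨⟨i + 1, by omega, by ring⟩, ⟨i, by omega, rfl⟩⟩

/-- An arc of length d is the whole group of d-th roots of unity, which rotation by ζ preserves. -/
theorem arc_succ_full (hζ : IsPrimitiveRoot ζ d) (a : ℕ) : arc ζ (a + 1) d = arc ζ a d := by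
  ext x
  constructor
  · rintro ⟨i, hi, rfl⟩
    rcases Nat.lt_or_ge (i + 1) d with h | h
    · exact ⟨i + 1, h, by ring⟩
    · refine ⟨0, by omega, ?_⟩
      rw [show a + 1 + i = a + 0 + d by omega, pow_add _ _ d, hζ.pow_eq_one, mul_one]
  · rintro ⟨i, hi, rfl⟩
    rcases i with _ | i
    · refine ⟨d - 1, by omega, ?_⟩
      rw [show a + 1 + (d - 1) = a + 0 + d by omega, pow_add _ _ d, hζ.pow_eq_one, mul_one]
    · exact ⟨i, by omega, by ring⟩

theorem arc_ne_zero (hζ : ζ ≠ 0) {a k : ℕ} : ∀ b ∈ arc ζ a k, b ≠ 0 := by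
  rintro _ ⟨i, _, rfl⟩
  exact pow_ne_zero _ hζ

/-- `𝒪(s) ⊗ 𝒪(B) ≅ 𝒪(s B)` for an arc `B`. -/
theorem iso_singleton_arc (hζ : ζ ≠ 0) (a k : ℕ) :
    Nonempty (Iso (tensor (coordRing {ζ}) (coordRing (arc ζ a k)))
      (coordRing (arc ζ (a + 1) k))) := by
  rw [← mul_image_arc]
  exact iso_tensor_singleton hζ _

/-- The product of `𝒪(e, s)` with the functions on a proper arc. -/
theorem iso_pair_arc (hζ : IsPrimitiveRoot ζ d) {j : ℕ} (hj : j + 1 < d) (a : ℕ) :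
    Nonempty (Iso (tensor (coordRing {1, ζ}) (coordRing (arc ζ a (j + 1))))
      (sum (coordRing (arc ζ a (j + 2))) (shift (coordRing (arc ζ (a + 1) j)) (-2)))) := by
  have h1 : ζ ^ (j + 1) - 1 ≠ 0 := sub_ne_zero.2 (pow_succ_ne_one hζ hj)
  have h0 : ζ ≠ 0 := hζ.ne_zero (by omega)
  -- Only the two end slopes ζ^a and ζ^{a+j+1} occur once, with middle slopes ζ^a and ζ^{a+j}. The
  -- conditions ζ^a = l ζ^a + m and ζ^{a+j} = l ζ^{a+j+1} + m determine l and m. They are solvable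
  -- because ζ^{j+1} ≠ 1, that is, because the arc is proper.
  have h := iso_tensor_pair h0 (hζ.ne_one (by omega))
    (arc_ne_zero (a := a) (k := j + 1) h0) ((ζ ^ j - 1) / (ζ ^ (j + 1) - 1))
    (ζ ^ a * (1 - (ζ ^ j - 1) / (ζ ^ (j + 1) - 1))) ?_ ?_
  · rwa [mul_image_arc, arc_union, arc_inter hζ hj] at h
  · rintro _ ⟨i, hi, rfl⟩ hb
    rcases i with _ | i
    · rw [add_zero]
      ring
    · refine absurd ?_ hb
      rw [mul_image_arc]
      exact ⟨i, by omega, by ring⟩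
  · rintro _ ⟨i, hi, rfl⟩ hb
    rcases Nat.lt_or_ge i j with hij | hij
    · exact absurd ⟨i + 1, by omega, by ring⟩ hb
    · obtain rfl : i = j := by omega
      field_simp
      ring

/-- The product of `𝒪(e, s)` with the functions on all lines. -/
theorem iso_pair_full (hζ : IsPrimitiveRoot ζ d) (hd : 1 < d) (a : ℕ) :
    Nonempty (Iso (tensor (coordRing {1, ζ}) (coordRing (arc ζ a d)))
      (sum (coordRing (arc ζ a d)) (shift (coordRing (arc ζ a d)) (-2)))) := by
  have h0 : ζ ≠ 0 := hζ.ne_zero (by omega)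
  have him : (ζ * ·) '' arc ζ a d = arc ζ a d := by rw [mul_image_arc, arc_succ_full hζ]
  -- On the full circle every slope occurs twice, so the linear form is subject to no condition and
  -- l = m = 0 will do.
  have h := iso_tensor_pair h0 (hζ.ne_one hd) (arc_ne_zero (a := a) (k := d) h0) 0 0 ?_ ?_
  · rwa [him, Set.union_self, Set.inter_self] at h
  · intro b hb hb'
    rw [him] at hb'
    exact absurd hb hb'
  · intro b hb hb'
    refine absurd ?_ hb'
    rw [← him]
    exact ⟨b, hb, rfl⟩

end arc

end GrBimod

end SoergelRankOne

/-! ### Unique decomposition into function rings of arcs. -/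

namespace SoergelRankOne

namespace GrBimod

instance : Subsingleton (coordRing ∅) := by
  refine subsingleton_of_forall_eq 0 fun x => coordRing_eq_zero x fun a ha => ?_
  exact absurd ha (Set.notMem_empty a)

theorem Iso.subsingleton {M N : GrBimod} (e : Iso M N) [Subsingleton N] : Subsingleton M :=
  e.e.injective.subsingleton

theorem iso_of_subsingleton (M N : GrBimod) [Subsingleton M] [Subsingleton N] :
    Nonempty (Iso M N) := by
  let f : Hom M N :=
    { toLin := 0
      map_lX := fun _ => Subsingleton.elim _ _
      map_rX := fun _ => Subsingleton.elim _ _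
      map_gr := fun i _ _ => Submodule.zero_mem (N.gr i) }
  let g : Hom N M :=
    { toLin := 0
      map_lX := fun _ => Subsingleton.elim _ _
      map_rX := fun _ => Subsingleton.elim _ _
      map_gr := fun i _ _ => Submodule.zero_mem (M.gr i) }
  exact ⟨Hom.toIso f g (fun _ => Subsingleton.elim _ _) fun _ => Subsingleton.elim _ _⟩

theorem subsingleton_sum_left {M N : GrBimod} (h : Subsingleton (sum M N)) : Subsingleton M :=
  (Function.LeftInverse.injective (f := Hom.inl M N) (g := Hom.fst M N) fun _ => rfl).subsingleton

theorem subsingleton_sum_right {M N : GrBimod} (h : Subsingleton (sum M N)) : Subsingleton N :=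
  (Function.LeftInverse.injective (f := Hom.inr M N) (g := Hom.snd M N) fun _ => rfl).subsingleton

theorem subsingleton_tensor (M N : GrBimod) [Subsingleton N] : Subsingleton (tensor M N) := by
  refine subsingleton_of_forall_eq 0 fun x => ?_
  induction x using tprod_induction with
  | tmul m n => rw [Subsingleton.elim n 0, map_zero]
  | add x y hx hy => rw [hx, hy, add_zero]

/-- The index of a shifted ring of functions on a nonempty arc. -/
structure ArcIdx (d : ℕ) where
  start : ℕ
  len : ℕ
  deg : ℤ
  one_le : 1 ≤ len
  le : len ≤ d

/-- The shifted ring of functions on an arc. -/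
noncomputable def arcMod (ζ : ℂ) {d : ℕ} (x : ArcIdx d) : GrBimod :=
  shift (coordRing (arc ζ x.start x.len)) x.deg

/-- The direct sum of a list of shifted rings of functions on arcs. -/
noncomputable def listSum (ζ : ℂ) {d : ℕ} : List (ArcIdx d) → GrBimod
  | [] => coordRing ∅
  | x :: L => sum (arcMod ζ x) (listSum ζ L)

theorem brick_arcMod (ζ : ℂ) {d : ℕ} (x : ArcIdx d) : Brick (arcMod ζ x) :=
  brick_shift_coordRing (nonempty_arc x.one_le) _

instance (ζ : ℂ) (d : ℕ) : Subsingleton (listSum ζ ([] : List (ArcIdx d))) :=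
  inferInstanceAs (Subsingleton (coordRing ∅))

/-- The finite direct sums of shifted rings of functions on arcs. -/
def Dec (ζ : ℂ) (d : ℕ) (M : GrBimod) : Prop :=
  ∃ L : List (ArcIdx d), Nonempty (Iso M (listSum ζ L))

section Dec

variable {ζ : ℂ} {d : ℕ}

theorem listSum_append (L L' : List (ArcIdx d)) :
    Nonempty (Iso (sum (listSum ζ L) (listSum ζ L')) (listSum ζ (L ++ L'))) := by
  induction L with
  | nil => exact ⟨Iso.zeroSum _ _⟩
  | cons x L ih =>
    obtain ⟨e⟩ := ih
    exact ⟨(Iso.sumAssoc _ _ _).trans (Iso.sumCongr (Iso.refl _) e)⟩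

theorem Dec.iso {M N : GrBimod} (h : Dec ζ d N) (e : Iso M N) : Dec ζ d M := by
  obtain ⟨L, ⟨f⟩⟩ := h
  exact ⟨L, ⟨e.trans f⟩⟩

theorem Dec.sum {M N : GrBimod} (hM : Dec ζ d M) (hN : Dec ζ d N) : Dec ζ d (sum M N) := by
  obtain ⟨L, ⟨e⟩⟩ := hM
  obtain ⟨L', ⟨e'⟩⟩ := hN
  obtain ⟨f⟩ := listSum_append (ζ := ζ) L L'
  exact ⟨L ++ L', ⟨(Iso.sumCongr e e').trans f⟩⟩

theorem Dec.of_subsingleton (M : GrBimod) [Subsingleton M] : Dec ζ d M := ⟨[], iso_of_subsingleton _ _⟩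

theorem listSum_singleton (x : ArcIdx d) : Nonempty (Iso (arcMod ζ x) (listSum ζ [x])) :=
  ⟨(Iso.sumZero _ (coordRing ∅)).symm⟩

theorem Dec.arcMod (x : ArcIdx d) : Dec ζ d (arcMod ζ x) := ⟨[x], listSum_singleton x⟩

/-- By the exchange property the first arc of the list splits off from N or from N', and the rest of
the list is the sum of what remains there and the other summand. Induction on the list does the
rest. -/
theorem Dec.of_iso_listSum (L : List (ArcIdx d)) {N N' : GrBimod}
    (e : Iso (listSum ζ L) (GrBimod.sum N N')) : Dec ζ d N ∧ Dec ζ d N' := by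
  induction L generalizing N N' with
  | nil =>
    have h : Subsingleton (GrBimod.sum N N') := e.symm.subsingleton
    have h1 := subsingleton_sum_left h
    have h2 := subsingleton_sum_right h
    exact ⟨Dec.of_subsingleton N, Dec.of_subsingleton N'⟩
  | cons x L ih =>
    rcases (brick_arcMod ζ x).exchange e with ⟨K, ⟨e1⟩, ⟨e2⟩⟩ | ⟨K, ⟨e1⟩, ⟨e2⟩⟩
    · obtain ⟨h1, h2⟩ := ih e2
      exact ⟨((Dec.arcMod x).sum h1).iso e1, h2⟩
    · obtain ⟨h1, h2⟩ := ih e2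
      exact ⟨h2, ((Dec.arcMod x).sum h1).iso e1⟩

theorem Dec.of_sum {M N N' : GrBimod} (h : Dec ζ d M) (e : Iso M (GrBimod.sum N N')) :
    Dec ζ d N := by
  obtain ⟨L, ⟨f⟩⟩ := h
  exact (Dec.of_iso_listSum L (f.symm.trans e)).1

/-- A weight that is invariant under isomorphism. -/
def IsoInvariant (ζ : ℂ) {d : ℕ} {Q : Type*} (wt : ArcIdx d → Q) : Prop :=
  ∀ x y, Nonempty (Iso (GrBimod.arcMod ζ x) (GrBimod.arcMod ζ y)) → wt x = wt y

variable {Q : Type*} [AddCommMonoid Q] {wt : ArcIdx d → Q}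

/-- The arc x is matched with some arc y of the list: exchange moves x into y or into the tail, and
in the first case y ≅ x because a brick has no proper summands. Removing y leaves a list for R, and
invariance of the weight equates the contributions of x and y. -/
theorem exists_of_iso_listSum (hwt : IsoInvariant ζ wt) (L : List (ArcIdx d)) (x : ArcIdx d)
    {R : GrBimod} (e : Iso (GrBimod.sum (GrBimod.arcMod ζ x) R) (listSum ζ L)) :
    ∃ L', Nonempty (Iso R (listSum ζ L')) ∧ (L.map wt).sum = wt x + (L'.map wt).sum := by
  induction L generalizing R with
  | nil =>
    have h := subsingleton_sum_left e.subsingleton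
    exact absurd h (not_subsingleton_iff_nontrivial.2 (brick_arcMod ζ x).nontrivial)
  | cons y L ih =>
    rcases (brick_arcMod ζ x).exchange e with ⟨K, ⟨e1⟩, ⟨e2⟩⟩ | ⟨K, ⟨e1⟩, ⟨e2⟩⟩
    · rcases (brick_arcMod ζ y).subsingleton_or e1 with h | h
      · exact absurd h (not_subsingleton_iff_nontrivial.2 (brick_arcMod ζ x).nontrivial)
      · refine ⟨L, ⟨e2.trans (Iso.zeroSum _ _)⟩, ?_⟩
        rw [List.map_cons, List.sum_cons, hwt y x ⟨e1.trans (Iso.sumZero _ _)⟩]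
    · obtain ⟨L', ⟨f⟩, h⟩ := ih e1.symm
      refine ⟨y :: L', ⟨e2.trans ((Iso.sumComm _ _).trans (Iso.sumCongr (Iso.refl _) f))⟩, ?_⟩
      rw [List.map_cons, List.sum_cons, h, List.map_cons, List.sum_cons, add_left_comm]

/-- This is the uniqueness half of the Krull–Schmidt theorem, in the only form needed: additive
invariants do not depend on the decomposition. The arcs of the first list are cancelled one by one.
-/
theorem sum_eq_of_iso (hwt : IsoInvariant ζ wt) (L L' : List (ArcIdx d))
    (e : Iso (listSum ζ L) (listSum ζ L')) : (L.map wt).sum = (L'.map wt).sum := by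
  induction L generalizing L' with
  | nil =>
    rcases L' with _ | ⟨y, L'⟩
    · rfl
    · have h := subsingleton_sum_left e.symm.subsingleton
      exact absurd h (not_subsingleton_iff_nontrivial.2 (brick_arcMod ζ y).nontrivial)
  | cons x L ih =>
    obtain ⟨L'', ⟨f⟩, h⟩ := exists_of_iso_listSum hwt L' x e
    rw [List.map_cons, List.sum_cons, h, ih L'' f]

variable (ζ) in
open Classical in
/-- The additive extension of a weight to the direct sums. -/
noncomputable def decWeight (wt : ArcIdx d → Q) (M : GrBimod) : Q :=
  -- The chosen list is irrelevant by `sum_eq_of_iso`; outside the sums of arcs the value 0 is a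
  -- default.
  if h : Dec ζ d M then (h.choose.map wt).sum else 0

theorem decWeight_eq (hwt : IsoInvariant ζ wt) {M : GrBimod} {L : List (ArcIdx d)}
    (e : Iso M (listSum ζ L)) : decWeight ζ wt M = (L.map wt).sum := by
  have h : Dec ζ d M := ⟨L, ⟨e⟩⟩
  rw [decWeight, dif_pos h]
  obtain ⟨f⟩ := h.choose_spec
  exact sum_eq_of_iso hwt _ _ (f.symm.trans e)

theorem decWeight_iso (hwt : IsoInvariant ζ wt) {M N : GrBimod} (hN : Dec ζ d N) (e : Iso M N) :
    decWeight ζ wt M = decWeight ζ wt N := by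
  obtain ⟨L, ⟨f⟩⟩ := hN
  rw [decWeight_eq hwt f, decWeight_eq hwt (e.trans f)]

theorem decWeight_sum (hwt : IsoInvariant ζ wt) {M N : GrBimod} (hM : Dec ζ d M)
    (hN : Dec ζ d N) :
    decWeight ζ wt (GrBimod.sum M N) = decWeight ζ wt M + decWeight ζ wt N := by
  obtain ⟨L, ⟨e⟩⟩ := hM
  obtain ⟨L', ⟨e'⟩⟩ := hN
  obtain ⟨f⟩ := listSum_append (ζ := ζ) L L'
  rw [decWeight_eq hwt e, decWeight_eq hwt e', decWeight_eq hwt ((Iso.sumCongr e e').trans f),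
    List.map_append, List.sum_append]

theorem decWeight_subsingleton (hwt : IsoInvariant ζ wt) (M : GrBimod) [Subsingleton M] :
    decWeight ζ wt M = 0 := by
  obtain ⟨e⟩ := iso_of_subsingleton M (listSum ζ ([] : List (ArcIdx d)))
  rw [decWeight_eq hwt e, List.map_nil, List.sum_nil]

theorem decWeight_arcMod (hwt : IsoInvariant ζ wt) (x : ArcIdx d) :
    decWeight ζ wt (GrBimod.arcMod ζ x) = wt x := by
  obtain ⟨e⟩ := listSum_singleton (ζ := ζ) x
  rw [decWeight_eq hwt e, List.map_cons, List.map_nil, List.sum_cons, List.sum_nil, add_zero]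

/-- The shift of an index. -/
def ArcIdx.shift (x : ArcIdx d) (n : ℤ) : ArcIdx d := { x with deg := x.deg + n }

theorem shift_arcMod (x : ArcIdx d) (n : ℤ) :
    Nonempty (Iso (GrBimod.shift (GrBimod.arcMod ζ x) n) (GrBimod.arcMod ζ (x.shift n))) :=
  ⟨Iso.shiftShift _ _ _⟩

theorem shift_listSum (L : List (ArcIdx d)) (n : ℤ) :
    Nonempty (Iso (GrBimod.shift (listSum ζ L) n) (listSum ζ (L.map fun x => x.shift n))) := by
  induction L with
  | nil =>
    have : Subsingleton (GrBimod.shift (listSum ζ ([] : List (ArcIdx d))) n) :=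
      inferInstanceAs (Subsingleton (coordRing ∅))
    rw [List.map_nil]
    exact iso_of_subsingleton _ _
  | cons x L ih =>
    obtain ⟨e⟩ := ih
    obtain ⟨f⟩ := shift_arcMod (ζ := ζ) x n
    exact ⟨(Iso.shiftSum _ _ _).trans (Iso.sumCongr f e)⟩

theorem Dec.shift {M : GrBimod} (h : Dec ζ d M) (n : ℤ) : Dec ζ d (GrBimod.shift M n) := by
  obtain ⟨L, ⟨e⟩⟩ := h
  obtain ⟨f⟩ := shift_listSum (ζ := ζ) L n
  exact ⟨_, ⟨(Iso.shiftCongr n e).trans f⟩⟩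

theorem Dec.coordRing_arc (a : ℕ) {k : ℕ} (hk : k ≤ d) : Dec ζ d (coordRing (arc ζ a k)) := by
  rcases Nat.eq_zero_or_pos k with rfl | h
  · rw [arc_zero]
    exact Dec.of_subsingleton _
  · exact (Dec.arcMod ⟨a, k, 0, h, hk⟩).iso (Iso.shiftZero _).symm

/-- To prove a property of all direct sums it suffices to treat the rings of functions on arcs. -/
theorem Dec.induction {motive : GrBimod → Prop}
    (iso : ∀ M N, Nonempty (Iso M N) → motive N → motive M) (zero : motive (GrBimod.coordRing ∅))
    (sum : ∀ M N, Dec ζ d M → Dec ζ d N → motive M → motive N → motive (GrBimod.sum M N))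
    (shift : ∀ M n, Dec ζ d M → motive M → motive (GrBimod.shift M n))
    (coord : ∀ a k, 1 ≤ k → k ≤ d → motive (GrBimod.coordRing (arc ζ a k)))
    {M : GrBimod} (h : Dec ζ d M) : motive M := by
  obtain ⟨L, e⟩ := h
  refine iso _ _ e ?_
  clear e
  induction L with
  | nil => exact zero
  | cons x L ih =>
    exact sum _ _ (Dec.arcMod x) ⟨L, ⟨Iso.refl _⟩⟩
      (shift _ _ (Dec.coordRing_arc _ x.le) (coord _ _ x.one_le x.le)) ih

end Dec

/-- To prove a property of the rings of functions on arcs it suffices to treat those of the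
simple reflection. -/
theorem arc_induction {ζ : ℂ} {d : ℕ} (hζ : IsPrimitiveRoot ζ d) (hd : 2 < d)
    {motive : GrBimod → Prop}
    (iso : ∀ M N, Nonempty (Iso M N) → motive N → motive M)
    (zero : motive (coordRing ∅)) (one : motive unit) (single : motive (coordRing {ζ}))
    (gen : motive (coordRing {1, ζ})) (tensor : ∀ M N, motive M → motive N → motive (tensor M N))
    (shift : ∀ M n, motive M → motive (shift M n))
    (summand : ∀ M N N', motive M → motive N' → Nonempty (Iso M (sum N N')) → motive N)
    (k : ℕ) (hk : k ≤ d) (a : ℕ) : motive (coordRing (arc ζ a k)) := by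
  have h0 : ζ ≠ 0 := hζ.ne_zero (by omega)
  have h1 : ∀ a, motive (coordRing (arc ζ a 1)) := by
    intro a
    induction a with
    | zero =>
      rw [arc_one, pow_zero]
      exact iso _ _ ⟨iso_unit.some.symm⟩ one
    | succ a ih =>
      obtain ⟨e⟩ := iso_singleton_arc h0 a 1
      exact iso _ _ ⟨e.symm⟩ (tensor _ _ single ih)
  -- Two consecutive lengths are carried along, since the arc of length j + 2 is the complement of a
  -- shifted arc of length j in the product of `𝒪(e, s)` with an arc of length j + 1.
  have h2 : ∀ j, (∀ a, j ≤ d → motive (coordRing (arc ζ a j))) ∧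
      (∀ a, j + 1 ≤ d → motive (coordRing (arc ζ a (j + 1)))) := by
    intro j
    induction j with
    | zero => exact ⟨fun a _ => by rwa [arc_zero], fun a _ => h1 a⟩
    | succ j ih =>
      refine ⟨ih.2, fun a hj => ?_⟩
      exact summand _ _ _ (tensor _ _ gen (ih.2 a (by omega)))
        (shift _ (-2) (ih.1 (a + 1) (by omega))) (iso_pair_arc hζ (by omega) a)
  exact (h2 k).1 a hk

/-- The Chebyshev sequence of the second kind `0, 1, c, c ^ 2 - 1, …`. -/
def chebSeq {Q : Type*} [Ring Q] (c : Q) : ℕ → Q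
  | 0 => 0
  | 1 => 1
  | n + 2 => c * chebSeq c (n + 1) - chebSeq c n

theorem map_chebSeq {Q Q' : Type*} [Ring Q] [Ring Q'] (f : Q →+* Q') (c : Q) :
    ∀ n, f (chebSeq c n) = chebSeq (f c) n
  | 0 => map_zero f
  | 1 => map_one f
  | n + 2 => by rw [chebSeq, map_sub, map_mul, map_chebSeq f c (n + 1), map_chebSeq f c n, chebSeq]

end GrBimod

end SoergelRankOne

/-! ### The character of a sum of arcs and its multiplicativity. -/

namespace SoergelRankOne

namespace GrBimod

open LaurentPolynomial (T)

section character

variable {ζ : ℂ} {d : ℕ} {Q : Type*} [CommRing Q] [Algebra (LaurentPolynomial ℤ) Q]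

/-- The weight of a shifted ring of functions on an arc. -/
noncomputable def arcWeight (c : Q) (x : ArcIdx d) : Q :=
  -- The normalization gives the arc of length k shifted by k - 1 the value U_k(c) without a power
  -- of v. The start of the arc does not enter, in accordance with s = 1.
  (T (x.deg + 1 - x.len) : LaurentPolynomial ℤ) • chebSeq c x.len

/-- An isomorphism preserves the shift and the arc as a set. The start is an exponent known only
modulo d, but the length is the cardinality of the set because it is at most d. -/
theorem isoInvariant_arcWeight (hζ : IsPrimitiveRoot ζ d) (c : Q) :
    IsoInvariant ζ (arcWeight (d := d) c) := by
  rintro x y ⟨e⟩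
  obtain ⟨h1, h2⟩ := eq_of_iso_shift_coordRing (nonempty_arc x.one_le) (nonempty_arc y.one_le)
    (finite_arc _ _) (finite_arc _ _) e
  have hd : d ≠ 0 := by
    have := x.one_le
    have := x.le
    omega
  have h3 := congrArg Set.ncard h2
  rw [ncard_arc hζ hd x.le, ncard_arc hζ hd y.le] at h3
  rw [arcWeight, arcWeight, h1, h3]

variable (ζ d) in
/-- The character of a direct sum of rings of functions on arcs. -/
noncomputable def character (c : Q) (M : GrBimod) : Q := decWeight ζ (arcWeight (d := d) c) M

variable {c : Q}

theorem character_iso (hζ : IsPrimitiveRoot ζ d) {M N : GrBimod} (hN : Dec ζ d N) (e : Iso M N) :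
    character ζ d c M = character ζ d c N := decWeight_iso (isoInvariant_arcWeight hζ c) hN e

theorem character_sum (hζ : IsPrimitiveRoot ζ d) {M N : GrBimod} (hM : Dec ζ d M)
    (hN : Dec ζ d N) :
    character ζ d c (sum M N) = character ζ d c M + character ζ d c N :=
  decWeight_sum (isoInvariant_arcWeight hζ c) hM hN

theorem character_subsingleton (hζ : IsPrimitiveRoot ζ d) (M : GrBimod) [Subsingleton M] :
    character ζ d c M = 0 := decWeight_subsingleton (isoInvariant_arcWeight hζ c) M

theorem character_shift (hζ : IsPrimitiveRoot ζ d) {M : GrBimod} (hM : Dec ζ d M) (n : ℤ) :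
    character ζ d c (shift M n) = (T n : LaurentPolynomial ℤ) • character ζ d c M := by
  obtain ⟨L, ⟨e⟩⟩ := hM
  obtain ⟨f⟩ := shift_listSum (ζ := ζ) L n
  have hw := isoInvariant_arcWeight (ζ := ζ) hζ c
  rw [character, character, decWeight_eq hw e, decWeight_eq hw ((Iso.shiftCongr n e).trans f),
    List.smul_sum, List.map_map, List.map_map]
  congr 1
  refine List.map_congr_left fun x _ => ?_
  simp only [Function.comp_apply, arcWeight, ArcIdx.shift, smul_smul, ← LaurentPolynomial.T_add]
  congr 2
  ring

theorem character_arc (hζ : IsPrimitiveRoot ζ d) (a : ℕ) {k : ℕ} (hk : k ≤ d) :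
    character ζ d c (coordRing (arc ζ a k)) =
      (T (1 - (k : ℤ)) : LaurentPolynomial ℤ) • chebSeq c k := by
  rcases Nat.eq_zero_or_pos k with rfl | h
  · rw [arc_zero, character_subsingleton hζ]
    simp [chebSeq]
  · have e : Iso (coordRing (arc ζ a k)) (arcMod ζ (⟨a, k, 0, h, hk⟩ : ArcIdx d)) :=
      (Iso.shiftZero _).symm
    rw [character_iso hζ (Dec.arcMod _) e, character,
      decWeight_arcMod (isoInvariant_arcWeight hζ c), arcWeight, zero_add]

theorem Dec.unit (hd : 2 < d) : Dec ζ d unit := by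
  obtain ⟨e⟩ := iso_unit
  have h := Dec.coordRing_arc (ζ := ζ) (d := d) 0 (k := 1) (by omega)
  rw [arc_one, pow_zero] at h
  exact h.iso e

theorem Dec.single (hd : 2 < d) : Dec ζ d (coordRing {ζ}) := by
  have h := Dec.coordRing_arc (ζ := ζ) (d := d) 1 (k := 1) (by omega)
  rwa [arc_one, pow_one] at h

theorem Dec.gen (hd : 2 < d) : Dec ζ d (coordRing {1, ζ}) := by
  have h := Dec.coordRing_arc (ζ := ζ) (d := d) 0 (k := 2) (by omega)
  rwa [arc_two] at h

theorem character_unit (hζ : IsPrimitiveRoot ζ d) (hd : 2 < d) : character ζ d c unit = 1 := by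
  obtain ⟨e⟩ := iso_unit
  have h := character_arc (c := c) hζ 0 (k := 1) (by omega)
  have h' := Dec.coordRing_arc (ζ := ζ) (d := d) 0 (k := 1) (by omega)
  rw [arc_one, pow_zero] at h h'
  rw [character_iso hζ h' e, h]
  simp [chebSeq]

theorem character_single (hζ : IsPrimitiveRoot ζ d) (hd : 2 < d) :
    character ζ d c (coordRing {ζ}) = 1 := by
  have h := character_arc (c := c) hζ 1 (k := 1) (by omega)
  rw [arc_one, pow_one] at h
  rw [h]
  simp [chebSeq]

theorem character_gen (hζ : IsPrimitiveRoot ζ d) (hd : 2 < d) :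
    character ζ d c (coordRing {1, ζ}) = (T (-1) : LaurentPolynomial ℤ) • c := by
  have h := character_arc (c := c) hζ 0 (k := 2) (by omega)
  rw [arc_two] at h
  rw [h]
  simp [chebSeq]

variable (ζ d) in
/-- The tensor product with `M` preserves direct sums of rings of functions on arcs and
multiplies their characters by that of `M`. -/
structure Good (c : Q) (M : GrBimod) : Prop where
  dec : Dec ζ d M
  dec_tensor : ∀ N, Dec ζ d N → Dec ζ d (tensor M N)
  character_tensor : ∀ N, Dec ζ d N →
    character ζ d c (tensor M N) = character ζ d c M * character ζ d c N

/-- Both sides of the product formula are additive in the second factor and compatible with shifts,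
so it suffices to test single unshifted arcs. -/
theorem Good.of_arc (hζ : IsPrimitiveRoot ζ d) {M : GrBimod} (hM : Dec ζ d M)
    (h : ∀ a k, 1 ≤ k → k ≤ d → Dec ζ d (tensor M (coordRing (arc ζ a k))) ∧
      character ζ d c (tensor M (coordRing (arc ζ a k))) =
        character ζ d c M * character ζ d c (coordRing (arc ζ a k))) : Good ζ d c M := by
  have key : ∀ N, Dec ζ d N → Dec ζ d N ∧ Dec ζ d (tensor M N) ∧
      character ζ d c (tensor M N) = character ζ d c M * character ζ d c N := by
    intro N hN
    refine hN.induction (motive := fun N => Dec ζ d N ∧ Dec ζ d (tensor M N) ∧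
      character ζ d c (tensor M N) = character ζ d c M * character ζ d c N) ?_ ?_ ?_ ?_ ?_
    · rintro N N' ⟨e⟩ ⟨h1, h2, h3⟩
      have f := Iso.tensorCongr (Iso.refl M) e
      exact ⟨h1.iso e, h2.iso f, by rw [character_iso hζ h2 f, h3, character_iso hζ h1 e]⟩
    · have := subsingleton_tensor M (coordRing ∅)
      exact ⟨Dec.of_subsingleton _, Dec.of_subsingleton _, by
        rw [character_subsingleton hζ (coordRing ∅), mul_zero, character_subsingleton hζ]⟩
    · rintro N N' _ _ ⟨h1, h2, h3⟩ ⟨h1', h2', h3'⟩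
      refine ⟨h1.sum h1', (h2.sum h2').iso (Iso.tensorSum M N N'), ?_⟩
      rw [character_iso hζ (h2.sum h2') (Iso.tensorSum M N N'), character_sum hζ h2 h2',
        character_sum hζ h1 h1', h3, h3', mul_add]
    · rintro N n _ ⟨h1, h2, h3⟩
      refine ⟨h1.shift n, (h2.shift n).iso (Iso.tensorShift M N n), ?_⟩
      rw [character_iso hζ (h2.shift n) (Iso.tensorShift M N n), character_shift hζ h2,
        character_shift hζ h1, h3, mul_smul_comm]
    · exact fun a k h1 h2 => ⟨Dec.coordRing_arc a h2, h a k h1 h2⟩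
  exact ⟨hM, fun N hN => (key N hN).2.1, fun N hN => (key N hN).2.2⟩

theorem Good.iso (hζ : IsPrimitiveRoot ζ d) {M N : GrBimod} (hN : Good ζ d c N) (e : Iso M N) :
    Good ζ d c M where
  dec := hN.dec.iso e
  dec_tensor P hP := (hN.dec_tensor P hP).iso (Iso.tensorCongr e (Iso.refl P))
  character_tensor P hP := by
    rw [character_iso hζ (hN.dec_tensor P hP) (Iso.tensorCongr e (Iso.refl P)),
      hN.character_tensor P hP, character_iso hζ hN.dec e]

theorem subsingleton_tensor_left (M N : GrBimod) [Subsingleton M] :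
    Subsingleton (tensor M N) := by
  refine subsingleton_of_forall_eq 0 fun x => ?_
  induction x using tprod_induction with
  | tmul m n => rw [Subsingleton.elim m 0, map_zero, LinearMap.zero_apply]
  | add x y hx hy => rw [hx, hy, add_zero]

theorem Good.zero (hζ : IsPrimitiveRoot ζ d) : Good ζ d c (coordRing ∅) where
  dec := Dec.of_subsingleton _
  dec_tensor P _ := by
    have := subsingleton_tensor_left (coordRing ∅) P
    exact Dec.of_subsingleton _
  character_tensor P _ := by
    have := subsingleton_tensor_left (coordRing ∅) P
    rw [character_subsingleton hζ, character_subsingleton hζ, zero_mul]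

theorem Good.unit (hζ : IsPrimitiveRoot ζ d) (hd : 2 < d) : Good ζ d c unit where
  dec := Dec.unit hd
  dec_tensor P hP := hP.iso (Iso.leftUnit P)
  character_tensor P hP := by
    rw [character_iso hζ hP (Iso.leftUnit P), character_unit hζ hd, one_mul]

theorem Good.sum (hζ : IsPrimitiveRoot ζ d) {M N : GrBimod} (hM : Good ζ d c M)
    (hN : Good ζ d c N) : Good ζ d c (GrBimod.sum M N) where
  dec := hM.dec.sum hN.dec
  dec_tensor P hP :=
    ((hM.dec_tensor P hP).sum (hN.dec_tensor P hP)).iso (Iso.sumTensor M N P)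
  character_tensor P hP := by
    rw [character_iso hζ ((hM.dec_tensor P hP).sum (hN.dec_tensor P hP)) (Iso.sumTensor M N P),
      character_sum hζ (hM.dec_tensor P hP) (hN.dec_tensor P hP), character_sum hζ hM.dec hN.dec,
      hM.character_tensor P hP, hN.character_tensor P hP, add_mul]

theorem Good.shift (hζ : IsPrimitiveRoot ζ d) {M : GrBimod} (hM : Good ζ d c M) (n : ℤ) :
    Good ζ d c (GrBimod.shift M n) where
  dec := hM.dec.shift n
  dec_tensor P hP := ((hM.dec_tensor P hP).shift n).iso (Iso.shiftTensor M P n)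
  character_tensor P hP := by
    rw [character_iso hζ ((hM.dec_tensor P hP).shift n) (Iso.shiftTensor M P n),
      character_shift hζ (hM.dec_tensor P hP), character_shift hζ hM.dec,
      hM.character_tensor P hP, smul_mul_assoc]

theorem Good.tensor (hζ : IsPrimitiveRoot ζ d) {M N : GrBimod} (hM : Good ζ d c M)
    (hN : Good ζ d c N) : Good ζ d c (GrBimod.tensor M N) where
  dec := hM.dec_tensor N hN.dec
  dec_tensor P hP := (hM.dec_tensor _ (hN.dec_tensor P hP)).iso (Iso.assoc M N P)
  character_tensor P hP := by
    rw [character_iso hζ (hM.dec_tensor _ (hN.dec_tensor P hP)) (Iso.assoc M N P),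
      hM.character_tensor _ (hN.dec_tensor P hP), hN.character_tensor P hP,
      hM.character_tensor N hN.dec, mul_assoc]

/-- Distributivity of the tensor product and additivity of the character give the formula for N plus
the one for N'; the latter is known and can be subtracted in the ring Q. That N ⊗ P is a sum of arcs
follows from closure under direct summands. -/
theorem Good.summand (hζ : IsPrimitiveRoot ζ d) {M N N' : GrBimod} (hM : Good ζ d c M)
    (hN' : Good ζ d c N') (e : Iso M (GrBimod.sum N N')) : Good ζ d c N := by
  have hN : Dec ζ d N := hM.dec.of_sum e
  have f : ∀ P, Iso (GrBimod.tensor M P)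
      (GrBimod.sum (GrBimod.tensor N P) (GrBimod.tensor N' P)) := fun P =>
    (Iso.tensorCongr e (Iso.refl P)).trans (Iso.sumTensor N N' P)
  have h : ∀ P, Dec ζ d P → Dec ζ d (GrBimod.tensor N P) := fun P hP =>
    (hM.dec_tensor P hP).of_sum (f P)
  refine ⟨hN, h, fun P hP => ?_⟩
  have h1 := character_iso (c := c) hζ ((h P hP).sum (hN'.dec_tensor P hP)) (f P)
  rw [character_sum hζ (h P hP) (hN'.dec_tensor P hP), hM.character_tensor P hP,
    hN'.character_tensor P hP, character_iso hζ (hN.sum hN'.dec) e,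
    character_sum hζ hN hN'.dec, add_mul] at h1
  exact (add_right_cancel h1).symm

/-- Tensoring with `𝒪(s)` only rotates an arc, and weights ignore the start. -/
theorem Good.single (hζ : IsPrimitiveRoot ζ d) (hd : 2 < d) : Good ζ d c (coordRing {ζ}) := by
  refine Good.of_arc hζ (Dec.single hd) fun a k _ hk => ?_
  obtain ⟨e⟩ := iso_singleton_arc (hζ.ne_zero (by omega)) a k
  have h := Dec.coordRing_arc (ζ := ζ) (a + 1) hk
  refine ⟨h.iso e, ?_⟩
  rw [character_iso hζ h e, character_single hζ hd, one_mul, character_arc hζ _ hk,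
    character_arc hζ _ hk]

/-- For a proper arc the tensor product rule is the Chebyshev recursion. The hypothesis on c enters
only for the full circle, where the recursion is replaced by c U_d = (v + v⁻¹) U_d. -/
theorem Good.gen (hζ : IsPrimitiveRoot ζ d) (hd : 2 < d)
    (hc : c * chebSeq c d = (T 1 + T (-1) : LaurentPolynomial ℤ) • chebSeq c d) :
    Good ζ d c (coordRing {1, ζ}) := by
  refine Good.of_arc hζ (Dec.gen hd) fun a k h1 hk => ?_
  obtain ⟨j, rfl⟩ : ∃ j, k = j + 1 := ⟨k - 1, by omega⟩
  rw [character_gen hζ hd]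
  rcases Nat.lt_or_ge (j + 1) d with hj | hj
  · obtain ⟨e⟩ := iso_pair_arc hζ hj a
    have h2 := Dec.coordRing_arc (ζ := ζ) (d := d) a (k := j + 2) (by omega)
    have h3 := Dec.coordRing_arc (ζ := ζ) (d := d) (a + 1) (k := j) (by omega)
    have h4 := h2.sum (h3.shift (-2))
    refine ⟨h4.iso e, ?_⟩
    rw [character_iso hζ h4 e, character_sum hζ h2 (h3.shift _), character_shift hζ h3,
      character_arc hζ _ (by omega), character_arc hζ _ (by omega), character_arc hζ _ hk,
      smul_mul_smul_comm, smul_smul, ← LaurentPolynomial.T_add, ← LaurentPolynomial.T_add]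
    have h5 : c * chebSeq c (j + 1) = chebSeq c (j + 2) + chebSeq c j := by
      rw [chebSeq]; ring
    rw [h5, smul_add]
    congr 3 <;> · push_cast; ring
  · obtain rfl : j + 1 = d := by omega
    obtain ⟨e⟩ := iso_pair_full hζ (by omega) a
    have h2 := Dec.coordRing_arc (ζ := ζ) a le_rfl (d := j + 1)
    have h4 := h2.sum (h2.shift (-2))
    refine ⟨h4.iso e, ?_⟩
    rw [character_iso hζ h4 e, character_sum hζ h2 (h2.shift _), character_shift hζ h2,
      character_arc hζ _ le_rfl, smul_mul_smul_comm, hc, smul_smul, smul_smul, ← add_smul,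
      mul_add, ← LaurentPolynomial.T_add, ← LaurentPolynomial.T_add, ← LaurentPolynomial.T_add,
      ← LaurentPolynomial.T_add]
    congr 3 <;> ring

/-- All arcs arise from R, `𝒪(s)` and `𝒪(e, s)` by tensor products, shifts and splitting off known
summands, and each of these operations preserves multiplicativity. -/
theorem Good.of_dec (hζ : IsPrimitiveRoot ζ d) (hd : 2 < d)
    (hc : c * chebSeq c d = (T 1 + T (-1) : LaurentPolynomial ℤ) • chebSeq c d) {M : GrBimod}
    (hM : Dec ζ d M) : Good ζ d c M :=
  hM.induction (motive := Good ζ d c) (fun _ _ e h => h.iso hζ e.some) (Good.zero hζ)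
    (fun _ _ _ _ h h' => h.sum hζ h') (fun _ n _ h => h.shift hζ n)
    (fun a k _ hk => arc_induction hζ hd (motive := Good ζ d c) (fun _ _ e h => h.iso hζ e.some)
      (Good.zero hζ) (Good.unit hζ hd) (Good.single hζ hd) (Good.gen hζ hd hc)
      (fun _ _ h h' => h.tensor hζ h') (fun _ n h => h.shift hζ n)
      (fun _ _ _ h h' e => h.summand hζ h' e.some) k hk a)

end character

end GrBimod

/-! ### The objects of `ℬ_W` are the sums of arcs. -/

open GrBimod

theorem MemB.iso {ζ : ℂ} {M N : GrBimod} (hM : MemB ζ M) (e : Iso M N) : MemB ζ N :=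
  MemB.summand M N (coordRing ∅) hM ⟨e.trans (Iso.sumZero N _).symm⟩

theorem MemB.zero {ζ : ℂ} : MemB ζ (coordRing ∅) :=
  MemB.summand GrBimod.unit _ GrBimod.unit MemB.unit ⟨(Iso.zeroSum _ _).symm⟩

/-- For d > 2 the arc {e, s} is proper, so the square of `𝒪(e, s)` splits as `𝒪(e, s, s²)` plus
`𝒪(s)` shifted by -2. Shifting the second summand back gives `𝒪(s)`. -/
theorem MemB.single {ζ : ℂ} {d : ℕ} (hζ : IsPrimitiveRoot ζ d) (hd : 2 < d) :
    MemB ζ (coordRing {ζ}) := by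
  obtain ⟨e⟩ := iso_pair_arc hζ (j := 1) (by omega) 0
  rw [arc_two, arc_one, zero_add, pow_one] at e
  have h1 := MemB.summand _ _ _ (MemB.tensor _ _ MemB.gen MemB.gen)
    ⟨e.trans (Iso.sumComm _ _)⟩
  refine (MemB.shift _ 2 h1).iso ((Iso.shiftShift _ _ _).trans ?_)
  rw [neg_add_cancel]
  exact Iso.shiftZero _

theorem MemB.arc {ζ : ℂ} {d : ℕ} (hζ : IsPrimitiveRoot ζ d) (hd : 2 < d) (a : ℕ) {k : ℕ}
    (hk : k ≤ d) : MemB ζ (coordRing (arc ζ a k)) :=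
  arc_induction hζ hd (motive := MemB ζ) (fun _ _ e h => h.iso e.some.symm)
    MemB.zero MemB.unit (MemB.single hζ hd) MemB.gen
    (fun _ _ h h' => MemB.tensor _ _ h h') (fun _ n h => MemB.shift _ n h)
    (fun M N N' h _ e => MemB.summand M N N' h e) k hk a

/-- Closure under summands is the exchange argument and closure under tensor products comes from
`Good`, so sums of arcs satisfy all the closure properties that define `ℬ_W`. -/
theorem MemB.dec {ζ : ℂ} {d : ℕ} (hζ : IsPrimitiveRoot ζ d) (hd : 2 < d) {M : GrBimod}
    (hM : MemB ζ M) : Dec ζ d M := by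
  induction hM with
  | unit => exact Dec.unit hd
  | gen => exact Dec.gen hd
  | sum M N _ _ h h' => exact h.sum h'
  | tensor M N _ _ h h' =>
    -- Only the decomposition of the tensor product is wanted. With values in the zero ring the
    -- condition on c is trivial.
    exact (Good.of_dec (Q := PUnit.{1}) (c := 0) hζ hd (Subsingleton.elim _ _) h).dec_tensor N h'
  | shift M n _ h => exact h.shift n
  | summand M N N' _ e h => exact h.of_sum e.some

end SoergelRankOne

/-! ### The relation satisfied by T_s in the quotient. -/

namespace SoergelRankOne

open GrBimod LaurentPolynomial

/-- The class of an object in `A_W / (s = 1)`. -/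
noncomputable def clsBar {ζ : ℂ} (hs : MemB ζ (coordRing {ζ})) (M : GrBimod) (hM : MemB ζ M) :
    AWbar hs :=
  RingQuot.mkAlgHom (LaurentPolynomial ℤ) (relS hs) (cls M hM)

/-- Negation is the action of the coefficient -1. A ring structure is needed to form `chebSeq` and
polynomials in T_s. -/
noncomputable instance {ζ : ℂ} (hs : MemB ζ (coordRing {ζ})) : Ring (AWbar hs) :=
  Algebra.semiringToRing (LaurentPolynomial ℤ)

section clsBar

variable {ζ : ℂ} (hs : MemB ζ (coordRing {ζ}))

theorem clsBar_iso {M N : GrBimod} (hM : MemB ζ M) (hN : MemB ζ N) (e : Iso M N) :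
    clsBar hs M hM = clsBar hs N hN := by
  have h : isoClass M hM = isoClass N hN := Quotient.sound ⟨e⟩
  rw [clsBar, clsBar, cls, cls, h]

theorem clsBar_sum {M N : GrBimod} (hM : MemB ζ M) (hN : MemB ζ N) :
    clsBar hs (sum M N) (MemB.sum M N hM hN) = clsBar hs M hM + clsBar hs N hN := by
  rw [clsBar, cls, RingQuot.mkAlgHom_rel _ (GrothendieckRel.sum M N hM hN), map_add, map_add]
  rfl

theorem clsBar_shift_one {M : GrBimod} (hM : MemB ζ M) :
    clsBar hs (shift M 1) (MemB.shift M 1 hM) =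
      (T 1 : LaurentPolynomial ℤ) • clsBar hs M hM := by
  rw [clsBar, cls, RingQuot.mkAlgHom_rel _ (GrothendieckRel.shift M hM), map_smul, map_smul]
  rfl

/-- The defining relations mention only the shift by 1; the invertibility of v extends the formula
to negative shifts. -/
theorem clsBar_shift {M : GrBimod} (hM : MemB ζ M) (n : ℤ) :
    clsBar hs (shift M n) (MemB.shift M n hM) =
      (T n : LaurentPolynomial ℤ) • clsBar hs M hM := by
  have step : ∀ n : ℤ, clsBar hs (shift M (n + 1)) (MemB.shift M (n + 1) hM) =
      (T 1 : LaurentPolynomial ℤ) • clsBar hs (shift M n) (MemB.shift M n hM) := fun n => by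
    rw [← clsBar_shift_one]
    exact clsBar_iso hs _ _ (Iso.shiftShift M n 1).symm
  induction n using Int.induction_on with
  | zero =>
    rw [T_zero, one_smul]
    exact clsBar_iso hs _ _ (Iso.shiftZero M)
  | succ n ih => rw [step, ih, smul_smul, ← T_add, add_comm]
  | pred n ih =>
    have h := step (-(n : ℤ) - 1)
    simp only [sub_add_cancel] at h
    rw [ih] at h
    have h2 := congrArg (fun x => (T (-1) : LaurentPolynomial ℤ) • x) h
    simp only [smul_smul, ← T_add, neg_add_cancel, T_zero, one_smul] at h2
    rw [← h2]
    congr 2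
    ring

theorem clsBar_tensor {M N : GrBimod} (hM : MemB ζ M) (hN : MemB ζ N) :
    clsBar hs (tensor M N) (MemB.tensor M N hM hN) = clsBar hs M hM * clsBar hs N hN := by
  rw [clsBar, clsBar, clsBar, ← map_mul, cls, cls, cls, ← map_mul, ← map_mul]
  rfl

theorem clsBar_unit : clsBar hs unit MemB.unit = 1 := by
  have h : cls unit MemB.unit = (1 : AW ζ) := by
    rw [cls, show isoClass unit MemB.unit = (1 : IsoClass ζ) from rfl, map_one, map_one]
  rw [clsBar, h, map_one]

theorem clsBar_single : clsBar hs (coordRing {ζ}) hs = 1 := by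
  rw [clsBar, RingQuot.mkAlgHom_rel (LaurentPolynomial ℤ) (s := relS hs) (y := 1) ⟨rfl, rfl⟩,
    map_one]

/-- A vanishing object satisfies M ⊕ M ≅ M, so its class x satisfies x + x = x. -/
theorem clsBar_subsingleton {M : GrBimod} [Subsingleton M] (hM : MemB ζ M) :
    clsBar hs M hM = 0 := by
  have h := clsBar_sum hs hM hM
  rw [clsBar_iso hs (MemB.sum M M hM hM) hM (Iso.sumZero M M)] at h
  exact left_eq_add.1 h

/-- The image of `C` in `A_W / (s = 1)`. -/
noncomputable def clsBarC : AWbar hs :=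
  Ts hs + algebraMap (LaurentPolynomial ℤ) (AWbar hs) (T 1)

theorem clsBarC_eq : clsBarC hs = (T 1 : LaurentPolynomial ℤ) • clsBar hs (coordRing {1, ζ}) MemB.gen := by
  have h : clsC ζ - algebraMap (LaurentPolynomial ℤ) (AW ζ) (T 1) +
      algebraMap (LaurentPolynomial ℤ) (AW ζ) (T 1) = clsC ζ :=
    sub_add_cancel (G := AW ζ) _ _
  rw [← clsBar_shift, clsBarC, Ts, ← AlgHom.commutes (RingQuot.mkAlgHom _ (relS hs)), ← map_add, h]
  rfl

theorem clsBar_gen : clsBar hs (coordRing {1, ζ}) MemB.gen =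
    (T (-1) : LaurentPolynomial ℤ) • clsBarC hs := by
  rw [clsBarC_eq, smul_smul, ← T_add, neg_add_cancel, T_zero, one_smul]

variable {d : ℕ}

/-- Rotation is the product with `𝒪(s)`, whose class has become 1. -/
theorem clsBar_arc_succ (hζ : IsPrimitiveRoot ζ d) (hd : 2 < d) (a : ℕ) {k : ℕ} (hk : k ≤ d) :
    clsBar hs (coordRing (arc ζ (a + 1) k)) (MemB.arc hζ hd (a + 1) hk) =
      clsBar hs (coordRing (arc ζ a k)) (MemB.arc hζ hd a hk) := by
  obtain ⟨e⟩ := iso_singleton_arc (hζ.ne_zero (by omega)) a k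
  rw [← clsBar_iso hs (MemB.tensor _ _ hs (MemB.arc hζ hd a hk)) _ e, clsBar_tensor hs hs,
    clsBar_single, one_mul]

/-- The tensor product rule for proper arcs is the Chebyshev recursion for classes, once they depend
on the length only. The induction carries two consecutive lengths, as the recursion does. -/
theorem clsBar_arc (hζ : IsPrimitiveRoot ζ d) (hd : 2 < d) (a : ℕ) {k : ℕ} (hk : k ≤ d) :
    clsBar hs (coordRing (arc ζ a k)) (MemB.arc hζ hd a hk) =
      (T (1 - (k : ℤ)) : LaurentPolynomial ℤ) • chebSeq (clsBarC hs) k := by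
  have h : ∀ j, (∀ a (hj : j ≤ d), clsBar hs (coordRing (arc ζ a j)) (MemB.arc hζ hd a hj) =
      (T (1 - (j : ℤ)) : LaurentPolynomial ℤ) • chebSeq (clsBarC hs) j) ∧
      (∀ a (hj : j + 1 ≤ d), clsBar hs (coordRing (arc ζ a (j + 1))) (MemB.arc hζ hd a hj) =
      (T (1 - ((j + 1 : ℕ) : ℤ)) : LaurentPolynomial ℤ) • chebSeq (clsBarC hs) (j + 1)) := by
    intro j
    induction j with
    | zero =>
      constructor
      · intro a hj
        have h0 : Subsingleton (coordRing (arc ζ a 0)) := by rw [arc_zero]; infer_instance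
        rw [clsBar_subsingleton, chebSeq, smul_zero]
      · intro a hj
        have h1 : clsBar hs (coordRing (arc ζ a (0 + 1))) (MemB.arc hζ hd a hj) = 1 := by
          induction a with
          | zero =>
            rw [← clsBar_unit hs]
            have h2 : arc ζ 0 (0 + 1) = {1} := by rw [zero_add, arc_one, pow_zero]
            exact clsBar_iso hs _ _ ((Iso.ofEq (congrArg coordRing h2)).trans iso_unit.some.symm)
          | succ a ih => rw [clsBar_arc_succ hs hζ hd a hj, ih]
        rw [h1, zero_add, chebSeq]
        simp
    | succ j ih =>
      refine ⟨ih.2, fun a hj => ?_⟩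
      obtain ⟨e⟩ := iso_pair_arc hζ (j := j) (by omega) a
      have e1 := clsBar_iso hs (MemB.tensor _ _ MemB.gen (MemB.arc hζ hd a (by omega)))
        (MemB.sum _ _ (MemB.arc hζ hd a hj)
          (MemB.shift _ _ (MemB.arc hζ hd (a + 1) (by omega)))) e
      rw [clsBar_tensor hs MemB.gen (MemB.arc hζ hd a (by omega)),
        clsBar_sum hs (MemB.arc hζ hd a hj) (MemB.shift _ _ (MemB.arc hζ hd (a + 1) (by omega))),
        clsBar_shift hs (MemB.arc hζ hd (a + 1) (by omega)), ih.1 _ (by omega), ih.2 _ (by omega),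
        clsBar_gen] at e1
      rw [eq_sub_of_add_eq e1.symm, chebSeq, smul_mul_smul_comm, smul_smul, ← T_add, ← T_add,
        smul_sub]
      congr 3 <;> · push_cast; ring
  exact (h k).1 a hk

/-- Taking classes in the tensor product rule for the full circle closes the recursion. This is the
single relation of the presentation. -/
theorem clsBarC_mul_chebSeq (hζ : IsPrimitiveRoot ζ d) (hd : 2 < d) :
    clsBarC hs * chebSeq (clsBarC hs) d =
      (T 1 + T (-1) : LaurentPolynomial ℤ) • chebSeq (clsBarC hs) d := by
  obtain ⟨e⟩ := iso_pair_full hζ (by omega) 0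
  have h := MemB.arc hζ hd 0 le_rfl
  have e1 := clsBar_iso hs (MemB.tensor _ _ MemB.gen h) (MemB.sum _ _ h (MemB.shift _ _ h)) e
  rw [clsBar_tensor hs MemB.gen h, clsBar_sum hs h (MemB.shift _ _ h), clsBar_shift hs h,
    clsBar_gen, clsBar_arc hs hζ hd 0 le_rfl, smul_mul_smul_comm] at e1
  -- Multiplying by v^d removes the normalizing powers of v: one factor v⁻¹ comes from the class of
  -- `𝒪(e, s)` and v^{1-d} from the full arc.
  have e2 := congrArg (fun x => (T (d : ℤ) : LaurentPolynomial ℤ) • x) e1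
  simp only [smul_smul, smul_add, ← T_add] at e2
  rw [add_smul]
  convert e2 using 2
  · rw [show (d : ℤ) + (-1 + (1 - d)) = 0 by ring, T_zero, one_smul]
  · congr 2; ring
  · congr 2; ring

end clsBar

/-! ### The defining polynomial and the algebra that it presents. -/

/-- The minimal polynomial of `T_s`. -/
noncomputable def heckePoly (d : ℕ) : Polynomial (LaurentPolynomial ℤ) :=
  (Polynomial.X - Polynomial.C (T (-1) : LaurentPolynomial ℤ)) *
    chebSeq (Polynomial.X + Polynomial.C (T 1 : LaurentPolynomial ℤ)) d

/-- In the recursion the product with X + a has degree two more than the subtracted term, so it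
determines the leading term. The index exceeds the degree by one because the sequence starts with 0,
1. -/
theorem monic_chebSeq {R : Type*} [CommRing R] [Nontrivial R] (a : R) (n : ℕ) :
    (chebSeq (Polynomial.X + Polynomial.C a) (n + 1)).Monic ∧
      (chebSeq (Polynomial.X + Polynomial.C a) (n + 1)).natDegree = n := by
  induction n using Nat.strong_induction_on with
  | _ n ih =>
    rcases n with _ | _ | n
    · simp [chebSeq]
    · have h : chebSeq (Polynomial.X + Polynomial.C a) (0 + 1 + 1) =
          Polynomial.X + Polynomial.C a := by
        simp [chebSeq]
      rw [h]
      exact ⟨Polynomial.monic_X_add_C a, Polynomial.natDegree_X_add_C a⟩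
    · obtain ⟨h1, h2⟩ := ih (n + 1) (by omega)
      obtain ⟨h3, h4⟩ := ih n (by omega)
      have h5 : ((Polynomial.X + Polynomial.C a) *
          chebSeq (Polynomial.X + Polynomial.C a) (n + 1 + 1)).Monic :=
        (Polynomial.monic_X_add_C a).mul h1
      have h6 : ((Polynomial.X + Polynomial.C a) *
          chebSeq (Polynomial.X + Polynomial.C a) (n + 1 + 1)).natDegree = n + 2 := by
        rw [(Polynomial.monic_X_add_C a).natDegree_mul h1, Polynomial.natDegree_X_add_C, h2]
        ring
      have h7 : (chebSeq (Polynomial.X + Polynomial.C a) (n + 1)).degree <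
          ((Polynomial.X + Polynomial.C a) *
            chebSeq (Polynomial.X + Polynomial.C a) (n + 1 + 1)).degree := by
        refine Polynomial.degree_lt_degree ?_
        rw [h4, h6]
        omega
      have h8 : chebSeq (Polynomial.X + Polynomial.C a) (n + 1 + 1 + 1) =
          (Polynomial.X + Polynomial.C a) * chebSeq (Polynomial.X + Polynomial.C a) (n + 1 + 1) -
            chebSeq (Polynomial.X + Polynomial.C a) (n + 1) := rfl
      rw [h8]
      exact ⟨h5.sub_of_left h7, by
        rw [Polynomial.natDegree_sub_eq_left_of_natDegree_lt (by rw [h4, h6]; omega), h6]⟩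

theorem monic_heckePoly {d : ℕ} (hd : 0 < d) : (heckePoly d).Monic := by
  obtain ⟨n, rfl⟩ : ∃ n, d = n + 1 := ⟨d - 1, by omega⟩
  exact (Polynomial.monic_X_sub_C _).mul (monic_chebSeq _ n).1

theorem natDegree_heckePoly {d : ℕ} (hd : 0 < d) : (heckePoly d).natDegree = d := by
  obtain ⟨n, rfl⟩ : ∃ n, d = n + 1 := ⟨d - 1, by omega⟩
  rw [heckePoly, (Polynomial.monic_X_sub_C _).natDegree_mul (monic_chebSeq _ n).1,
    Polynomial.natDegree_X_sub_C, (monic_chebSeq _ n).2, add_comm]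

/-- The constant term is -v⁻¹ U_d(v). Here U_d is a monic integral polynomial, so its value at the
indeterminate v is nonzero, and Laurent polynomials over ℤ form a domain. -/
theorem coeff_zero_heckePoly {d : ℕ} (hd : 0 < d) : (heckePoly d).coeff 0 ≠ 0 := by
  obtain ⟨n, rfl⟩ : ∃ n, d = n + 1 := ⟨d - 1, by omega⟩
  have h1 : (chebSeq (Polynomial.X + Polynomial.C (T 1 : LaurentPolynomial ℤ)) (n + 1)).coeff 0 =
      chebSeq (T 1 : LaurentPolynomial ℤ) (n + 1) := by
    rw [← Polynomial.constantCoeff_apply, map_chebSeq]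
    simp
  -- U_d(v) is viewed as an ordinary polynomial in v; the summand `Polynomial.C 0` puts it into the
  -- form covered by `monic_chebSeq`.
  have h2 : chebSeq (T 1 : LaurentPolynomial ℤ) (n + 1) =
      (chebSeq (Polynomial.X + Polynomial.C (0 : ℤ)) (n + 1)).toLaurent := by
    rw [map_chebSeq]
    simp [Polynomial.toLaurent_X]
  rw [heckePoly, Polynomial.mul_coeff_zero, h1, h2]
  refine mul_ne_zero ?_ (Polynomial.toLaurent_ne_zero.2 (monic_chebSeq _ n).1.ne_zero)
  simpa using (isUnit_T (R := ℤ) (-1)).ne_zero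

theorem aeval_heckePoly {d : ℕ} {Q : Type*} [Ring Q] [Algebra (LaurentPolynomial ℤ) Q] (x : Q) :
    Polynomial.aeval x (heckePoly d) =
      (x - algebraMap (LaurentPolynomial ℤ) Q (T (-1))) * chebSeq (x + algebraMap (LaurentPolynomial ℤ) Q (T 1)) d := by
  have h := map_chebSeq (Polynomial.aeval (R := LaurentPolynomial ℤ) x).toRingHom
    (Polynomial.X + Polynomial.C (T 1 : LaurentPolynomial ℤ)) d
  rw [heckePoly, map_mul]
  refine congrArg₂ (· * ·) (by simp) (h.trans ?_)
  simp

/-- With c = x + v one has x - v⁻¹ = c - (v + v⁻¹), so the factored polynomial encodes the relation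
of the full circle. -/
theorem aeval_heckePoly_eq_zero_iff {d : ℕ} {Q : Type*} [Ring Q] [Algebra (LaurentPolynomial ℤ) Q]
    (x : Q) : Polynomial.aeval x (heckePoly d) = 0 ↔
      (x + algebraMap (LaurentPolynomial ℤ) Q (T 1)) * chebSeq (x + algebraMap (LaurentPolynomial ℤ) Q (T 1)) d =
        (T 1 + T (-1) : LaurentPolynomial ℤ) • chebSeq (x + algebraMap (LaurentPolynomial ℤ) Q (T 1)) d := by
  have h : (x - algebraMap (LaurentPolynomial ℤ) Q (T (-1))) * chebSeq (x + algebraMap (LaurentPolynomial ℤ) Q (T 1)) d =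
      (x + algebraMap (LaurentPolynomial ℤ) Q (T 1)) * chebSeq (x + algebraMap (LaurentPolynomial ℤ) Q (T 1)) d -
        (T 1 + T (-1) : LaurentPolynomial ℤ) • chebSeq (x + algebraMap (LaurentPolynomial ℤ) Q (T 1)) d := by
    rw [Algebra.smul_def, ← sub_mul, map_add]
    congr 1
    abel
  rw [aeval_heckePoly, h, sub_eq_zero]

/-- The generator `C = T_s + v` in the presented algebra. -/
noncomputable def rootC (d : ℕ) : AdjoinRoot (heckePoly d) :=
  AdjoinRoot.root (heckePoly d) + algebraMap (LaurentPolynomial ℤ) _ (T 1)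

/-- This is the one condition under which `Good.of_dec` makes the character with parameter `rootC d`
multiplicative. -/
theorem rootC_mul_chebSeq (d : ℕ) : rootC d * chebSeq (rootC d) d =
    (T 1 + T (-1) : LaurentPolynomial ℤ) • chebSeq (rootC d) d :=
  (aeval_heckePoly_eq_zero_iff _).1 (by rw [AdjoinRoot.aeval_eq, AdjoinRoot.mk_self])

/-! ### The character of the Grothendieck ring inverts T ↦ T_s. -/

section presentation

variable {ζ : ℂ} {d : ℕ}

/-- The character on isomorphism classes. -/
noncomputable def characterHom (hζ : IsPrimitiveRoot ζ d) (hd : 2 < d) :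
    IsoClass ζ →* AdjoinRoot (heckePoly d) where
  toFun := Quotient.lift (fun M => character ζ d (rootC d) M.1)
    (fun _ N ⟨e⟩ => character_iso hζ (N.2.dec hζ hd) e)
  map_one' := character_unit hζ hd
  map_mul' x y := by
    induction x using Quotient.inductionOn with
    | h M =>
      induction y using Quotient.inductionOn with
      | h N =>
        have h := Good.of_dec hζ hd (rootC_mul_chebSeq d) (M.2.dec hζ hd)
        exact h.character_tensor N.1 (N.2.dec hζ hd)

/-- The character of the split Grothendieck ring. -/
noncomputable def characterAW (hζ : IsPrimitiveRoot ζ d) (hd : 2 < d) :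
    AW ζ →ₐ[LaurentPolynomial ℤ] AdjoinRoot (heckePoly d) :=
  RingQuot.liftAlgHom _ ⟨MonoidAlgebra.lift _ _ _ (characterHom hζ hd), by
    intro x y h
    induction h with
    | sum M N hM hN =>
      rw [map_add, MonoidAlgebra.lift_of, MonoidAlgebra.lift_of, MonoidAlgebra.lift_of]
      exact character_sum hζ (hM.dec hζ hd) (hN.dec hζ hd)
    | shift M hM =>
      rw [map_smul, MonoidAlgebra.lift_of, MonoidAlgebra.lift_of]
      exact character_shift hζ (hM.dec hζ hd) 1⟩

theorem characterAW_cls (hζ : IsPrimitiveRoot ζ d) (hd : 2 < d) (M : GrBimod) (hM : MemB ζ M) :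
    characterAW hζ hd (cls M hM) = character ζ d (rootC d) M := by
  rw [characterAW, cls, RingQuot.liftAlgHom_mkAlgHom_apply, MonoidAlgebra.lift_of]
  rfl

/-- The character of the quotient of the split Grothendieck ring. -/
noncomputable def characterAWbar (hζ : IsPrimitiveRoot ζ d) (hd : 2 < d)
    (hs : MemB ζ (coordRing {ζ})) :
    AWbar hs →ₐ[LaurentPolynomial ℤ] AdjoinRoot (heckePoly d) :=
  RingQuot.liftAlgHom _ ⟨characterAW hζ hd, by
    rintro x y ⟨rfl, rfl⟩
    rw [characterAW_cls, map_one, character_single hζ hd]⟩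

theorem characterAWbar_clsBar (hζ : IsPrimitiveRoot ζ d) (hd : 2 < d)
    (hs : MemB ζ (coordRing {ζ})) (M : GrBimod) (hM : MemB ζ M) :
    characterAWbar hζ hd hs (clsBar hs M hM) = character ζ d (rootC d) M := by
  rw [characterAWbar, clsBar, RingQuot.liftAlgHom_mkAlgHom_apply, characterAW_cls]

theorem characterAWbar_Ts (hζ : IsPrimitiveRoot ζ d) (hd : 2 < d)
    (hs : MemB ζ (coordRing {ζ})) :
    characterAWbar hζ hd hs (Ts hs) = AdjoinRoot.root (heckePoly d) := by
  have h := congrArg (characterAWbar hζ hd hs) (clsBarC_eq hs)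
  rw [clsBarC, map_add, AlgHom.commutes, map_smul, characterAWbar_clsBar, character_gen hζ hd,
    smul_smul, ← T_add, add_neg_cancel, T_zero, one_smul, rootC] at h
  exact add_right_cancel h

/-- The homomorphism that maps the root to `T_s`. -/
noncomputable def rootHom (hζ : IsPrimitiveRoot ζ d) (hd : 2 < d) (hs : MemB ζ (coordRing {ζ})) :
    AdjoinRoot (heckePoly d) →ₐ[LaurentPolynomial ℤ] AWbar hs :=
  -- Commutativity of the target is only a consequence of the presentation; evaluating polynomials
  -- at the single element T_s does not need it.
  Ideal.Quotient.liftₐ (Ideal.span {heckePoly d}) (Polynomial.aeval (Ts hs)) (fun p hp => by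
    obtain ⟨q, rfl⟩ := Ideal.mem_span_singleton.1 hp
    rw [map_mul, (aeval_heckePoly_eq_zero_iff (Ts hs)).2 (clsBarC_mul_chebSeq hs hζ hd), zero_mul])

theorem rootHom_root (hζ : IsPrimitiveRoot ζ d) (hd : 2 < d) (hs : MemB ζ (coordRing {ζ})) :
    rootHom hζ hd hs (AdjoinRoot.root (heckePoly d)) = Ts hs :=
  Polynomial.aeval_X (Ts hs)

theorem rootHom_rootC (hζ : IsPrimitiveRoot ζ d) (hd : 2 < d) (hs : MemB ζ (coordRing {ζ})) :
    rootHom hζ hd hs (rootC d) = clsBarC hs := by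
  rw [rootC, map_add, rootHom_root, AlgHom.commutes, clsBarC]

/-- Both sides are additive and compatible with shifts, and on an arc of length k both are v^{1-k}
U_k(C). So the class of an object can be recovered from its character, which makes `rootHom` a left
inverse of `characterAWbar`. -/
theorem rootHom_character (hζ : IsPrimitiveRoot ζ d) (hd : 2 < d) (hs : MemB ζ (coordRing {ζ}))
    (M : GrBimod) (hM : MemB ζ M) :
    rootHom hζ hd hs (character ζ d (rootC d) M) = clsBar hs M hM := by
  have key : ∀ hM : MemB ζ M, rootHom hζ hd hs (character ζ d (rootC d) M) = clsBar hs M hM := by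
    refine (hM.dec hζ hd).induction (motive := fun M => ∀ hM : MemB ζ M,
      rootHom hζ hd hs (character ζ d (rootC d) M) = clsBar hs M hM) ?_ ?_ ?_ ?_ ?_
    · rintro M N ⟨e⟩ ih hM
      have hN := hM.iso e
      rw [character_iso hζ (hN.dec hζ hd) e, ih hN, clsBar_iso hs hM hN e]
    · intro hM
      rw [character_subsingleton hζ, map_zero, clsBar_subsingleton]
    · intro M N dM dN ihM ihN h
      -- The induction runs over sums of arcs, so membership in `ℬ_W` has to be passed down to the
      -- parts: to summands here, and by the opposite shift in the next case.
      have hM : MemB ζ M := MemB.summand _ M N h ⟨Iso.refl _⟩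
      have hN : MemB ζ N := MemB.summand _ N M h ⟨Iso.sumComm _ _⟩
      rw [character_sum hζ dM dN, map_add, ihM hM, ihN hN, ← clsBar_sum]
    · intro M n dM ihM h
      have hM : MemB ζ M := (MemB.shift _ (-n) h).iso ((Iso.shiftShift M n (-n)).trans
        ((Iso.ofEq (by rw [add_neg_cancel])).trans (Iso.shiftZero M)))
      rw [character_shift hζ dM, map_smul, ihM hM, ← clsBar_shift]
    · intro a k h1 hk hM
      rw [character_arc hζ a hk, map_smul, clsBar_arc hs hζ hd a hk, ← rootHom_rootC hζ hd]
      congr 1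
      exact map_chebSeq (rootHom hζ hd hs).toRingHom _ _
  exact key hM

/-- The presentation of `A_W / (s = 1)`. -/
noncomputable def presentation (hζ : IsPrimitiveRoot ζ d) (hd : 2 < d)
    (hs : MemB ζ (coordRing {ζ})) :
    AdjoinRoot (heckePoly d) ≃ₐ[LaurentPolynomial ℤ] AWbar hs :=
  AlgEquiv.ofAlgHom (rootHom hζ hd hs) (characterAWbar hζ hd hs)
    (by
      -- The two successive quotients are removed, which reduces the claim to classes of objects,
      -- that is, to `rootHom_character`.
      apply RingQuot.ringQuot_ext'
      apply RingQuot.ringQuot_ext'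
      refine MonoidAlgebra.algHom_ext (fun x => ?_) (Subsingleton.elim _ _)
      induction x using Quotient.inductionOn with
      | h M =>
        change rootHom hζ hd hs (characterAWbar hζ hd hs (clsBar hs M.1 M.2)) =
          clsBar hs M.1 M.2
        rw [characterAWbar_clsBar, rootHom_character])
    (by
      refine AdjoinRoot.algHom_ext ?_
      rw [AlgHom.comp_apply, rootHom_root, characterAWbar_Ts]
      rfl)

theorem presentation_root (hζ : IsPrimitiveRoot ζ d) (hd : 2 < d)
    (hs : MemB ζ (coordRing {ζ})) :
    presentation hζ hd hs (AdjoinRoot.root (heckePoly d)) = Ts hs := rootHom_root hζ hd hs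

end presentation

end SoergelRankOne

/-! ### Specializations of the generic Hecke algebra. -/

namespace SoergelRankOne

open LaurentPolynomial

theorem aeval_eq_of_monic {R B : Type*} [CommRing R] [CommRing B] [Algebra R B]
    {P : Polynomial R} (hP : P.Monic) {d : ℕ} (hd : P.natDegree = d) (x : B) :
    Polynomial.aeval x P = x ^ d + ∑ i : Fin d, algebraMap R B (P.coeff i) * x ^ (i : ℕ) := by
  conv_lhs => rw [hP.as_sum]
  rw [hd, map_add, map_pow, Polynomial.aeval_X, map_sum,
    Fin.sum_univ_eq_sum_range (fun i => algebraMap R B (P.coeff i) * x ^ i)]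
  simp

/-- Writing P = Q X + P(0) gives Q(x) x = -P(0), so x divides a unit. -/
theorem isUnit_of_aeval_eq_zero {R B : Type*} [CommRing R] [CommRing B] [Algebra R B]
    {P : Polynomial R} {x : B} (hx : Polynomial.aeval x P = 0)
    (h : IsUnit (algebraMap R B (P.coeff 0))) : IsUnit x := by
  rw [← P.divX_mul_X_add, map_add, map_mul, Polynomial.aeval_X, Polynomial.aeval_C] at hx
  rw [eq_neg_of_add_eq_zero_right hx, IsUnit.neg_iff] at h
  exact isUnit_of_mul_isUnit_right h

section Hecke

variable {d : ℕ} [NeZero d]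

theorem heckeSigma_relation : heckeSigma d ^ d +
    ∑ i : Fin d, algebraMap (HeckeParam d) (GenericHecke d) (heckeU d i) *
      heckeSigma d ^ (i : ℕ) = 0 := by
  have h : Ideal.Quotient.mk (heckeIdeal d) (T (d : ℤ) + ∑ i : Fin d,
      LaurentPolynomial.C (heckeU d i) * T ((i : ℕ) : ℤ)) = 0 :=
    Ideal.Quotient.eq_zero_iff_mem.2 (Ideal.subset_span rfl)
  have hT : ∀ n : ℕ, (T (n : ℤ) : LaurentPolynomial (HeckeParam d)) = T 1 ^ n := fun n => by
    rw [T_pow, mul_one]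
  simp only [map_add, map_sum, map_mul, hT, map_pow] at h
  exact h

/-- A homomorphism out of the generic Hecke algebra is given by the images of the parameters and
an invertible image of `σ` that satisfies the relation. -/
theorem exists_heckeLift {B : Type*} [CommRing B] (φ : HeckeParam d →+* B) (s : Bˣ)
    (hs : (s : B) ^ d + ∑ i : Fin d, φ (heckeU d i) * (s : B) ^ (i : ℕ) = 0) :
    ∃ g : GenericHecke d →+* B, (∀ u, g (algebraMap (HeckeParam d) (GenericHecke d) u) = φ u) ∧
      g (heckeSigma d) = s := by
  let g₀ : LaurentPolynomial (HeckeParam d) →+* B := LaurentPolynomial.eval₂ φ s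
  have hT : ∀ n : ℕ, g₀ (T (n : ℤ)) = (s : B) ^ n := fun n => by simp [g₀]
  have hC : ∀ u, g₀ (LaurentPolynomial.C u) = φ u := fun u => by simp [g₀]
  let g : LaurentPolynomial (HeckeParam d) ⧸ heckeIdeal d →+* B :=
    Ideal.Quotient.lift (heckeIdeal d) g₀ fun p hp => by
      obtain ⟨q, rfl⟩ := Ideal.mem_span_singleton.1 hp
      rw [map_mul, map_add, map_sum, hT]
      simp only [map_mul, hT, hC]
      rw [hs, zero_mul]
  refine ⟨g, hC, ?_⟩
  have h := hT 1
  rw [Nat.cast_one, pow_one] at h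
  exact h

/-- The algebra is a quotient of Laurent polynomials, and these are a localization of the
polynomials in σ. Agreement on parameters and on σ therefore includes agreement on σ⁻¹. -/
theorem hecke_hom_ext {B : Type*} [CommRing B] {f g : GenericHecke d →+* B}
    (h : ∀ u, f (algebraMap (HeckeParam d) (GenericHecke d) u) =
      g (algebraMap (HeckeParam d) (GenericHecke d) u))
    (hσ : f (heckeSigma d) = g (heckeSigma d)) : f = g := by
  refine Ideal.Quotient.ringHom_ext (I := heckeIdeal d) ?_
  refine IsLocalization.ringHom_ext (Submonoid.powers (Polynomial.X : Polynomial (HeckeParam d)))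
    (Polynomial.ringHom_ext (fun u => ?_) ?_)
  · simp only [RingHom.comp_apply, algebraMap_eq_toLaurent, Polynomial.toLaurent_C]
    exact h u
  · simp only [RingHom.comp_apply, algebraMap_eq_toLaurent, Polynomial.toLaurent_X]
    exact hσ

variable {K : Type} [CommRing K] (φ : HeckeParam d →+* K)

/-- The canonical homomorphism from the generic Hecke algebra to a specialization. -/
noncomputable def toSpecialized : GenericHecke d →+* SpecializedHecke φ :=
  letI := φ.toAlgebra
  (Algebra.TensorProduct.includeRight : GenericHecke d →ₐ[HeckeParam d] K ⊗[HeckeParam d]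
    GenericHecke d).toRingHom

theorem toSpecialized_sigma : toSpecialized φ (heckeSigma d) = specializedSigma φ := rfl

theorem toSpecialized_algebraMap (u : HeckeParam d) :
    toSpecialized φ (algebraMap (HeckeParam d) (GenericHecke d) u) =
      algebraMap K (SpecializedHecke φ) (φ u) := by
  let := φ.toAlgebra
  exact ((Algebra.TensorProduct.includeRight : GenericHecke d →ₐ[HeckeParam d] K ⊗[HeckeParam d]
    GenericHecke d).commutes u).trans rfl

theorem exists_specializedLift {B : Type*} [CommRing B] [Algebra K B] (g : GenericHecke d →+* B)
    (hg : ∀ u, g (algebraMap (HeckeParam d) (GenericHecke d) u) = algebraMap K B (φ u)) :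
    ∃ G : SpecializedHecke φ →ₐ[K] B, ∀ h, G (toSpecialized φ h) = g h := by
  let := φ.toAlgebra
  let : Algebra (HeckeParam d) B := ((algebraMap K B).comp φ).toAlgebra
  have : IsScalarTower (HeckeParam d) K B := IsScalarTower.of_algebraMap_eq fun _ => rfl
  let g' : GenericHecke d →ₐ[HeckeParam d] B := { g with commutes' := hg }
  refine ⟨Algebra.TensorProduct.lift (Algebra.ofId K B) g' (fun _ _ => Commute.all _ _), ?_⟩
  intro h
  refine (Algebra.TensorProduct.lift_tmul _ _ _ _ _).trans ?_
  rw [map_one, one_mul]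
  rfl

/-- The scalars of K are fixed, and the parameters act through K, so by `hecke_hom_ext` only the
image of σ is free. -/
theorem specialized_hom_ext {B : Type*} [CommRing B] [Algebra K B]
    {f g : SpecializedHecke φ →ₐ[K] B} (h : f (specializedSigma φ) = g (specializedSigma φ)) :
    f = g := by
  have key : f.toRingHom.comp (toSpecialized φ) = g.toRingHom.comp (toSpecialized φ) := by
    refine hecke_hom_ext (fun u => ?_) h
    change f (toSpecialized φ _) = g (toSpecialized φ _)
    rw [toSpecialized_algebraMap, AlgHom.commutes, AlgHom.commutes]
  let := φ.toAlgebra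
  let : Algebra (HeckeParam d) B := ((algebraMap K B).comp φ).toAlgebra
  have : IsScalarTower (HeckeParam d) K B := IsScalarTower.of_algebraMap_eq fun _ => rfl
  refine Algebra.TensorProduct.ext (A := K) (B := GenericHecke d) (Subsingleton.elim _ _) ?_
  refine AlgHom.ext fun x => ?_
  exact congrArg (fun F : GenericHecke d →+* B => F x) key

/-- The specialization of the generic Hecke algebra is presented by one generator. -/
theorem exists_specialized_equiv {R : Type} [CommRing R] [Algebra R K] {P : Polynomial R}
    (hP : P.Monic) (hd : P.natDegree = d) (hu : IsUnit (algebraMap R K (P.coeff 0)))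
    (hφ : ∀ i : Fin d, φ (heckeU d i) = algebraMap R K (P.coeff i)) :
    ∃ f : K ⊗[R] AdjoinRoot P ≃ₐ[K] SpecializedHecke φ,
      f (1 ⊗ₜ AdjoinRoot.root P) = specializedSigma φ := by
  let : Algebra R (SpecializedHecke φ) :=
    ((algebraMap K (SpecializedHecke φ)).comp (algebraMap R K)).toAlgebra
  have : IsScalarTower R K (SpecializedHecke φ) := IsScalarTower.of_algebraMap_eq fun _ => rfl
  have h1 : Polynomial.aeval (specializedSigma φ) P = 0 := by
    rw [aeval_eq_of_monic hP hd]
    have h := congrArg (toSpecialized φ) (heckeSigma_relation (d := d))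
    simp only [map_add, map_sum, map_mul, map_pow, map_zero, toSpecialized_algebraMap,
      toSpecialized_sigma, hφ] at h
    exact h
  let F : K ⊗[R] AdjoinRoot P →ₐ[K] SpecializedHecke φ :=
    Algebra.TensorProduct.lift (Algebra.ofId K _)
      (AdjoinRoot.liftAlgHom P (Algebra.ofId R _) (specializedSigma φ) h1)
      (fun _ _ => Commute.all _ _)
  have hF : F (1 ⊗ₜ AdjoinRoot.root P) = specializedSigma φ := by
    refine (Algebra.TensorProduct.lift_tmul _ _ _ _ _).trans ?_
    rw [map_one, one_mul]
    exact AdjoinRoot.lift_root h1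
  have h2 : Polynomial.aeval ((1 : K) ⊗ₜ[R] AdjoinRoot.root P) P = 0 := by
    have h := Polynomial.aeval_algHom_apply
      (Algebra.TensorProduct.includeRight : AdjoinRoot P →ₐ[R] K ⊗[R] AdjoinRoot P)
      (AdjoinRoot.root P) P
    rw [AdjoinRoot.aeval_eq, AdjoinRoot.mk_self, map_zero] at h
    exact h
  have h3 : IsUnit (algebraMap R (K ⊗[R] AdjoinRoot P) (P.coeff 0)) := by
    rw [IsScalarTower.algebraMap_apply R K]
    exact hu.map _
  -- The generator σ is invertible, so its image has to be a unit. This is the place where the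
  -- constant term of P has to be invertible in K.
  obtain ⟨s, hs⟩ := isUnit_of_aeval_eq_zero h2 h3
  obtain ⟨g, hg, hgσ⟩ := exists_heckeLift
    ((algebraMap K (K ⊗[R] AdjoinRoot P)).comp φ) s (by
      rw [aeval_eq_of_monic hP hd, ← hs] at h2
      simp only [RingHom.comp_apply, hφ, ← IsScalarTower.algebraMap_apply]
      exact h2)
  obtain ⟨G, hG⟩ := exists_specializedLift φ g hg
  have hGσ : G (specializedSigma φ) = 1 ⊗ₜ AdjoinRoot.root P := by
    rw [← toSpecialized_sigma, hG, hgσ, hs]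
  refine ⟨AlgEquiv.ofAlgHom F G (specialized_hom_ext φ ?_) ?_, hF⟩
  · rw [AlgHom.comp_apply, hGσ, hF]
    rfl
  · refine Algebra.TensorProduct.ext (Subsingleton.elim _ _) (AdjoinRoot.algHom_ext ?_)
    change G (F (1 ⊗ₜ AdjoinRoot.root P)) = 1 ⊗ₜ AdjoinRoot.root P
    rw [hF, hGσ]

end Hecke

end SoergelRankOne

theorem mainTheorem6 (d : ℕ) [NeZero d] (hd : 2 < d) (ζ : ℂ) (hζ : IsPrimitiveRoot ζ d) :
    ∃ hs : SoergelRankOne.MemB ζ (SoergelRankOne.GrBimod.coordRing {ζ}),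
    ∃ P : Polynomial (LaurentPolynomial ℤ), P.Monic ∧ P.natDegree = d ∧
      (∃ e : AdjoinRoot P ≃ₐ[LaurentPolynomial ℤ] SoergelRankOne.AWbar hs,
        e (AdjoinRoot.root P) = SoergelRankOne.Ts hs) ∧
      P.coeff 0 ≠ 0 ∧
      ∃ φ : SoergelRankOne.HeckeParam d →+* Localization.Away (P.coeff 0),
        (∀ i : Fin d, φ (SoergelRankOne.heckeU d i) =
          algebraMap (LaurentPolynomial ℤ) (Localization.Away (P.coeff 0)) (P.coeff i)) ∧
        ∃ f : TensorProduct (LaurentPolynomial ℤ) (Localization.Away (P.coeff 0))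
            (SoergelRankOne.AWbar hs) ≃ₐ[Localization.Away (P.coeff 0)]
            SoergelRankOne.SpecializedHecke φ,
          f (TensorProduct.tmul (LaurentPolynomial ℤ) 1 (SoergelRankOne.Ts hs)) =
            SoergelRankOne.specializedSigma φ := by
  have h0 : 0 < d := by omega
  have hs := SoergelRankOne.MemB.single hζ hd
  have hP := SoergelRankOne.monic_heckePoly h0
  have hPd := SoergelRankOne.natDegree_heckePoly h0
  have hu : IsUnit (algebraMap (LaurentPolynomial ℤ)
      (Localization.Away ((SoergelRankOne.heckePoly d).coeff 0))
      ((SoergelRankOne.heckePoly d).coeff 0)) := IsLocalization.Away.algebraMap_isUnit _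
  -- The parameters u_i are sent to the coefficients of the polynomial. Since u_0 goes to the
  -- inverted constant term, the map extends to the localization `HeckeParam d`.
  let φ₀ : MvPolynomial (Fin d) ℤ →+* Localization.Away ((SoergelRankOne.heckePoly d).coeff 0) :=
    MvPolynomial.eval₂Hom (Int.castRingHom _) fun i => algebraMap _ _
      ((SoergelRankOne.heckePoly d).coeff i)
  have hφ₀ : IsUnit (φ₀ (MvPolynomial.X 0)) := by
    simpa [φ₀] using hu
  let φ : SoergelRankOne.HeckeParam d →+*
      Localization.Away ((SoergelRankOne.heckePoly d).coeff 0) :=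
    IsLocalization.Away.lift (MvPolynomial.X 0) hφ₀
  have hφ : ∀ i : Fin d, φ (SoergelRankOne.heckeU d i) = algebraMap (LaurentPolynomial ℤ)
      (Localization.Away ((SoergelRankOne.heckePoly d).coeff 0))
      ((SoergelRankOne.heckePoly d).coeff i) := fun i => by
    rw [SoergelRankOne.heckeU, IsLocalization.Away.lift_eq]
    simp [φ₀]
  let e := SoergelRankOne.presentation hζ hd hs
  have he : e (AdjoinRoot.root _) = SoergelRankOne.Ts hs :=
    SoergelRankOne.presentation_root hζ hd hs
  obtain ⟨f, hf⟩ := SoergelRankOne.exists_specialized_equiv φ hP hPd hu hφ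
  refine ⟨hs, SoergelRankOne.heckePoly d, hP, hPd, ⟨e, he⟩,
    SoergelRankOne.coeff_zero_heckePoly h0, φ, hφ,
    -- The presentation is base changed to the localization and then composed with the comparison of
    -- the presented algebra and the specialized Hecke algebra.
    (Algebra.TensorProduct.congr AlgEquiv.refl e.symm).trans f, ?_⟩
  rw [AlgEquiv.trans_apply, Algebra.TensorProduct.congr_apply, Algebra.TensorProduct.map_tmul,
    ← hf]
  congr 2
  rw [← he]
  exact e.symm_apply_apply _
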